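/- Let $n,k\ge 1$. Let $\mathcal W=(W_{ij}\in\mathbb R^{k\times k} : i\neq j\in[n])$ with $W_{ji}=W_{ij}^{T}$, let $\theta\in\mathbb R^{[n]\times[k]}$, and let $\mathcal D=\mathcal D(\mathcal W,\theta)$ be the non-binary Ising model on $[k]^n$, $$\Pr_{X\sim\mathcal D}[X=x]\;\propto\;\exp\Big(\sum_{\{i,j\}:\,i\ne j}W_{ij}(x_i,x_j)+\sum_{i}\theta_i(x_i)\Big),$$ where each unordered pair is counted once. Assume that the matrices $W_{ij}$ are centered (all rows and all columns sum to $0$). The width of $\mathcal D$ is $\max_{i,a}\big(\sum_{j\ne i}\max_b|W_{ij}(a,b)|+|\theta_i(a)|\big)$. The dependency graph of $\mathcal D$ has vertex set $[n]$ and an edge $\{i,j\}$ exactly when $W_{ij}\ne 0$. $\mathcal D$ is $\eta$-identifiable if $\max_{a,b}|W_{ij}(a,b)|\ge\eta$ for every edge $\{i,j\}$. **Theorem.** There are a single algorithm and an absolute constant $C>0$ such that the following holds for all $n,k\ge1$, all $\lambda\in\mathbb R$ and $\eta,\rho\in(0,1)$, and every integer $$N\;\ge\; C\,\frac{e^{C\lambda}}{\eta^4}\,k^3\,\log\frac{n}{\rho\eta}.$$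 Let $\mathcal D$ be any $\eta$-identifiable non-binary Ising model on $[k]^n$ with centered interaction matrices and width at most $\lambda$. Given $n,k,N,\lambda,\eta,\rho$ and $N$ independent samples $Z^1,\dots,Z^N$ from $\mathcal D$, the algorithm outputs exactly the dependency graph of $\mathcal D$ with probability at least $1-\rho$. For every input sequence the algorithm runs in total time at most $C k^2n^2N$. It is online: it sees the samples one at a time, spends at most $C k^2n^2$ time on each of them, and carries from one sample to the next only a number of memory cells bounded in terms of $n$ and $k$, independently of $N$. Time is counted on a uniform real random access machine with unit-cost real arithmetic, $\exp$, $\log$ and comparisons, and addition and truncated subtraction of natural numbers. -/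

import Mathlib

open MeasureTheory
open scoped ENNReal

/-! ## Non-binary Ising models -/

/-- Parameters of a pairwise graphical model on `n` variables over an alphabet of size `k`:
an interaction matrix for every pair of distinct variables and a field for every variable.
The interaction of the unordered pair `{i, j}` is stored in both orders, `W j i` being the
transpose of `W i j`.  The diagonal entries `W i i` are never used. -/
structure NonbinaryIsing (n k : ℕ) where
  W : Fin n → Fin n → Matrix (Fin k) (Fin k) ℝ
  θ : Fin n → Fin k → ℝ
  transpose_eq : ∀ i j, i ≠ j → W j i = (W i j).transpose

namespace NonbinaryIsing

variable {n k : ℕ}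

/-- The exponent: every unordered pair `{i, j}` contributes `W i j (x i) (x j)` once. -/
def energy (D : NonbinaryIsing n k) (x : Fin n → Fin k) : ℝ :=
  (∑ i, ∑ j, if i < j then D.W i j (x i) (x j) else 0) + ∑ i, D.θ i (x i)

/-- The unnormalised weight `exp (energy x)`. -/
noncomputable def weight (D : NonbinaryIsing n k) (x : Fin n → Fin k) : ℝ≥0∞ :=
  ENNReal.ofReal (Real.exp (D.energy x))

theorem tsum_weight_ne_zero [NeZero k] (D : NonbinaryIsing n k) :
    ∑' x, D.weight x ≠ 0 := by
  intro h
  have h1 := ENNReal.tsum_eq_zero.mp h (fun _ => 0)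
  simp only [weight, ENNReal.ofReal_eq_zero] at h1
  exact absurd (Real.exp_pos (D.energy fun _ => 0)) (not_lt.mpr h1)

theorem tsum_weight_ne_top (D : NonbinaryIsing n k) : ∑' x, D.weight x ≠ ∞ := by
  rw [tsum_fintype]
  exact ENNReal.sum_ne_top.mpr fun x _ => ENNReal.ofReal_ne_top

/-- The distribution on `[k]^n` with `Pr[X = x]` proportional to `exp (energy x)`. -/
noncomputable def dist [NeZero k] (D : NonbinaryIsing n k) : PMF (Fin n → Fin k) :=
  PMF.normalize D.weight D.tsum_weight_ne_zero D.tsum_weight_ne_top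

/-- The width `max_{i,a} (∑_{j ≠ i} max_b |W_ij(a,b)| + |θ_i(a)|)`. -/
noncomputable def width (D : NonbinaryIsing n k) : ℝ :=
  ⨆ p : Fin n × Fin k,
    ((∑ j ∈ Finset.univ.erase p.1, ⨆ b : Fin k, |D.W p.1 j p.2 b|) + |D.θ p.1 p.2|)

/-- All rows and columns of all interaction matrices sum to zero. -/
def IsCentered (D : NonbinaryIsing n k) : Prop :=
  ∀ i j, i ≠ j → (∀ a, ∑ b, D.W i j a b = 0) ∧ (∀ b, ∑ a, D.W i j a b = 0)

/-- The dependency graph: `{i, j}` is an edge exactly when `W_ij ≠ 0`. -/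
def dependencyGraph (D : NonbinaryIsing n k) : SimpleGraph (Fin n) where
  Adj i j := i ≠ j ∧ D.W i j ≠ 0
  symm := ⟨by
    rintro i j ⟨hij, hW⟩
    refine ⟨hij.symm, ?_⟩
    rw [D.transpose_eq i j hij]
    intro h
    exact hW (by rw [← Matrix.transpose_transpose (D.W i j), h, Matrix.transpose_zero])⟩
  loopless := ⟨fun _ h => h.1 rfl⟩

/-- Every edge of the dependency graph has `max_{a,b} |W_ij(a,b)| ≥ η`. -/
def IsIdentifiable (D : NonbinaryIsing n k) (η : ℝ) : Prop :=
  ∀ i j, D.dependencyGraph.Adj i j → η ≤ ⨆ p : Fin k × Fin k, |D.W i j p.1 p.2|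

end NonbinaryIsing

/-! ## Online algorithms on a real random access machine

A program is a fixed finite object, the same for all inputs.  It works with natural-number
registers and memory (for counting and addressing) and with real registers and memory, both
memories being indirectly addressable.  Every instruction and every test takes one unit of
time.  There is no multiplication of naturals, no rounding of reals, and the only constants
are natural numbers.  Loops are bounded loops, so every program halts; each such program is a
program of the usual real random access machine, with the same running time up to a constant
factor. -/

namespace RealRAM

/-- The configuration of the machine; `edges` is the write-only output. -/
structure State where
  nreg : ℕ → ℕ
  rreg : ℕ → ℝ
  nmem : ℕ → ℕ
  rmem : ℕ → ℝ
  edges : Set (ℕ × ℕ)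

/-- Instructions.  The first register is the target; all arguments are register names, except
for the literal in `const`. -/
inductive Instr where
  | const (r c : ℕ)
  | add (r a b : ℕ)
  | sub (r a b : ℕ)
  | load (r a : ℕ)
  | store (a r : ℕ)
  | readSample (r a : ℕ)
  | ofNat (r a : ℕ)
  | addR (r a b : ℕ)
  | subR (r a b : ℕ)
  | mulR (r a b : ℕ)
  | divR (r a b : ℕ)
  | expR (r a : ℕ)
  | logR (r a : ℕ)
  | loadR (r a : ℕ)
  | storeR (a r : ℕ)
  | emit (a b : ℕ)

/-- The effect of one instruction; `x` is the sample that is currently readable. -/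
noncomputable def Instr.exec (x : ℕ → ℕ) : Instr → State → State
  | .const r c, s => { s with nreg := Function.update s.nreg r c }
  | .add r a b, s => { s with nreg := Function.update s.nreg r (s.nreg a + s.nreg b) }
  | .sub r a b, s => { s with nreg := Function.update s.nreg r (s.nreg a - s.nreg b) }
  | .load r a, s => { s with nreg := Function.update s.nreg r (s.nmem (s.nreg a)) }
  | .store a r, s => { s with nmem := Function.update s.nmem (s.nreg a) (s.nreg r) }
  | .readSample r a, s => { s with nreg := Function.update s.nreg r (x (s.nreg a)) }
  | .ofNat r a, s => { s with rreg := Function.update s.rreg r (s.nreg a : ℝ) }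
  | .addR r a b, s => { s with rreg := Function.update s.rreg r (s.rreg a + s.rreg b) }
  | .subR r a b, s => { s with rreg := Function.update s.rreg r (s.rreg a - s.rreg b) }
  | .mulR r a b, s => { s with rreg := Function.update s.rreg r (s.rreg a * s.rreg b) }
  | .divR r a b, s => { s with rreg := Function.update s.rreg r (s.rreg a / s.rreg b) }
  | .expR r a, s => { s with rreg := Function.update s.rreg r (Real.exp (s.rreg a)) }
  | .logR r a, s => { s with rreg := Function.update s.rreg r (Real.log (s.rreg a)) }
  | .loadR r a, s => { s with rreg := Function.update s.rreg r (s.rmem (s.nreg a)) }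
  | .storeR a r, s => { s with rmem := Function.update s.rmem (s.nreg a) (s.rreg r) }
  | .emit a b, s => { s with edges := insert (s.nreg a, s.nreg b) s.edges }

/-- Programs. -/
inductive Program where
  | skip
  | instr (i : Instr)
  | seq (p q : Program)
  | ifLt (a b : ℕ) (p q : Program)
  | ifLtR (a b : ℕ) (p q : Program)
  | loop (a : ℕ) (p : Program)

/-- Run a program while the sample `x` is readable: the final state and the number of steps.
`loop a p` runs `p` as many times as register `a` says on entry, with one extra step per round
and one for the loop itself. -/
noncomputable def Program.run (x : ℕ → ℕ) : Program → State → State × ℕ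
  | .skip, s => (s, 1)
  | .instr i, s => (i.exec x s, 1)
  | .seq p q, s => ((q.run x (p.run x s).1).1, (p.run x s).2 + (q.run x (p.run x s).1).2)
  | .ifLt a b p q, s =>
      if s.nreg a < s.nreg b then ((p.run x s).1, (p.run x s).2 + 1)
      else ((q.run x s).1, (q.run x s).2 + 1)
  | .ifLtR a b p q, s =>
      if s.rreg a < s.rreg b then ((p.run x s).1, (p.run x s).2 + 1)
      else ((q.run x s).1, (q.run x s).2 + 1)
  | .loop a p, s =>
      (fun c : State × ℕ => ((p.run x c.1).1, c.2 + (p.run x c.1).2 + 1))^[s.nreg a] (s, 1)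

/-- An online algorithm: `setup` is run before any sample is seen, `update` is run once for
every sample in order of arrival, and `finish` is run at the end.  A sample is readable only
during its own update. -/
structure OnlineAlgorithm where
  setup : Program
  update : Program
  finish : Program

/-- The inputs other than the samples: number of variables, alphabet size, number of samples,
bound on the width, identifiability and confidence parameters. -/
structure Input where
  n : ℕ
  k : ℕ
  N : ℕ
  lam : ℝ
  η : ℝ
  ρ : ℝ

/-- The initial state: the inputs are in registers `0`, `1`, `2`, everything else is blank. -/
def Input.state (I : Input) : State where
  nreg r := if r = 0 then I.n else if r = 1 then I.k else if r = 2 then I.N else 0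
  rreg r := if r = 0 then I.lam else if r = 1 then I.η else if r = 2 then I.ρ else 0
  nmem _ := 0
  rmem _ := 0
  edges := ∅

/-- A sample `z ∈ [k]^n` as it is presented to the machine. -/
def encode {n k : ℕ} (z : Fin n → Fin k) (i : ℕ) : ℕ :=
  if h : i < n then (z ⟨i, h⟩ : ℕ) else 0

/-- No sample is readable. -/
def noSample (_ : ℕ) : ℕ := 0

namespace OnlineAlgorithm

variable (A : OnlineAlgorithm) (I : Input) (Z : Fin I.N → Fin I.n → Fin I.k)

/-- The sample readable in the `t`-th update. -/
def sample (t : ℕ) : ℕ → ℕ :=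
  if h : t < I.N then encode (Z ⟨t, h⟩) else noSample

/-- The state after the setup and the first `t` updates. -/
noncomputable def stateAfter : ℕ → State
  | 0 => (A.setup.run noSample I.state).1
  | t + 1 => (A.update.run (sample I Z t) (stateAfter t)).1

/-- The number of steps of the `t`-th update. -/
noncomputable def updateTime (t : ℕ) : ℕ :=
  (A.update.run (sample I Z t) (A.stateAfter I Z t)).2

/-- The number of steps of the whole run. -/
noncomputable def totalTime : ℕ :=
  (A.setup.run noSample I.state).2 + (∑ t ∈ Finset.range I.N, A.updateTime I Z t) +
    (A.finish.run noSample (A.stateAfter I Z I.N)).2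

/-- The graph on the variables whose edges are the pairs emitted by the algorithm. -/
noncomputable def graph : SimpleGraph (Fin I.n) :=
  SimpleGraph.fromRel fun i j =>
    ((i : ℕ), (j : ℕ)) ∈ (A.finish.run noSample (A.stateAfter I Z I.N)).1.edges

/-- The memory that is carried from one sample to the next is confined to `m` cells. -/
def UsesSpace (m : ℕ) : Prop :=
  ∀ t ≤ I.N, ∀ c, m ≤ c → (A.stateAfter I Z t).nmem c = 0 ∧ (A.stateAfter I Z t).rmem c = 0

end OnlineAlgorithm

end RealRAM

/-! Fix a variable i and a value a ≠ 0. Given the other coordinates and x_i ∈ {0, a}, the event x_i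
= a has probability σ(f), where σ is the sigmoid and the log-odds f (`logOdds`) is an intercept plus
one function of x_j for each j ≠ i; the suprema of these pieces add up to at most 2λ. Every pair (i,
a) is thus a logistic regression problem whose features are grouped by variable.

Learning. Each problem runs exponential weights over the experts (variable j, sign pattern on [k]),
scaled by 2λ. The mass of all 2^k sign patterns of a group is a product over its k cells, so a group
costs O(k) time, and the regret against f is at most 2λ((log n + k)/β + Nβ) (`regret_le`). The
expected regret increment is at least e^{-4λ}/(4k) times the mean squared prediction error
(`sum_prob_regret_ge`). Up to a deviation term the accumulated squared error of the predictions w is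
therefore small (`sum_sq_error_le`).

Testing. The learned coefficients are never compared with the true ones. For each j and b a
statistic adds up, over the samples with x_j = b, the residual against the prediction averaged over
x_j. As the matrices are centered, averaging f over x_j deletes exactly the contribution of x_j.
Hence the drift of the statistic, times k², is `signal` up to the L¹ prediction error
(`abs_drift_sub_signal_le`). The signal vanishes for a non-edge, and for an edge it is at least
e^{-6λ}η/4 in absolute value for some a, b (`exists_oddsCoef_of_adj`, `abs_signal_ge`). A threshold
halfway decides (`detects_iff_adj`).

Concentration. The predictor used on a sample depends on the earlier samples only, so an exponential
supermartingale gives a Bernstein bound (`measure_scan_deviation_le`). The test increments have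
second moment O(e^{4λ}/k²), and β of order η²/k balances the regret; both are compatible with N of
order k³/η⁴.

The program makes two passes per problem over its nk cells for every sample. Loop invariants
identify its memory with the scores and statistics above (`stateAfter_inv`). -/

/-! ## The logistic function -/

/-- The product equals 1 / (2 + e^x + e^{-x}), whose denominator is at most 4e^L. -/
theorem Real.le_sigmoid_mul_one_sub {x L : ℝ} (hx : |x| ≤ L) :
    Real.exp (-L) / 4 ≤ Real.sigmoid x * (1 - Real.sigmoid x) := by
  obtain ⟨h1, h2⟩ := abs_le.mp hx
  have hL : 0 ≤ L := (abs_nonneg x).trans hx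
  have e1 : Real.exp (-x) ≤ Real.exp L := Real.exp_le_exp.mpr (by linarith)
  have e2 : Real.exp x ≤ Real.exp L := Real.exp_le_exp.mpr h2
  have e3 : 1 ≤ Real.exp L := Real.one_le_exp hL
  have hp := Real.exp_pos x
  have hp' := Real.exp_pos (-x)
  have hm : Real.exp x * Real.exp (-x) = 1 := by rw [← Real.exp_add]; simp
  have hE : Real.sigmoid x * (1 - Real.sigmoid x) = 1 / (2 + Real.exp x + Real.exp (-x)) := by
    rw [Real.sigmoid_def]
    field_simp
    linear_combination hm
  rw [hE, Real.exp_neg, inv_eq_one_div, div_div]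
  exact one_div_le_one_div_of_le (by positivity) (by linarith)

theorem Real.sigmoid_sub_ge {u v L : ℝ} (hv : |v| ≤ L) (hu : |u| ≤ L) (huv : v ≤ u) :
    Real.exp (-L) / 4 * (u - v) ≤ Real.sigmoid u - Real.sigmoid v := by
  apply (convex_Icc (-L) L).mul_sub_le_image_sub_of_le_deriv
    (fun x _ => (Real.hasDerivAt_sigmoid x).continuousAt.continuousWithinAt)
    (fun x _ => (Real.hasDerivAt_sigmoid x).differentiableAt.differentiableWithinAt)
    _ v (abs_le.mp hv) u (abs_le.mp hu) huv
  intro x hx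
  rw [Real.deriv_sigmoid]
  exact Real.le_sigmoid_mul_one_sub (abs_le.mpr (Set.mem_Icc.mp (interior_subset hx)))

theorem Real.abs_sigmoid_sub_le (u v : ℝ) : |Real.sigmoid u - Real.sigmoid v| ≤ |u - v| := by
  have h := convex_univ.norm_image_sub_le_of_norm_deriv_le (f := Real.sigmoid) (C := 1)
    (fun x _ => (Real.hasDerivAt_sigmoid x).differentiableAt) (fun x _ => by
      rw [Real.deriv_sigmoid, Real.norm_eq_abs, abs_le]
      have := Real.sigmoid_pos x
      have := Real.sigmoid_lt_one x
      constructor <;> nlinarith) (Set.mem_univ v) (Set.mem_univ u)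
  simpa using h

/-- Strong monotonicity of the sigmoid on [-L, L]; it turns the drift of the regret into a squared
error. -/
theorem Real.sigmoid_sub_mul_sub_ge {u v L : ℝ} (hu : |u| ≤ L) (hv : |v| ≤ L) :
    Real.exp (-L) / 4 * (u - v) ^ 2 ≤ (Real.sigmoid u - Real.sigmoid v) * (u - v) := by
  rcases le_total v u with h | h
  · nlinarith [Real.sigmoid_sub_ge hv hu h]
  · nlinarith [Real.sigmoid_sub_ge hu hv h]

theorem Real.exp_le_one_add_add_sq {u : ℝ} (hu : |u| ≤ 1) : Real.exp u ≤ 1 + u + u ^ 2 := by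
  linarith [(abs_le.mp (Real.abs_exp_sub_one_sub_id_le hu)).2]

/-! ## Exponential weights over signed group indicators -/

namespace SignedHedge

variable {J B : Type*} [Fintype B]

/-- The mass `exp (β v) + exp (-β v)` of the two signs of a cell with score `v`. -/
noncomputable def slot (β v : ℝ) : ℝ := Real.exp (β * v) + Real.exp (-(β * v))

/-- The mean sign of a cell with score `v`, i.e. `tanh (β v)`. -/
noncomputable def meanSign (β v : ℝ) : ℝ :=
  (Real.exp (β * v) - Real.exp (-(β * v))) / slot β v

/-- The total mass of the sign patterns of group `j`. -/
noncomputable def groupWeight (β : ℝ) (S : J → B → ℝ) (j : J) : ℝ := ∏ b, slot β (S j b)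

theorem slot_pos (β v : ℝ) : 0 < slot β v := by unfold slot; positivity

theorem groupWeight_pos (β : ℝ) (S : J → B → ℝ) (j : J) : 0 < groupWeight β S j :=
  Finset.prod_pos fun _ _ => slot_pos _ _

theorem abs_meanSign_le (β v : ℝ) : |meanSign β v| ≤ 1 := by
  unfold meanSign
  rw [abs_div, abs_of_pos (slot_pos β v), div_le_one (slot_pos β v), abs_le]
  unfold slot
  have := Real.exp_pos (β * v)
  have := Real.exp_pos (-(β * v))
  constructor <;> linarith

theorem exp_abs_le_slot (β v : ℝ) : Real.exp |β * v| ≤ slot β v := by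
  unfold slot
  have := Real.exp_pos (β * v)
  have := Real.exp_pos (-(β * v))
  rcases abs_choice (β * v) with h | h <;> rw [h] <;> linarith

/-- Replacing both e^{±βc} by their quadratic bounds leaves the first-order terms ±βc, whose average
over the two signs is `meanSign`. -/
theorem slot_add_le {β v c : ℝ} (hc : |β * c| ≤ 1) :
    slot β (v + c) ≤ slot β v * (1 + β * c * meanSign β v + (β * c) ^ 2) := by
  have h1 : slot β v * meanSign β v = Real.exp (β * v) - Real.exp (-(β * v)) := by
    unfold meanSign; field_simp [(slot_pos β v).ne']
  have h2 := Real.exp_le_one_add_add_sq hc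
  have h3 := Real.exp_le_one_add_add_sq (u := -(β * c)) (by rwa [abs_neg])
  have h4 : slot β (v + c) = Real.exp (β * v) * Real.exp (β * c) +
      Real.exp (-(β * v)) * Real.exp (-(β * c)) := by
    unfold slot; rw [← Real.exp_add, ← Real.exp_add]; congr 2 <;> ring
  have h5 : slot β v * (1 + β * c * meanSign β v + (β * c) ^ 2) =
      slot β v * (1 + (β * c) ^ 2) + β * c * (slot β v * meanSign β v) := by ring
  rw [h4, h5, h1]
  unfold slot
  nlinarith [Real.exp_pos (β * v), Real.exp_pos (-(β * v))]

/-- A round moves a single score of each group, so one factor of the product changes. -/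
theorem groupWeight_update_le [DecidableEq B] {β c : ℝ} (hc : |β * c| ≤ 1) (S S' : J → B → ℝ)
    (x : J → B) (h : ∀ j b, S' j b = S j b + if x j = b then c else 0) (j : J) :
    groupWeight β S' j ≤
      groupWeight β S j * (1 + β * c * meanSign β (S j (x j)) + (β * c) ^ 2) := by
  unfold groupWeight
  rw [← Finset.mul_prod_erase _ _ (Finset.mem_univ (x j)),
    ← Finset.mul_prod_erase _ (fun b => slot β (S j b)) (Finset.mem_univ (x j))]
  have h1 : ∏ b ∈ Finset.univ.erase (x j), slot β (S' j b) =
      ∏ b ∈ Finset.univ.erase (x j), slot β (S j b) := by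
    refine Finset.prod_congr rfl fun b hb => ?_
    rw [h, if_neg (Finset.ne_of_mem_erase hb).symm, add_zero]
  rw [h1, mul_right_comm, h, if_pos rfl]
  exact mul_le_mul_of_nonneg_right (slot_add_le hc) (Finset.prod_nonneg fun _ _ => (slot_pos _ _).le)

variable [Fintype J]

/-- The weight `w_j(b)` of the predictor with scores `S`. -/
noncomputable def coef (L β : ℝ) (S : J → B → ℝ) (j : J) (b : B) : ℝ :=
  L * (groupWeight β S j / ∑ l, groupWeight β S l) * meanSign β (S j b)

/-- The linear prediction `∑ j, w_j(x_j)`. -/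
noncomputable def predict (L β : ℝ) (S : J → B → ℝ) (x : J → B) : ℝ := ∑ j, coef L β S j (x j)

theorem sum_groupWeight_pos [Nonempty J] (β : ℝ) (S : J → B → ℝ) :
    0 < ∑ l, groupWeight β S l :=
  Finset.sum_pos (fun j _ => groupWeight_pos β S j) Finset.univ_nonempty

theorem sum_abs_le_of_abs_coef [Nonempty J] {L β : ℝ} (S : J → B → ℝ) (u : J → ℝ)
    (hu : ∀ j, |u j| ≤ L * (groupWeight β S j / ∑ l, groupWeight β S l)) : |∑ j, u j| ≤ L := by
  have hZ := sum_groupWeight_pos β S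
  calc |∑ j, u j| ≤ ∑ j, |u j| := Finset.abs_sum_le_sum_abs _ _
    _ ≤ ∑ j, L * (groupWeight β S j / ∑ l, groupWeight β S l) := Finset.sum_le_sum fun j _ => hu j
    _ = L := by rw [← Finset.mul_sum, ← Finset.sum_div, div_self hZ.ne', mul_one]

theorem abs_coef_le [Nonempty J] {L β : ℝ} (hL : 0 ≤ L) (S : J → B → ℝ) (j : J) (b : B) :
    |coef L β S j b| ≤ L * (groupWeight β S j / ∑ l, groupWeight β S l) := by
  have hZ := sum_groupWeight_pos β S
  have hq : 0 ≤ L * (groupWeight β S j / ∑ l, groupWeight β S l) :=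
    mul_nonneg hL (div_nonneg (groupWeight_pos β S j).le hZ.le)
  unfold coef
  rw [abs_mul, abs_of_nonneg hq]
  exact mul_le_of_le_one_right hq (abs_meanSign_le _ _)

theorem abs_predict_le [Nonempty J] {L β : ℝ} (hL : 0 ≤ L) (S : J → B → ℝ) (x : J → B) :
    |predict L β S x| ≤ L :=
  sum_abs_le_of_abs_coef S _ fun j => abs_coef_le hL S j (x j)

/-- The normalised first-order term is the learner's own prediction, so the potential grows only as
fast as the learner gains. -/
theorem sum_groupWeight_update_le [DecidableEq B] [Nonempty J] {β c : ℝ} (hc : |β * c| ≤ 1)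
    (S S' : J → B → ℝ) (x : J → B) (h : ∀ j b, S' j b = S j b + if x j = b then c else 0) :
    ∑ j, groupWeight β S' j ≤
      (∑ j, groupWeight β S j) * Real.exp (β * c * predict 1 β S x + (β * c) ^ 2) := by
  have hZ := sum_groupWeight_pos β S
  have h1 : (∑ j, groupWeight β S j) * predict 1 β S x =
      ∑ j, groupWeight β S j * meanSign β (S j (x j)) := by
    unfold predict coef
    rw [Finset.mul_sum]
    refine Finset.sum_congr rfl fun j _ => ?_
    field_simp
  calc ∑ j, groupWeight β S' j
      ≤ ∑ j, groupWeight β S j * (1 + β * c * meanSign β (S j (x j)) + (β * c) ^ 2) :=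
        Finset.sum_le_sum fun j _ => groupWeight_update_le hc S S' x h j
    _ = ∑ j, (groupWeight β S j * (1 + (β * c) ^ 2) +
          β * c * (groupWeight β S j * meanSign β (S j (x j)))) :=
        Finset.sum_congr rfl fun j _ => by ring
    _ = (∑ j, groupWeight β S j) * ((β * c * predict 1 β S x + (β * c) ^ 2) + 1) := by
        rw [Finset.sum_add_distrib, ← Finset.sum_mul, ← Finset.mul_sum, ← h1]; ring
    _ ≤ _ := mul_le_mul_of_nonneg_left (Real.add_one_le_exp _) hZ.le

theorem predict_eq_mul (L β : ℝ) (S : J → B → ℝ) (x : J → B) :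
    predict L β S x = L * predict 1 β S x := by
  unfold predict coef
  rw [Finset.mul_sum]
  exact Finset.sum_congr rfl fun j _ => by ring

/-! ### Regret of exponential weights -/

section Regret

variable [DecidableEq B] {β : ℝ} {S : ℕ → J → B → ℝ} {x : ℕ → J → B} {c : ℕ → ℝ}

/-- The initial potential |J| · 2^|B| is the number of experts, i.e. of pairs of a group and a sign
pattern. -/
theorem sum_groupWeight_le [Nonempty J] (hβ0 : 0 ≤ β) (hβ1 : β ≤ 1) (h0 : ∀ j b, S 0 j b = 0) (N : ℕ)
    (hS : ∀ t < N, ∀ j b, S (t + 1) j b = S t j b + if x t j = b then c t else 0)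
    (hc : ∀ t < N, |c t| ≤ 1) :
    ∑ j, groupWeight β (S N) j ≤ Fintype.card J * 2 ^ Fintype.card B *
      Real.exp (β * ∑ t ∈ Finset.range N, c t * predict 1 β (S t) (x t) + N * β ^ 2) := by
  induction N with
  | zero =>
    simp [groupWeight, slot, h0]
    norm_num
  | succ N ih =>
    have hcN := hc N (Nat.lt_succ_self N)
    have hb : |β * c N| ≤ 1 := by
      rw [abs_mul, abs_of_nonneg hβ0]
      exact mul_le_one₀ hβ1 (abs_nonneg _) hcN
    have hb2 : (β * c N) ^ 2 ≤ β ^ 2 := by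
      rw [mul_pow]
      exact mul_le_of_le_one_right (sq_nonneg _) ((sq_le_one_iff_abs_le_one _).mpr hcN)
    have ih' := ih (fun t ht => hS t (ht.trans (Nat.lt_succ_self N)))
      (fun t ht => hc t (ht.trans (Nat.lt_succ_self N)))
    refine (sum_groupWeight_update_le hb (S N) _ (x N) (hS N (Nat.lt_succ_self N))).trans ?_
    refine (mul_le_mul ih' (Real.exp_le_exp.mpr (add_le_add_right hb2 _)) (Real.exp_pos _).le
      (by positivity)).trans (le_of_eq ?_)
    rw [mul_assoc, ← Real.exp_add, Finset.sum_range_succ]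
    push_cast
    congr 2
    ring

/-- The best sign pattern of group `j` alone has mass exp(β ∑ |S N j b|), which is part of the
potential; take logarithms. -/
theorem sum_abs_score_le [Nonempty J] (hβ0 : 0 < β) (hβ1 : β ≤ 1) (h0 : ∀ j b, S 0 j b = 0) (N : ℕ)
    (hS : ∀ t < N, ∀ j b, S (t + 1) j b = S t j b + if x t j = b then c t else 0)
    (hc : ∀ t < N, |c t| ≤ 1) (j : J) :
    ∑ b, |S N j b| ≤ (Real.log (Fintype.card J) + Fintype.card B) / β +
      ∑ t ∈ Finset.range N, c t * predict 1 β (S t) (x t) + N * β := by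
  have h1 := sum_groupWeight_le hβ0.le hβ1 h0 N hS hc
  have h2 : Real.exp (β * ∑ b, |S N j b|) ≤ ∑ j, groupWeight β (S N) j := by
    refine le_trans ?_ (Finset.single_le_sum
      (fun j _ => (groupWeight_pos β (S N) j).le) (Finset.mem_univ j))
    rw [Finset.mul_sum, Real.exp_sum]
    refine Finset.prod_le_prod (fun _ _ => (Real.exp_pos _).le) fun b _ => ?_
    have := exp_abs_le_slot β (S N j b)
    rwa [abs_mul, abs_of_pos hβ0] at this
  have hJ : (0 : ℝ) < Fintype.card J := by exact_mod_cast Fintype.card_pos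
  have h3 := Real.log_le_log (Real.exp_pos _) (h2.trans h1)
  rw [Real.log_exp, Real.log_mul (by positivity) (Real.exp_pos _).ne', Real.log_exp,
    Real.log_mul hJ.ne' (by positivity), Real.log_pow] at h3
  have h4 : (Fintype.card B : ℝ) * Real.log 2 ≤ Fintype.card B :=
    mul_le_of_le_one_right (by positivity) (by linarith [Real.log_two_lt_d9])
  have h5 : ∑ b, |S N j b| ≤ (Real.log (Fintype.card J) + Fintype.card B +
      (β * ∑ t ∈ Finset.range N, c t * predict 1 β (S t) (x t) + N * β ^ 2)) / β := by
    rw [le_div_iff₀ hβ0]; linarith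
  refine h5.trans (le_of_eq ?_)
  field_simp
  ring

/-- Exchange of summation: the final score of a cell is the sum of `c t` over the rounds in which
the cell occurred. -/
theorem sum_mul_linear_eq (V : J → B → ℝ) (h0 : ∀ j b, S 0 j b = 0) (N : ℕ)
    (hS : ∀ t < N, ∀ j b, S (t + 1) j b = S t j b + if x t j = b then c t else 0) :
    ∑ t ∈ Finset.range N, c t * ∑ j, V j (x t j) = ∑ j, ∑ b, V j b * S N j b := by
  induction N with
  | zero => simp [h0]
  | succ N ih =>
    rw [Finset.sum_range_succ, ih fun t ht => hS t (ht.trans (Nat.lt_succ_self N)),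
      Finset.mul_sum, ← Finset.sum_add_distrib]
    refine Finset.sum_congr rfl fun j _ => ?_
    simp only [hS N (Nat.lt_succ_self N), mul_add, Finset.sum_add_distrib]
    congr 1
    simp [mul_comm]

/-- The regret against a linear predictor whose group suprema `m j` sum to at most `L`. -/
theorem regret_le [Nonempty J] {L : ℝ} (hβ0 : 0 < β) (hβ1 : β ≤ 1) (h0 : ∀ j b, S 0 j b = 0)
    (N : ℕ) (hS : ∀ t < N, ∀ j b, S (t + 1) j b = S t j b + if x t j = b then c t else 0)
    (hc : ∀ t < N, |c t| ≤ 1) (V : J → B → ℝ) (m : J → ℝ) (hV : ∀ j b, |V j b| ≤ m j)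
    (hm0 : ∀ j, 0 ≤ m j) (hm : ∑ j, m j ≤ L) :
    ∑ t ∈ Finset.range N, c t * (∑ j, V j (x t j) - predict L β (S t) (x t)) ≤
      L * ((Real.log (Fintype.card J) + Fintype.card B) / β + N * β) := by
  set A := ∑ t ∈ Finset.range N, c t * predict 1 β (S t) (x t) with hA
  set K := (Real.log (Fintype.card J) + Fintype.card B) / β + A + N * β with hK
  have hb : ∀ j, ∑ b, |S N j b| ≤ K := sum_abs_score_le hβ0 hβ1 h0 N hS hc
  -- Needed because the group bounds `m j` may sum to strictly less than `L`.
  have hK0 : 0 ≤ K := by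
    obtain ⟨j⟩ := ‹Nonempty J›
    exact (Finset.sum_nonneg fun b _ => abs_nonneg _).trans (hb j)
  have h1 : ∑ t ∈ Finset.range N, c t * ∑ j, V j (x t j) ≤ L * K := by
    rw [sum_mul_linear_eq V h0 N hS]
    calc ∑ j, ∑ b, V j b * S N j b ≤ ∑ j, m j * K := by
          refine Finset.sum_le_sum fun j _ => ?_
          calc ∑ b, V j b * S N j b ≤ ∑ b, m j * |S N j b| := by
                refine Finset.sum_le_sum fun b _ => ?_
                refine (le_abs_self _).trans ?_
                rw [abs_mul]
                exact mul_le_mul_of_nonneg_right (hV j b) (abs_nonneg _)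
            _ = m j * ∑ b, |S N j b| := by rw [Finset.mul_sum]
            _ ≤ m j * K := mul_le_mul_of_nonneg_left (hb j) (hm0 j)
      _ = (∑ j, m j) * K := by rw [Finset.sum_mul]
      _ ≤ L * K := mul_le_mul_of_nonneg_right hm hK0
  have h2 : ∑ t ∈ Finset.range N, c t * predict L β (S t) (x t) = L * A := by
    rw [hA, Finset.mul_sum]
    exact Finset.sum_congr rfl fun t _ => by rw [predict_eq_mul]; ring
  simp only [mul_sub, Finset.sum_sub_distrib]
  rw [h2]
  calc _ ≤ L * K - L * A := by linarith
    _ = _ := by rw [hK]; ring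

end Regret

end SignedHedge

/-! ## Sums over configurations with one resampled coordinate -/

section Resample

variable {ι A : Type*} [Fintype ι] [DecidableEq ι] [Fintype A]

/-- Exchanging `x j` with the extra value `c` is an involution on the pairs (x, c). -/
theorem sum_resample_swap (j : ι) (H : (ι → A) → A → ℝ) :
    ∑ x, ∑ c, H x c = ∑ x, ∑ c, H (Function.update x j c) (x j) := by
  rw [← Fintype.sum_prod_type', ← Fintype.sum_prod_type']
  let e : (ι → A) × A ≃ (ι → A) × A :=
    ⟨fun p => (Function.update p.1 j p.2, p.1 j), fun p => (Function.update p.1 j p.2, p.1 j),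
      fun p => by simp, fun p => by simp⟩
  exact Fintype.sum_equiv e _ _ fun p => by simp [e]

/-- Each configuration with `x j = b` is hit |A| times; this is the source of the factors k and k²
below. -/
theorem sum_update_eq [DecidableEq A] (j : ι) (b : A) (G : (ι → A) → ℝ) :
    ∑ x, G (Function.update x j b) = Fintype.card A * ∑ x, if x j = b then G x else 0 := by
  have h := sum_resample_swap j fun x _ => if x j = b then G x else 0
  simp only [Function.update_self, Finset.sum_ite_eq', Finset.mem_univ, if_true,
    Finset.sum_const, nsmul_eq_mul] at h
  rw [← h, ← Finset.mul_sum, Finset.card_univ]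

theorem sum_sum_update_eq (j : ι) (G : (ι → A) → ℝ) :
    ∑ x, ∑ b, G (Function.update x j b) = Fintype.card A * ∑ x, G x := by
  rw [← sum_resample_swap j fun x _ => G x]
  simp [Finset.mul_sum]

end Resample

namespace NonbinaryIsing

variable {n k : ℕ}

/-! ## Single-site conditional laws -/

/-- Only pairs containing `i` change. A pair with q < i enters the energy through `W q i`, which the
transpose condition rewrites. -/
theorem energy_update_sub (D : NonbinaryIsing n k) (x : Fin n → Fin k) (i : Fin n) (a c : Fin k) :
    D.energy (Function.update x i a) - D.energy (Function.update x i c) =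
      ∑ j ∈ Finset.univ.erase i, (D.W i j a (x j) - D.W i j c (x j)) + (D.θ i a - D.θ i c) := by
  set u := Function.update x i a with hu
  set v := Function.update x i c with hv
  set h : Fin n → Fin n → ℝ := fun p q =>
    if p < q then D.W p q (u p) (u q) - D.W p q (v p) (v q) else 0 with hh
  have hne : ∀ p, p ≠ i → u p = x p ∧ v p = x p := fun p hp => by simp [hu, hv, hp]
  have hi : u i = a ∧ v i = c := by simp [hu, hv]
  have h0 : ∀ p q, p ≠ i → q ≠ i → h p q = 0 := fun p q hp hq => by
    simp [hh, (hne p hp).1, (hne p hp).2, (hne q hq).1, (hne q hq).2]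
  have hii : h i i = 0 := by simp [hh]
  have hsplit : ∑ p, ∑ q, h p q = ∑ q ∈ Finset.univ.erase i, (h i q + h q i) := by
    rw [← Finset.add_sum_erase _ _ (Finset.mem_univ i), ← Finset.add_sum_erase _ (h i)
      (Finset.mem_univ i), hii, zero_add, Finset.sum_add_distrib]
    congr 1
    refine Finset.sum_congr rfl fun p hp => ?_
    exact Finset.sum_eq_single i (fun q _ hq => h0 p q (Finset.ne_of_mem_erase hp) hq) (by simp)
  have hθ : ∑ p, D.θ p (u p) - ∑ p, D.θ p (v p) = D.θ i a - D.θ i c := by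
    rw [← Finset.sum_sub_distrib, Finset.sum_eq_single i, hi.1, hi.2]
    · intro p _ hp
      rw [(hne p hp).1, (hne p hp).2, sub_self]
    · simp
  have hW : (∑ p, ∑ q, if p < q then D.W p q (u p) (u q) else 0) -
      (∑ p, ∑ q, if p < q then D.W p q (v p) (v q) else 0) = ∑ p, ∑ q, h p q := by
    simp only [← Finset.sum_sub_distrib]
    refine Finset.sum_congr rfl fun p _ => Finset.sum_congr rfl fun q _ => ?_
    simp only [hh]
    split_ifs <;> simp
  have hpair : ∀ q, q ≠ i → h i q + h q i = D.W i q a (x q) - D.W i q c (x q) := by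
    intro q hq
    simp only [hh, (hne q hq).1, (hne q hq).2, hi.1, hi.2]
    rcases lt_or_gt_of_ne hq with hlt | hlt
    · rw [if_neg hlt.asymm, if_pos hlt, D.transpose_eq i q hq.symm]
      simp
    · rw [if_pos hlt, if_neg hlt.asymm, add_zero]
  unfold energy
  rw [add_sub_add_comm, hW, hθ, hsplit]
  congr 1
  exact Finset.sum_congr rfl fun q hq => hpair q (Finset.ne_of_mem_erase hq)

theorem abs_W_le_iSup (D : NonbinaryIsing n k) (i j : Fin n) (a b : Fin k) :
    |D.W i j a b| ≤ ⨆ b, |D.W i j a b| :=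
  le_ciSup (f := fun b => |D.W i j a b|) (Set.finite_range _).bddAbove b

theorem sum_iSup_le_width (D : NonbinaryIsing n k) (i : Fin n) (a : Fin k) :
    (∑ j ∈ Finset.univ.erase i, ⨆ b, |D.W i j a b|) + |D.θ i a| ≤ D.width :=
  le_ciSup (f := fun p : Fin n × Fin k =>
    ((∑ j ∈ Finset.univ.erase p.1, ⨆ b : Fin k, |D.W p.1 j p.2 b|) + |D.θ p.1 p.2|))
    (Set.finite_range _).bddAbove (i, a)

theorem width_nonneg [NeZero n] [NeZero k] (D : NonbinaryIsing n k) : 0 ≤ D.width :=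
  le_trans (add_nonneg (Finset.sum_nonneg fun _ _ => Real.iSup_nonneg fun _ => abs_nonneg _)
    (abs_nonneg _)) (D.sum_iSup_le_width 0 0)

/-- The probability of a configuration as a real number. -/
noncomputable def prob (D : NonbinaryIsing n k) (x : Fin n → Fin k) : ℝ :=
  Real.exp (D.energy x) / ∑ z, Real.exp (D.energy z)

/-! ### Probability ratios, log-odds and drifts under the model -/

section Prob

variable [NeZero k] (D : NonbinaryIsing n k)

theorem sum_exp_energy_pos : 0 < ∑ z, Real.exp (D.energy z) :=
  Finset.sum_pos (fun _ _ => Real.exp_pos _) Finset.univ_nonempty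

theorem prob_pos (x : Fin n → Fin k) : 0 < D.prob x :=
  div_pos (Real.exp_pos _) D.sum_exp_energy_pos

theorem sum_prob : ∑ x, D.prob x = 1 := by
  unfold prob
  rw [← Finset.sum_div, div_self D.sum_exp_energy_pos.ne']

theorem dist_apply (x : Fin n → Fin k) : D.dist x = ENNReal.ofReal (D.prob x) := by
  unfold dist prob
  rw [PMF.normalize_apply, tsum_fintype]
  unfold weight
  rw [← ENNReal.ofReal_sum_of_nonneg fun _ _ => (Real.exp_pos _).le,
    ENNReal.ofReal_div_of_pos D.sum_exp_energy_pos, div_eq_mul_inv]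

theorem prob_update_eq (x : Fin n → Fin k) (i : Fin n) (a c : Fin k) :
    D.prob (Function.update x i a) = D.prob (Function.update x i c) *
      Real.exp (∑ j ∈ Finset.univ.erase i, (D.W i j a (x j) - D.W i j c (x j)) +
        (D.θ i a - D.θ i c)) := by
  rw [← D.energy_update_sub, Real.exp_sub]
  unfold prob
  field_simp

/-- The log-ratio is a difference of two expressions, each bounded by the width. This comparison
replaces explicit conditional laws in all estimates below. -/
theorem prob_update_le_update (x : Fin n → Fin k) (i : Fin n) (a c : Fin k) :
    D.prob (Function.update x i a) ≤
      Real.exp (2 * D.width) * D.prob (Function.update x i c) := by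
  rw [D.prob_update_eq x i a c, mul_comm]
  refine mul_le_mul_of_nonneg_right (Real.exp_le_exp.mpr ?_) (D.prob_pos _).le
  have h1 := D.sum_iSup_le_width i a
  have h2 := D.sum_iSup_le_width i c
  have h3 : ∑ j ∈ Finset.univ.erase i, (D.W i j a (x j) - D.W i j c (x j)) ≤
      (∑ j ∈ Finset.univ.erase i, ⨆ b, |D.W i j a b|) +
        ∑ j ∈ Finset.univ.erase i, ⨆ b, |D.W i j c b| := by
    rw [← Finset.sum_add_distrib]
    refine Finset.sum_le_sum fun j _ => ?_
    have := le_abs_self (D.W i j a (x j))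
    have := neg_abs_le (D.W i j c (x j))
    have := D.abs_W_le_iSup i j a (x j)
    have := D.abs_W_le_iSup i j c (x j)
    linarith
  have := le_abs_self (D.θ i a)
  have := neg_abs_le (D.θ i c)
  linarith

theorem prob_update_le (x : Fin n → Fin k) (i : Fin n) (a : Fin k) :
    D.prob (Function.update x i a) ≤ Real.exp (2 * D.width) * D.prob x := by
  simpa using D.prob_update_le_update x i a (x i)

theorem prob_le_update (x : Fin n → Fin k) (i : Fin n) (a : Fin k) :
    D.prob x ≤ Real.exp (2 * D.width) * D.prob (Function.update x i a) := by
  simpa using D.prob_update_le_update x i (x i) a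

/-! ## The logistic model for the values `0` and `a` of variable `i` -/

/-- The configuration with coordinate `i` blanked out, so that feature group `i` serves as the
intercept. -/
def mask (i : Fin n) (x : Fin n → Fin k) : Fin n → Fin k := Function.update x i 0

/-- The coefficients of the log-odds of `x i = a` against `x i = 0`. -/
def oddsCoef (i : Fin n) (a : Fin k) (j : Fin n) (b : Fin k) : ℝ :=
  if j = i then D.θ i a - D.θ i 0 else D.W i j a b - D.W i j 0 b

/-- The log-odds of `x i = a` against `x i = 0` given the other coordinates. -/
def logOdds (i : Fin n) (a : Fin k) (x : Fin n → Fin k) : ℝ :=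
  ∑ j, D.oddsCoef i a j (mask i x j)

/-- A bound on group `j` of the coefficients of the log-odds. -/
noncomputable def oddsBound (i : Fin n) (a : Fin k) (j : Fin n) : ℝ :=
  if j = i then |D.θ i a| + |D.θ i 0| else (⨆ b, |D.W i j a b|) + ⨆ b, |D.W i j 0 b|

theorem oddsBound_nonneg (i : Fin n) (a : Fin k) (j : Fin n) : 0 ≤ D.oddsBound i a j := by
  unfold oddsBound
  split_ifs
  · positivity
  · exact add_nonneg (Real.iSup_nonneg fun _ => abs_nonneg _)
      (Real.iSup_nonneg fun _ => abs_nonneg _)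

theorem abs_oddsCoef_le (i : Fin n) (a : Fin k) (j : Fin n) (b : Fin k) :
    |D.oddsCoef i a j b| ≤ D.oddsBound i a j := by
  unfold oddsCoef oddsBound
  split_ifs
  · exact abs_sub _ _
  · exact (abs_sub _ _).trans (add_le_add (D.abs_W_le_iSup i j a b) (D.abs_W_le_iSup i j 0 b))

theorem sum_oddsBound_le (i : Fin n) (a : Fin k) : ∑ j, D.oddsBound i a j ≤ 2 * D.width := by
  have h1 := D.sum_iSup_le_width i a
  have h2 := D.sum_iSup_le_width i 0
  rw [← Finset.add_sum_erase _ _ (Finset.mem_univ i)]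
  have h3 : ∑ j ∈ Finset.univ.erase i, D.oddsBound i a j =
      (∑ j ∈ Finset.univ.erase i, ⨆ b, |D.W i j a b|) +
        ∑ j ∈ Finset.univ.erase i, ⨆ b, |D.W i j 0 b| := by
    rw [← Finset.sum_add_distrib]
    refine Finset.sum_congr rfl fun j hj => ?_
    unfold oddsBound
    rw [if_neg (Finset.ne_of_mem_erase hj)]
  rw [h3]
  unfold oddsBound
  rw [if_pos rfl]
  linarith

theorem abs_logOdds_le (i : Fin n) (a : Fin k) (x : Fin n → Fin k) :
    |D.logOdds i a x| ≤ 2 * D.width :=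
  (Finset.abs_sum_le_sum_abs _ _).trans
    ((Finset.sum_le_sum fun j _ => D.abs_oddsCoef_le i a j _).trans (D.sum_oddsBound_le i a))

theorem mask_update_self (i : Fin n) (x : Fin n → Fin k) (c : Fin k) :
    mask i (Function.update x i c) = mask i x := by
  simp [mask]

theorem logOdds_update_self (i : Fin n) (a c : Fin k) (x : Fin n → Fin k) :
    D.logOdds i a (Function.update x i c) = D.logOdds i a x := by
  unfold logOdds
  rw [mask_update_self]

theorem logOdds_eq (i : Fin n) (a : Fin k) (x : Fin n → Fin k) :
    D.logOdds i a x = ∑ j ∈ Finset.univ.erase i, (D.W i j a (x j) - D.W i j 0 (x j)) +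
      (D.θ i a - D.θ i 0) := by
  unfold logOdds
  rw [← Finset.add_sum_erase _ _ (Finset.mem_univ i), add_comm]
  congr 1
  · refine Finset.sum_congr rfl fun j hj => ?_
    have hj' := Finset.ne_of_mem_erase hj
    simp [oddsCoef, mask, hj']
  · simp [oddsCoef]

theorem prob_update_eq_exp_logOdds (x : Fin n → Fin k) (i : Fin n) (a : Fin k) :
    D.prob (Function.update x i a) =
      D.prob (Function.update x i 0) * Real.exp (D.logOdds i a x) := by
  rw [D.prob_update_eq x i a 0, D.logOdds_eq]

theorem logOdds_update_of_ne {i j : Fin n} (hji : j ≠ i) (a b c : Fin k) (x : Fin n → Fin k) :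
    D.logOdds i a (Function.update x j c) =
      D.logOdds i a (Function.update x j b) - D.oddsCoef i a j b + D.oddsCoef i a j c := by
  unfold logOdds
  rw [← Finset.add_sum_erase _ _ (Finset.mem_univ j),
    ← Finset.add_sum_erase _ (fun l => D.oddsCoef i a l (mask i (Function.update x j b) l))
      (Finset.mem_univ j)]
  have h : ∑ l ∈ Finset.univ.erase j, D.oddsCoef i a l (mask i (Function.update x j c) l) =
      ∑ l ∈ Finset.univ.erase j, D.oddsCoef i a l (mask i (Function.update x j b) l) := by
    refine Finset.sum_congr rfl fun l hl => ?_
    have hl' := Finset.ne_of_mem_erase hl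
    by_cases hli : l = i
    · subst hli; simp [mask]
    · simp [mask, hli, hl']
  rw [h]
  simp only [mask, Function.update_of_ne hji, Function.update_self]
  ring

theorem sum_oddsCoef (hD : D.IsCentered) {i j : Fin n} (hji : j ≠ i) (a : Fin k) :
    ∑ b, D.oddsCoef i a j b = 0 := by
  simp only [oddsCoef, if_neg hji, Finset.sum_sub_distrib, (hD i j hji.symm).1, sub_self]

/-- Zero row sums make the term of variable `j` vanish under uniform averaging over its values. The
learner can apply the same averaging to its own predictions. -/
theorem mean_logOdds (hD : D.IsCentered) {i j : Fin n} (hji : j ≠ i) (a b : Fin k)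
    (x : Fin n → Fin k) :
    (∑ c, D.logOdds i a (Function.update x j c)) / k =
      D.logOdds i a (Function.update x j b) - D.oddsCoef i a j b := by
  have hk : (k : ℝ) ≠ 0 := by exact_mod_cast NeZero.ne k
  have h : ∑ c, D.logOdds i a (Function.update x j c) =
      ∑ c, (D.logOdds i a (Function.update x j b) - D.oddsCoef i a j b + D.oddsCoef i a j c) :=
    Finset.sum_congr rfl fun c _ => D.logOdds_update_of_ne hji a b c x
  rw [h, Finset.sum_add_distrib, D.sum_oddsCoef hD hji a]
  simp only [Finset.sum_const, Finset.card_univ, Fintype.card_fin, nsmul_eq_mul, add_zero]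
  field_simp

/-- Only the values `0` and `a ≠ 0` of `x i` take part in problem `(i, a)`. -/
noncomputable def gate (i : Fin n) (a : Fin k) (x : Fin n → Fin k) : ℝ :=
  if a ≠ 0 ∧ (x i = 0 ∨ x i = a) then 1 else 0

/-- The label of problem `(i, a)`. -/
noncomputable def label (i : Fin n) (a : Fin k) (x : Fin n → Fin k) : ℝ :=
  if x i = a then 1 else 0

theorem gate_mul_eq {a : Fin k} (ha : a ≠ 0) (i : Fin n) (x : Fin n → Fin k) (p : ℝ) :
    gate i a x * (label i a x - p) =
      (if x i = 0 then -p else 0) + if x i = a then 1 - p else 0 := by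
  unfold gate label
  by_cases h0 : x i = 0
  · have : x i ≠ a := fun h => ha (h ▸ h0)
    simp [h0, ha, ha.symm]
  · by_cases h1 : x i = a <;> simp [h0, h1, ha]

theorem abs_gate_mul_le (i : Fin n) (a : Fin k) (x : Fin n → Fin k) (v : ℝ) :
    |gate i a x * (label i a x - Real.sigmoid v)| ≤ 1 := by
  have h0 := Real.sigmoid_pos v
  have h1 := Real.sigmoid_lt_one v
  unfold gate label
  split_ifs <;> rw [abs_le] <;> constructor <;> linarith

/-- The labels 0 and 1 have residuals -p and 1 - p and occur in proportion 1 : e^f. -/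
theorem sigmoid_identity (f p : ℝ) :
    -p + Real.exp f * (1 - p) = (1 + Real.exp f) * (Real.sigmoid f - p) := by
  have h : Real.exp f * Real.exp (-f) = 1 := by rw [← Real.exp_add]; simp
  have h2 : (1 + Real.exp f) * Real.sigmoid f = Real.exp f := by
    rw [Real.sigmoid_def]
    have := Real.exp_pos (-f)
    field_simp
    linear_combination -h
  linear_combination -h2

/-- Averaging a residual over the conditional law of `x i` leaves the difference of the
conditional probabilities. -/
theorem sum_prob_residual {a : Fin k} (ha : a ≠ 0) (i : Fin n) (w F : (Fin n → Fin k) → ℝ)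
    (hw : ∀ x c, w (Function.update x i c) = w x) (hF : ∀ x c, F (Function.update x i c) = F x) :
    (k : ℝ) * ∑ x, D.prob x * (gate i a x * (label i a x - Real.sigmoid (w x)) * F x) =
      ∑ x, (D.prob (Function.update x i 0) + D.prob (Function.update x i a)) *
        ((Real.sigmoid (D.logOdds i a x) - Real.sigmoid (w x)) * F x) := by
  have h1 : ∑ x, D.prob x * (gate i a x * (label i a x - Real.sigmoid (w x)) * F x) =
      (∑ x, if x i = 0 then D.prob x * (-Real.sigmoid (w x)) * F x else 0) +
        ∑ x, if x i = a then D.prob x * (1 - Real.sigmoid (w x)) * F x else 0 := by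
    rw [← Finset.sum_add_distrib]
    refine Finset.sum_congr rfl fun x _ => ?_
    rw [gate_mul_eq ha]
    split_ifs <;> ring
  -- Resampling coordinate `i` removes the constraints `x i = 0` and `x i = a`, at the cost of a
  -- factor k.
  have h2 := sum_update_eq i (0 : Fin k) fun x => D.prob x * (-Real.sigmoid (w x)) * F x
  have h3 := sum_update_eq i a fun x => D.prob x * (1 - Real.sigmoid (w x)) * F x
  rw [Fintype.card_fin] at h2 h3
  rw [h1, mul_add, ← h2, ← h3, ← Finset.sum_add_distrib]
  refine Finset.sum_congr rfl fun x _ => ?_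
  rw [hw, hF, hw, hF, D.prob_update_eq_exp_logOdds x i a]
  linear_combination D.prob (Function.update x i 0) * F x *
    sigmoid_identity (D.logOdds i a x) (Real.sigmoid (w x))

/-- The drift of the regret dominates the squared prediction error. -/
theorem sum_prob_regret_ge {a : Fin k} (ha : a ≠ 0) (i : Fin n) {lam : ℝ} (hlam : D.width ≤ lam)
    (w : (Fin n → Fin k) → ℝ) (hw : ∀ x c, w (Function.update x i c) = w x)
    (hwL : ∀ x, |w x| ≤ 2 * lam) :
    Real.exp (-(4 * lam)) / 4 * ∑ x, D.prob x * (w x - D.logOdds i a x) ^ 2 ≤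
      (k : ℝ) * ∑ x, D.prob x *
        (gate i a x * (label i a x - Real.sigmoid (w x)) * (D.logOdds i a x - w x)) := by
  rw [D.sum_prob_residual ha i w (fun x => D.logOdds i a x - w x) hw
    fun x c => by rw [hw, D.logOdds_update_self], Finset.mul_sum]
  refine Finset.sum_le_sum fun x _ => ?_
  have hf : |D.logOdds i a x| ≤ 2 * lam := (D.abs_logOdds_le i a x).trans (by linarith)
  have h1 := Real.sigmoid_sub_mul_sub_ge hf (hwL x)
  have h2 := D.prob_le_update x i 0
  have h3 : Real.exp (-(2 * lam)) * D.prob x ≤ D.prob (Function.update x i 0) := by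
    have : Real.exp (2 * D.width) ≤ Real.exp (2 * lam) := Real.exp_le_exp.mpr (by linarith)
    rw [Real.exp_neg, inv_mul_le_iff₀ (Real.exp_pos _)]
    exact h2.trans (mul_le_mul_of_nonneg_right this (D.prob_pos _).le)
  -- One factor is the slope of the sigmoid on [-2λ, 2λ], the other the price of resampling `x i`.
  have h4 : Real.exp (-(4 * lam)) = Real.exp (-(2 * lam)) * Real.exp (-(2 * lam)) := by
    rw [← Real.exp_add]; ring_nf
  calc _ = (Real.exp (-(2 * lam)) * D.prob x) *
        (Real.exp (-(2 * lam)) / 4 * (D.logOdds i a x - w x) ^ 2) := by rw [h4]; ring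
    _ ≤ (D.prob (Function.update x i 0) + D.prob (Function.update x i a)) * _ :=
      mul_le_mul (h3.trans (le_add_of_nonneg_right (D.prob_pos _).le)) h1 (by positivity)
        (add_nonneg (D.prob_pos _).le (D.prob_pos _).le)

/-- The weight of `x` after averaging over `x j = b` and over the two values of `x i`. -/
noncomputable def pairProb (i : Fin n) (a : Fin k) (j : Fin n) (b : Fin k)
    (x : Fin n → Fin k) : ℝ :=
  D.prob (Function.update (Function.update x j b) i 0) +
    D.prob (Function.update (Function.update x j b) i a)

/-- Two coordinates are changed, each for a factor e^{2λ}, and there are two terms. -/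
theorem pairProb_le {lam : ℝ} (hlam : D.width ≤ lam) (i : Fin n) (a : Fin k) (j : Fin n)
    (b : Fin k) (x : Fin n → Fin k) :
    D.pairProb i a j b x ≤ 2 * Real.exp (4 * lam) * D.prob x := by
  have h0 : Real.exp (2 * D.width) ≤ Real.exp (2 * lam) := Real.exp_le_exp.mpr (by linarith)
  have h : ∀ c, D.prob (Function.update (Function.update x j b) i c) ≤
      Real.exp (2 * lam) * (Real.exp (2 * lam) * D.prob x) := fun c =>
    ((D.prob_update_le _ i c).trans (mul_le_mul_of_nonneg_right h0 (D.prob_pos _).le)).trans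
      (mul_le_mul_of_nonneg_left
        ((D.prob_update_le x j b).trans (mul_le_mul_of_nonneg_right h0 (D.prob_pos _).le))
        (Real.exp_pos _).le)
  have h4 : Real.exp (4 * lam) = Real.exp (2 * lam) * Real.exp (2 * lam) := by
    rw [← Real.exp_add]; ring_nf
  unfold pairProb
  rw [h4]
  linarith [h 0, h a]

theorem le_pairProb {lam : ℝ} (hlam : D.width ≤ lam) (i : Fin n) (a : Fin k) (j : Fin n)
    (b : Fin k) (x : Fin n → Fin k) :
    2 * Real.exp (-(4 * lam)) * D.prob x ≤ D.pairProb i a j b x := by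
  have h0 : Real.exp (2 * D.width) ≤ Real.exp (2 * lam) := Real.exp_le_exp.mpr (by linarith)
  have h : ∀ c, D.prob x ≤ Real.exp (2 * lam) * (Real.exp (2 * lam) *
      D.prob (Function.update (Function.update x j b) i c)) := fun c =>
    ((D.prob_le_update x j b).trans (mul_le_mul_of_nonneg_right h0 (D.prob_pos _).le)).trans
      (mul_le_mul_of_nonneg_left
        ((D.prob_le_update _ i c).trans (mul_le_mul_of_nonneg_right h0 (D.prob_pos _).le))
        (Real.exp_pos _).le)
  have h4 : Real.exp (4 * lam) = Real.exp (2 * lam) * Real.exp (2 * lam) := by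
    rw [← Real.exp_add]; ring_nf
  rw [Real.exp_neg, mul_right_comm, ← div_eq_mul_inv, div_le_iff₀ (Real.exp_pos _), h4]
  unfold pairProb
  linarith [h 0, h a]

theorem sum_pairProb_le {lam : ℝ} (hlam : D.width ≤ lam) (i : Fin n) (a : Fin k) (j : Fin n)
    (b : Fin k) : ∑ x, D.pairProb i a j b x ≤ 2 * Real.exp (4 * lam) := by
  refine (Finset.sum_le_sum fun x _ => D.pairProb_le hlam i a j b x).trans (le_of_eq ?_)
  rw [← Finset.mul_sum, D.sum_prob, mul_one]

theorem le_sum_pairProb {lam : ℝ} (hlam : D.width ≤ lam) (i : Fin n) (a : Fin k) (j : Fin n)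
    (b : Fin k) : 2 * Real.exp (-(4 * lam)) ≤ ∑ x, D.pairProb i a j b x := by
  refine le_trans (le_of_eq ?_) (Finset.sum_le_sum fun x _ => D.le_pairProb hlam i a j b x)
  rw [← Finset.mul_sum, D.sum_prob, mul_one]

theorem pairProb_nonneg (i : Fin n) (a : Fin k) (j : Fin n) (b : Fin k) (x : Fin n → Fin k) :
    0 ≤ D.pairProb i a j b x := add_nonneg (D.prob_pos _).le (D.prob_pos _).le

/-- Coordinates `i` and `j` are resampled one after the other, each giving a factor k; `w` depends
on neither. -/
theorem sum_prob_residual_pair {a : Fin k} (ha : a ≠ 0) {i j : Fin n} (hji : j ≠ i) (b : Fin k)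
    (w : (Fin n → Fin k) → ℝ) (hw : ∀ x c, w (Function.update x i c) = w x)
    (hwj : ∀ x c, w (Function.update x j c) = w x) :
    (k : ℝ) ^ 2 * ∑ x, D.prob x * (gate i a x * (label i a x - Real.sigmoid (w x)) *
        if x j = b then 1 else 0) =
      ∑ x, D.pairProb i a j b x *
        (Real.sigmoid (D.logOdds i a (Function.update x j b)) - Real.sigmoid (w x)) := by
  have h1 := D.sum_prob_residual ha i w (fun x => if x j = b then 1 else 0) hw
    fun x c => by simp only [Function.update_of_ne hji]
  have h2 := sum_update_eq j b fun x =>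
    (D.prob (Function.update x i 0) + D.prob (Function.update x i a)) *
      (Real.sigmoid (D.logOdds i a x) - Real.sigmoid (w x))
  rw [Fintype.card_fin] at h2
  rw [sq, mul_assoc, h1]
  unfold pairProb
  simp only [hwj] at h2
  rw [h2]
  congr 1
  exact Finset.sum_congr rfl fun x _ => by split_ifs <;> simp

/-- Used to show that the event on which a test statistic moves has probability O(e^{4λ}/k²). -/
theorem sum_prob_gate_pair {a : Fin k} (ha : a ≠ 0) {i j : Fin n} (hji : j ≠ i) (b : Fin k) :
    (k : ℝ) ^ 2 * ∑ x, D.prob x * (gate i a x * if x j = b then 1 else 0) =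
      ∑ x, D.pairProb i a j b x := by
  have h1 : ∑ x, D.prob x * (gate i a x * if x j = b then 1 else 0) =
      (∑ x, if x i = 0 then D.prob x * (if x j = b then 1 else 0) else 0) +
        ∑ x, if x i = a then D.prob x * (if x j = b then 1 else 0) else 0 := by
    rw [← Finset.sum_add_distrib]
    refine Finset.sum_congr rfl fun x _ => ?_
    have h := gate_mul_eq ha i x (label i a x - 1)
    rw [sub_sub_cancel, mul_one] at h
    rw [h]
    by_cases h0 : x i = 0
    · have : x i ≠ a := fun h => ha (h ▸ h0)
      simp [h0, ha.symm, label]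
    · by_cases h1 : x i = a <;> simp [h0, h1, ha, label]
  have h2 := sum_update_eq i (0 : Fin k) fun x => D.prob x * (if x j = b then 1 else 0)
  have h3 := sum_update_eq i a fun x => D.prob x * (if x j = b then 1 else 0)
  have h4 := sum_update_eq j b fun x =>
    (D.prob (Function.update x i 0) + D.prob (Function.update x i a))
  rw [Fintype.card_fin] at h2 h3 h4
  unfold pairProb
  rw [h4, sq, mul_assoc, h1, mul_add (k : ℝ) (∑ x, _), ← h2, ← h3, ← Finset.sum_add_distrib]
  congr 1
  refine Finset.sum_congr rfl fun x _ => ?_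
  simp only [Function.update_of_ne hji]
  split_ifs <;> simp

/-- The average of `w` over coordinate `j`. -/
noncomputable def averageAt (w : (Fin n → Fin k) → ℝ) (j : Fin n) (x : Fin n → Fin k) : ℝ :=
  (∑ b, w (Function.update x j b)) / k

theorem abs_averageAt_le {w : (Fin n → Fin k) → ℝ} {L : ℝ} (hw : ∀ x, |w x| ≤ L) (j : Fin n)
    (x : Fin n → Fin k) : |averageAt w j x| ≤ L := by
  have hk : (0 : ℝ) < k := by exact_mod_cast Nat.pos_of_ne_zero (NeZero.ne k)
  unfold averageAt
  rw [abs_div, abs_of_pos hk, div_le_iff₀ hk]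
  refine (Finset.abs_sum_le_sum_abs _ _).trans ((Finset.sum_le_sum fun b _ => hw _).trans ?_)
  simp [mul_comm]

theorem sum_prob_averageAt_le {F : (Fin n → Fin k) → ℝ} (hF : ∀ x, 0 ≤ F x) (j : Fin n) :
    ∑ x, D.prob x * averageAt F j x ≤ Real.exp (2 * D.width) * ∑ x, D.prob x * F x := by
  have hk : (0 : ℝ) < k := by exact_mod_cast Nat.pos_of_ne_zero (NeZero.ne k)
  have h := sum_sum_update_eq j fun x => D.prob x * F x
  rw [Fintype.card_fin] at h
  have h2 : (k : ℝ) * ∑ x, D.prob x * averageAt F j x =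
      ∑ x, ∑ b, D.prob x * F (Function.update x j b) := by
    rw [Finset.mul_sum]
    refine Finset.sum_congr rfl fun x _ => ?_
    unfold averageAt
    rw [← Finset.mul_sum]
    field_simp
  refine le_of_mul_le_mul_left ?_ hk
  calc (k : ℝ) * ∑ x, D.prob x * averageAt F j x
      = ∑ x, ∑ b, D.prob x * F (Function.update x j b) := h2
    _ ≤ ∑ x, ∑ b, Real.exp (2 * D.width) *
          (D.prob (Function.update x j b) * F (Function.update x j b)) := by
        refine Finset.sum_le_sum fun x _ => Finset.sum_le_sum fun b _ => ?_
        rw [← mul_assoc]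
        exact mul_le_mul_of_nonneg_right (D.prob_le_update x j b) (hF _)
    _ = _ := by
        simp only [← Finset.mul_sum]
        rw [h]; ring

/-- The part of the drift of the test statistic that is due to the interaction of `i` and `j`. -/
noncomputable def signal (i : Fin n) (a : Fin k) (j : Fin n) (b : Fin k) : ℝ :=
  ∑ x, D.pairProb i a j b x * (Real.sigmoid (D.logOdds i a (Function.update x j b)) -
    Real.sigmoid (D.logOdds i a (Function.update x j b) - D.oddsCoef i a j b))

theorem signal_eq_zero {i j : Fin n} {a b : Fin k} (h : D.oddsCoef i a j b = 0) :
    D.signal i a j b = 0 := by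
  simp [signal, h]

/-- The sigmoid is increasing, so all summands of `signal` have the sign of the coefficient and
nothing cancels. The bound is the least slope e^{-2λ}/4 times the least total mass 2e^{-4λ} times
the coefficient. -/
theorem abs_signal_ge (hD : D.IsCentered) {lam η : ℝ} (hlam : D.width ≤ lam) {i j : Fin n}
    (hji : j ≠ i) {a b : Fin k} (hη : η ≤ 2 * |D.oddsCoef i a j b|) :
    Real.exp (-(6 * lam)) / 4 * η ≤ |D.signal i a j b| := by
  set V := D.oddsCoef i a j b with hV
  have hf : ∀ x, |D.logOdds i a x| ≤ 2 * lam := fun x =>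
    (D.abs_logOdds_le i a x).trans (by linarith)
  -- The shifted argument is an average of log-odds and so obeys the same bound.
  have hf' : ∀ x, |D.logOdds i a (Function.update x j b) - V| ≤ 2 * lam := fun x => by
    have := abs_averageAt_le (w := D.logOdds i a) hf j x
    rwa [averageAt, D.mean_logOdds hD hji a b] at this
  have h6 : Real.exp (-(6 * lam)) = Real.exp (-(2 * lam)) * Real.exp (-(4 * lam)) := by
    rw [← Real.exp_add]; ring_nf
  have hsum := D.le_sum_pairProb hlam i a j b
  have key : ∀ v, (∑ x, D.pairProb i a j b x * (Real.exp (-(2 * lam)) / 4 * |V|)) ≤ v →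
      Real.exp (-(6 * lam)) / 4 * η ≤ v := by
    intro v hv
    rw [← Finset.sum_mul] at hv
    refine le_trans ?_ hv
    have e2 := Real.exp_pos (-(2 * lam))
    calc _ ≤ Real.exp (-(6 * lam)) / 4 * (2 * |V|) :=
          mul_le_mul_of_nonneg_left hη (by positivity)
      _ = 2 * Real.exp (-(4 * lam)) * (Real.exp (-(2 * lam)) / 4 * |V|) := by rw [h6]; ring
      _ ≤ _ := mul_le_mul_of_nonneg_right hsum (by positivity)
  rcases le_total 0 V with h0 | h0
  · refine (key _ ?_).trans (le_abs_self _)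
    refine Finset.sum_le_sum fun x _ => mul_le_mul_of_nonneg_left ?_ (D.pairProb_nonneg i a j b x)
    rw [abs_of_nonneg h0]
    have := Real.sigmoid_sub_ge (hf' x) (hf (Function.update x j b)) (by linarith)
    rwa [sub_sub_cancel] at this
  · refine (key _ ?_).trans (neg_le_abs _)
    unfold signal
    rw [← Finset.sum_neg_distrib]
    refine Finset.sum_le_sum fun x _ => ?_
    rw [← mul_neg (D.pairProb i a j b x), neg_sub]
    refine mul_le_mul_of_nonneg_left ?_ (D.pairProb_nonneg i a j b x)
    rw [abs_of_nonpos h0]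
    have := Real.sigmoid_sub_ge (hf (Function.update x j b)) (hf' x) (by linarith)
    rwa [sub_sub_cancel_left] at this

/-- The drift of the test statistic is its signal up to the prediction error. -/
theorem abs_drift_sub_signal_le (hD : D.IsCentered) {lam : ℝ} (hlam : D.width ≤ lam)
    {a : Fin k} (ha : a ≠ 0) {i j : Fin n} (hji : j ≠ i) (b : Fin k)
    (w : (Fin n → Fin k) → ℝ) (hw : ∀ x c, w (Function.update x i c) = w x) :
    |(k : ℝ) ^ 2 * ∑ x, D.prob x * (gate i a x *
        (label i a x - Real.sigmoid (averageAt w j x)) * if x j = b then 1 else 0) -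
      D.signal i a j b| ≤
      2 * Real.exp (6 * lam) * ∑ x, D.prob x * |w x - D.logOdds i a x| := by
  have hi : ∀ x c, averageAt w j (Function.update x i c) = averageAt w j x := fun x c => by
    unfold averageAt
    simp only [Function.update_comm hji.symm, hw]
  have hj : ∀ x c, averageAt w j (Function.update x j c) = averageAt w j x := fun x c => by
    unfold averageAt
    simp only [Function.update_idem]
  rw [D.sum_prob_residual_pair ha hji b _ hi hj]
  unfold signal
  rw [← Finset.sum_sub_distrib]
  have h6 : Real.exp (6 * lam) = Real.exp (4 * lam) * Real.exp (2 * lam) := by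
    rw [← Real.exp_add]; ring_nf
  have h2 : Real.exp (2 * D.width) ≤ Real.exp (2 * lam) := Real.exp_le_exp.mpr (by linarith)
  have hk : (0 : ℝ) < k := by exact_mod_cast Nat.pos_of_ne_zero (NeZero.ne k)
  have hpt : ∀ x, |D.pairProb i a j b x *
        (Real.sigmoid (D.logOdds i a (Function.update x j b)) - Real.sigmoid (averageAt w j x)) -
      D.pairProb i a j b x * (Real.sigmoid (D.logOdds i a (Function.update x j b)) -
        Real.sigmoid (D.logOdds i a (Function.update x j b) - D.oddsCoef i a j b))| ≤
      2 * Real.exp (4 * lam) *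
        (D.prob x * averageAt (fun x => |w x - D.logOdds i a x|) j x) := by
    intro x
    rw [← mul_sub, sub_sub_sub_cancel_left, abs_mul, abs_of_nonneg (D.pairProb_nonneg i a j b x),
      ← mul_assoc]
    refine mul_le_mul (D.pairProb_le hlam i a j b x) ?_ (abs_nonneg _)
      (mul_nonneg (by positivity) (D.prob_pos x).le)
    rw [abs_sub_comm]
    refine (Real.abs_sigmoid_sub_le _ _).trans ?_
    -- The shifted log-odds is the average over `x j` of the log-odds, so the difference to bound is
    -- an average of prediction errors.
    rw [← D.mean_logOdds hD hji a b]
    unfold averageAt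
    rw [← sub_div, ← Finset.sum_sub_distrib, abs_div, abs_of_pos hk]
    exact div_le_div_of_nonneg_right (Finset.abs_sum_le_sum_abs _ _) hk.le
  refine (Finset.abs_sum_le_sum_abs _ _).trans ((Finset.sum_le_sum fun x _ => hpt x).trans ?_)
  rw [← Finset.mul_sum, h6]
  have h3 := (D.sum_prob_averageAt_le (F := fun x => |w x - D.logOdds i a x|)
    (fun _ => abs_nonneg _) j).trans (mul_le_mul_of_nonneg_right h2
      (Finset.sum_nonneg fun x _ => mul_nonneg (D.prob_pos x).le (abs_nonneg _)))
  have h5 : 0 ≤ 2 * Real.exp (4 * lam) := by positivity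
  exact (mul_le_mul_of_nonneg_left h3 h5).trans (le_of_eq (by ring))

/-! ## Edges have large log-odds coefficients -/

/-- Take the column `b₀` of a largest entry. It sums to zero, so its entry in row 0 is minus the
average of the differences to row 0. If all differences were below η/2, that entry would be at most
η/2 in size and every entry of the column below η. -/
theorem exists_oddsCoef_of_adj (hD : D.IsCentered) {η : ℝ} (hη : 0 < η)
    (hI : D.IsIdentifiable η) {i j : Fin n} (h : D.dependencyGraph.Adj i j) :
    ∃ a b : Fin k, a ≠ 0 ∧ η ≤ 2 * |D.oddsCoef i a j b| := by
  have hij : i ≠ j := h.1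
  have hk : (0 : ℝ) < k := by exact_mod_cast Nat.pos_of_ne_zero (NeZero.ne k)
  obtain ⟨⟨a₀, b₀⟩, hp⟩ := exists_eq_ciSup_of_finite (f := fun p : Fin k × Fin k =>
    |D.W i j p.1 p.2|)
  have hmax : η ≤ |D.W i j a₀ b₀| := (hI i j h).trans (le_of_eq hp.symm)
  have hdiff : ∀ a, D.oddsCoef i a j b₀ = D.W i j a b₀ - D.W i j 0 b₀ := fun a => by
    simp [oddsCoef, hij.symm]
  suffices ∃ a, η ≤ 2 * |D.W i j a b₀ - D.W i j 0 b₀| by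
    obtain ⟨a, ha⟩ := this
    refine ⟨a, b₀, ?_, by rwa [hdiff]⟩
    rintro rfl
    rw [sub_self, abs_zero] at ha
    linarith
  by_contra hcon
  push Not at hcon
  have hsum : (k : ℝ) * D.W i j 0 b₀ = -∑ a, (D.W i j a b₀ - D.W i j 0 b₀) := by
    rw [Finset.sum_sub_distrib, (hD i j hij).2 b₀]
    simp
  have h0 : (k : ℝ) * |D.W i j 0 b₀| ≤ k * (η / 2) := by
    rw [← abs_of_pos hk, ← abs_mul, abs_of_pos hk, hsum, abs_neg]
    refine (Finset.abs_sum_le_sum_abs _ _).trans ((Finset.sum_le_sum fun a _ =>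
      (show _ ≤ η / 2 by linarith [hcon a])).trans ?_)
    simp
  have h1 := le_of_mul_le_mul_left h0 hk
  have h2 := abs_sub_abs_le_abs_sub (D.W i j a₀ b₀) (D.W i j 0 b₀)
  linarith [hcon a₀]

theorem oddsCoef_eq_zero_of_not_adj {i j : Fin n} (hij : i ≠ j)
    (h : ¬ D.dependencyGraph.Adj i j) (a b : Fin k) : D.oddsCoef i a j b = 0 := by
  have hW : D.W i j = 0 := by
    by_contra hW
    exact h ⟨hij, hW⟩
  simp [oddsCoef, hij.symm, hW]

end Prob

end NonbinaryIsing

/-! ## Concentration for statistics of an adaptive scan of independent samples -/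

section Scan

variable {σ Ω : Type*}

/-- The states of an online procedure with transition `step`. -/
def scan (step : σ → Ω → σ) (s : σ) (z : ℕ → Ω) : ℕ → σ
  | 0 => s
  | t + 1 => step (scan step s z t) (z t)

/-- `scan` unfolds at the last sample, whereas the induction below peels off the first. -/
theorem scan_succ_eq (step : σ → Ω → σ) (s : σ) (z : ℕ → Ω) (t : ℕ) :
    scan step s z (t + 1) = scan step (step s (z 0)) (fun t => z (t + 1)) t := by
  induction t with
  | zero => rfl
  | succ t ih => rw [scan, ih]; rfl

/-- A finite sample sequence continued by a default sample. -/
def extendSeq [Inhabited Ω] {N : ℕ} (Z : Fin N → Ω) (t : ℕ) : Ω :=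
  if h : t < N then Z ⟨t, h⟩ else default

theorem extendSeq_cons_zero [Inhabited Ω] {N : ℕ} (x : Ω) (Z : Fin N → Ω) :
    extendSeq (Fin.cons x Z : Fin (N + 1) → Ω) 0 = x := by
  simp only [extendSeq, Nat.succ_pos, dite_true]
  rfl

theorem extendSeq_cons_succ [Inhabited Ω] {N : ℕ} (x : Ω) (Z : Fin N → Ω) (t : ℕ) :
    extendSeq (Fin.cons x Z : Fin (N + 1) → Ω) (t + 1) = extendSeq Z t := by
  by_cases h : t < N
  · simp only [extendSeq, h, Nat.succ_lt_succ h, dite_true]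
    rfl
  · unfold extendSeq
    rw [dif_neg h, dif_neg fun h' => h (Nat.lt_of_succ_lt_succ h')]

/-- The product is a supermartingale started at 1: after the first sample the remaining ones are
handled from an arbitrary state. -/
theorem sum_prod_scan_le [Inhabited Ω] [Fintype Ω] {p : Ω → ℝ} (hp : ∀ x, 0 ≤ p x)
    (step : σ → Ω → σ) {φ : σ → Ω → ℝ} (hφ0 : ∀ s x, 0 ≤ φ s x)
    (hφ : ∀ s, ∑ x, p x * φ s x ≤ 1) (N : ℕ) (s : σ) :
    ∑ Z : Fin N → Ω, (∏ t, p (Z t)) * ∏ t ∈ Finset.range N,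
      φ (scan step s (extendSeq Z) t) (extendSeq Z t) ≤ 1 := by
  induction N generalizing s with
  | zero => simp
  | succ N ih =>
    rw [← Fintype.sum_equiv (Fin.consEquiv fun _ => Ω) (fun q => (p q.1 * φ s q.1) *
      ((∏ t, p (q.2 t)) * ∏ t ∈ Finset.range N,
        φ (scan step (step s q.1) (extendSeq q.2) t) (extendSeq q.2 t))) _ ?_]
    · rw [Fintype.sum_prod_type]
      simp only [← Finset.mul_sum]
      refine le_trans (Finset.sum_le_sum fun x _ => ?_) (hφ s)
      exact mul_le_of_le_one_right (mul_nonneg (hp x) (hφ0 s x)) (ih (step s x))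
    · rintro ⟨x, Z⟩
      rw [show (Fin.consEquiv fun _ => Ω) (x, Z) = (Fin.cons x Z : Fin (N + 1) → Ω) from rfl]
      rw [Fin.prod_univ_succ, Finset.prod_range_succ']
      simp only [scan_succ_eq, extendSeq_cons_succ, extendSeq_cons_zero, Fin.cons_zero,
        Fin.cons_succ]
      simp only [scan]
      ring

theorem pi_toMeasure_eq_sum [Fintype Ω] [MeasurableSpace Ω] [MeasurableSingletonClass Ω]
    {N : ℕ} (P : PMF Ω) {p : Ω → ℝ} (hp : ∀ x, 0 ≤ p x) (hP : ∀ x, P x = ENNReal.ofReal (p x))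
    (A : Set (Fin N → Ω)) [DecidablePred (· ∈ A)] :
    Measure.pi (fun _ : Fin N => P.toMeasure) A =
      ENNReal.ofReal (∑ Z, if Z ∈ A then ∏ t, p (Z t) else 0) := by
  have h : A = ((Finset.univ.filter (· ∈ A) : Finset (Fin N → Ω)) : Set (Fin N → Ω)) := by
    ext; simp
  conv_lhs => rw [h]
  rw [← sum_measure_singleton, ← Finset.sum_filter,
    ENNReal.ofReal_sum_of_nonneg fun Z _ => Finset.prod_nonneg fun t _ => hp _]
  refine Finset.sum_congr rfl fun Z _ => ?_
  rw [Measure.pi_singleton, ENNReal.ofReal_prod_of_nonneg fun t _ => hp _]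
  refine Finset.prod_congr rfl fun t _ => ?_
  rw [PMF.toMeasure_apply_singleton _ _ (measurableSet_singleton _), hP]

/-- Markov's inequality for the exponential of an adaptive sum. -/
theorem measure_scan_exp_le [Inhabited Ω] [Fintype Ω] [MeasurableSpace Ω]
    [MeasurableSingletonClass Ω] (P : PMF Ω) {p : Ω → ℝ} (hp : ∀ x, 0 ≤ p x)
    (hP : ∀ x, P x = ENNReal.ofReal (p x)) (step : σ → Ω → σ) {ψ : σ → Ω → ℝ}
    (hψ : ∀ s, ∑ x, p x * Real.exp (ψ s x) ≤ 1) (N : ℕ) (s : σ) {δ : ℝ} (hδ : 0 < δ) :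
    Measure.pi (fun _ : Fin N => P.toMeasure)
      {Z | Real.log δ⁻¹ < ∑ t ∈ Finset.range N,
        ψ (scan step s (extendSeq Z) t) (extendSeq Z t)} ≤ ENNReal.ofReal δ := by
  classical
  rw [pi_toMeasure_eq_sum P hp hP]
  refine ENNReal.ofReal_le_ofReal ?_
  have h := sum_prod_scan_le hp step (φ := fun s x => Real.exp (ψ s x))
    (fun _ _ => (Real.exp_pos _).le) hψ N s
  refine le_trans ?_ (mul_le_of_le_one_right hδ.le h)
  rw [Finset.mul_sum]
  refine Finset.sum_le_sum fun Z _ => ?_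
  have hZ : 0 ≤ ∏ t, p (Z t) := Finset.prod_nonneg fun t _ => hp _
  rw [← Real.exp_sum]
  split_ifs with hA
  · rw [Set.mem_ofPred_eq, Real.log_lt_iff_lt_exp (inv_pos.mpr hδ)] at hA
    have h1 : 1 ≤ δ * Real.exp (∑ t ∈ Finset.range N,
        ψ (scan step s (extendSeq Z) t) (extendSeq Z t)) := by
      rw [← mul_inv_cancel₀ hδ.ne']
      exact mul_le_mul_of_nonneg_left hA.le hδ.le
    nlinarith
  · positivity

/-- A Bernstein bound for adaptive sums with bounded conditional second moments. -/
theorem measure_scan_deviation_le [Inhabited Ω] [Fintype Ω] [MeasurableSpace Ω]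
    [MeasurableSingletonClass Ω] (P : PMF Ω) {p : Ω → ℝ} (hp : ∀ x, 0 ≤ p x)
    (hp1 : ∑ x, p x = 1) (hP : ∀ x, P x = ENNReal.ofReal (p x)) (step : σ → Ω → σ)
    {ξ : σ → Ω → ℝ} {r v : ℝ} (hr : 0 < r) (hξ : ∀ s x, r * |ξ s x| ≤ 1)
    (hv : ∀ s, ∑ x, p x * ξ s x ^ 2 ≤ v) (N : ℕ) (s : σ) {δ : ℝ} (hδ : 0 < δ) :
    Measure.pi (fun _ : Fin N => P.toMeasure)
      {Z | Real.log δ⁻¹ / r + N * (r * v) < ∑ t ∈ Finset.range N,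
        (ξ (scan step s (extendSeq Z) t) (extendSeq Z t) -
          ∑ x, p x * ξ (scan step s (extendSeq Z) t) x)} ≤ ENNReal.ofReal δ := by
  -- By e^u ≤ 1 + u + u² for |u| ≤ 1, the moment generating function at `r` is at most exp(r m + r²
  -- v), where m is the conditional mean.
  have hψ : ∀ s, ∑ x, p x * Real.exp (r * (ξ s x - ∑ x, p x * ξ s x) - r ^ 2 * v) ≤ 1 := by
    intro s
    set m := ∑ x, p x * ξ s x with hm
    have h1 : ∑ x, p x * Real.exp (r * ξ s x) ≤ 1 + r * m + r ^ 2 * v := by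
      have h2 : ∑ x, p x * Real.exp (r * ξ s x) ≤
          ∑ x, (p x + r * (p x * ξ s x) + r ^ 2 * (p x * ξ s x ^ 2)) := by
        refine Finset.sum_le_sum fun x _ => ?_
        have hb : |r * ξ s x| ≤ 1 := by rw [abs_mul, abs_of_pos hr]; exact hξ s x
        refine (mul_le_mul_of_nonneg_left (Real.exp_le_one_add_add_sq hb) (hp x)).trans
          (le_of_eq (by ring))
      rw [Finset.sum_add_distrib, Finset.sum_add_distrib, ← Finset.mul_sum, ← Finset.mul_sum,
        hp1, ← hm] at h2
      nlinarith [hv s, sq_nonneg r]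
    have h3 : 1 + r * m + r ^ 2 * v ≤ Real.exp (r * m + r ^ 2 * v) := by
      linarith [Real.add_one_le_exp (r * m + r ^ 2 * v)]
    have h4 : ∀ x, p x * Real.exp (r * (ξ s x - m) - r ^ 2 * v) =
        p x * Real.exp (r * ξ s x) * (Real.exp (r * m + r ^ 2 * v))⁻¹ := by
      intro x
      rw [← Real.exp_neg, mul_assoc, ← Real.exp_add]
      congr 2
      ring
    simp only [h4]
    rw [← Finset.sum_mul, ← div_eq_mul_inv, div_le_one (Real.exp_pos _)]
    exact h1.trans h3
  refine le_trans (measure_mono ?_) (measure_scan_exp_le P hp hP step hψ N s hδ)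
  intro Z hZ
  simp only [Set.mem_ofPred_eq] at hZ ⊢
  rw [Finset.sum_sub_distrib, ← Finset.mul_sum, Finset.sum_const, Finset.card_range, nsmul_eq_mul]
  have h5 := mul_lt_mul_of_pos_left hZ hr
  have h6 : r * (Real.log δ⁻¹ / r + N * (r * v)) = Real.log δ⁻¹ + N * (r ^ 2 * v) := by
    field_simp
  linarith

end Scan

/-! ## The learner and its test statistic -/

namespace StructureLearner

open NonbinaryIsing SignedHedge

variable {n k : ℕ}

/-- The number of samples suffices for the test. -/
structure Regime (n k N : ℕ) (lam η ρ : ℝ) : Prop where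
  two_le : 2 ≤ n
  lam_nonneg : 0 ≤ lam
  η_pos : 0 < η
  η_lt : η < 1
  ρ_pos : 0 < ρ
  ρ_lt : ρ < 1
  le_samples : 2 ^ 40 * Real.exp lam ^ 60 * (k : ℝ) ^ 3 * Real.log (n / (ρ * η)) ≤ N * η ^ 4

namespace Regime

variable {N : ℕ} {lam η ρ : ℝ}

/-- Here n ≥ 2 matters. The bound lets constants, and k itself, be absorbed into multiples of k ·
log(n/(ρη)). -/
theorem half_le_log (R : Regime n k N lam η ρ) : 1 / 2 ≤ Real.log (n / (ρ * η)) := by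
  have h2 : (2 : ℝ) ≤ n := by exact_mod_cast R.two_le
  have h3 : ρ * η ≤ 1 := mul_le_one₀ R.ρ_lt.le R.η_pos.le R.η_lt.le
  have h4 : (2 : ℝ) ≤ n / (ρ * η) := by
    rw [le_div_iff₀ (mul_pos R.ρ_pos R.η_pos)]; linarith
  linarith [Real.log_le_log (by norm_num) h4, Real.log_two_gt_d9]

theorem log_le (R : Regime n k N lam η ρ) : Real.log n ≤ Real.log (n / (ρ * η)) := by
  have h2 : (2 : ℝ) ≤ n := by exact_mod_cast R.two_le
  have h3 : ρ * η ≤ 1 := mul_le_one₀ R.ρ_lt.le R.η_pos.le R.η_lt.le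
  refine Real.log_le_log (by linarith) ?_
  rw [le_div_iff₀ (mul_pos R.ρ_pos R.η_pos)]
  nlinarith

end Regime

variable [NeZero k]

/-- The scores of all problems `(i, a)`. -/
abbrev Scores (n k : ℕ) := Fin n → Fin k → Fin n → Fin k → ℝ

/-- The prediction of problem `(i, a)` on `x`. -/
noncomputable def prediction (L β : ℝ) (s : Scores n k) (i : Fin n) (a : Fin k)
    (x : Fin n → Fin k) : ℝ := predict L β (s i a) (mask i x)

/-- The residual of problem `(i, a)` on `x`. -/
noncomputable def residual (L β : ℝ) (s : Scores n k) (i : Fin n) (a : Fin k)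
    (x : Fin n → Fin k) : ℝ :=
  gate i a x * (label i a x - Real.sigmoid (prediction L β s i a x))

/-- The scores after the sample `x`. -/
noncomputable def nextScores (L β : ℝ) (s : Scores n k) (x : Fin n → Fin k) : Scores n k :=
  fun i a j b => s i a j b + if mask i x j = b then residual L β s i a x else 0

/-- The prediction in which the contribution of variable `j` is replaced by its mean. -/
noncomputable def looPrediction (L β : ℝ) (s : Scores n k) (i : Fin n) (a : Fin k) (j : Fin n)
    (x : Fin n → Fin k) : ℝ :=
  prediction L β s i a x - coef L β (s i a) j (mask i x j) + (∑ b, coef L β (s i a) j b) / k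

/-- The contribution of the sample `x` to the test statistic `(i, a, j, b)`. -/
noncomputable def testTerm (L β : ℝ) (i : Fin n) (a : Fin k) (j : Fin n) (b : Fin k)
    (s : Scores n k) (x : Fin n → Fin k) : ℝ :=
  gate i a x * (label i a x - Real.sigmoid (looPrediction L β s i a j x)) *
    if mask i x j = b then 1 else 0

/-- The scores before sample `t`. -/
noncomputable def scores (L β : ℝ) (z : ℕ → Fin n → Fin k) (t : ℕ) : Scores n k :=
  scan (nextScores L β) (fun _ _ _ _ => 0) z t

/-- The test statistic `(i, a, j, b)` after `N` samples. -/
noncomputable def testStat (L β : ℝ) (z : ℕ → Fin n → Fin k) (N : ℕ) (i : Fin n) (a : Fin k)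
    (j : Fin n) (b : Fin k) : ℝ :=
  ∑ t ∈ Finset.range N, testTerm L β i a j b (scores L β z t) (z t)

theorem prediction_update_self (L β : ℝ) (s : Scores n k) (i : Fin n) (a : Fin k)
    (x : Fin n → Fin k) (c : Fin k) :
    prediction L β s i a (Function.update x i c) = prediction L β s i a x := by
  unfold prediction
  rw [mask_update_self]

theorem abs_prediction_le {L : ℝ} (hL : 0 ≤ L) (β : ℝ) (s : Scores n k) (i : Fin n) (a : Fin k)
    (x : Fin n → Fin k) : |prediction L β s i a x| ≤ L :=
  haveI : Nonempty (Fin n) := ⟨i⟩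
  abs_predict_le hL _ _

/-- A prediction is a sum over groups, so averaging over `x j` touches only group `j`. This makes
the averaged prediction cheap to compute. -/
theorem averageAt_prediction (L β : ℝ) (s : Scores n k) {i j : Fin n} (hji : j ≠ i) (a : Fin k)
    (x : Fin n → Fin k) :
    averageAt (prediction L β s i a) j x = looPrediction L β s i a j x := by
  have hk : (k : ℝ) ≠ 0 := by exact_mod_cast NeZero.ne k
  have h : ∀ b, prediction L β s i a (Function.update x j b) =
      prediction L β s i a x - coef L β (s i a) j (mask i x j) + coef L β (s i a) j b := by
    intro b
    unfold prediction predict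
    rw [← Finset.add_sum_erase _ _ (Finset.mem_univ j),
      ← Finset.add_sum_erase _ (fun l => coef L β (s i a) l (mask i x l)) (Finset.mem_univ j)]
    have h1 : ∑ l ∈ Finset.univ.erase j,
        coef L β (s i a) l (mask i (Function.update x j b) l) =
        ∑ l ∈ Finset.univ.erase j, coef L β (s i a) l (mask i x l) := by
      refine Finset.sum_congr rfl fun l hl => ?_
      have hl' := Finset.ne_of_mem_erase hl
      by_cases hli : l = i
      · subst hli; simp [mask]
      · simp [mask, hli, hl']
    rw [h1]
    simp only [mask, Function.update_of_ne hji, Function.update_self]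
    ring
  unfold averageAt looPrediction
  simp only [h]
  rw [Finset.sum_add_distrib, Finset.sum_const, Finset.card_univ, Fintype.card_fin, nsmul_eq_mul]
  field_simp

theorem testTerm_zero (L β : ℝ) (i j : Fin n) (b : Fin k) (s : Scores n k) (x : Fin n → Fin k) :
    testTerm L β i 0 j b s x = 0 := by
  simp [testTerm, gate]

theorem testTerm_eq (L β : ℝ) {i j : Fin n} (hji : j ≠ i) (a b : Fin k) (s : Scores n k)
    (x : Fin n → Fin k) :
    testTerm L β i a j b s x = gate i a x *
      (label i a x - Real.sigmoid (averageAt (prediction L β s i a) j x)) *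
        if x j = b then 1 else 0 := by
  unfold testTerm
  rw [averageAt_prediction L β s hji a x]
  simp only [mask, Function.update_of_ne hji]

theorem abs_testTerm_le (L β : ℝ) (i : Fin n) (a : Fin k) (j : Fin n) (b : Fin k)
    (s : Scores n k) (x : Fin n → Fin k) : |testTerm L β i a j b s x| ≤ 1 := by
  unfold testTerm
  split_ifs
  · rw [mul_one]; exact abs_gate_mul_le _ _ _ _
  · simp

/-- The increment is bounded by 1 and vanishes unless `x i` is 0 or `a` and `x j = b`. The resulting
1/k² offsets the scaling of the statistic by k². -/
theorem sum_prob_testTerm_sq_le (D : NonbinaryIsing n k) {lam : ℝ} (hlam : D.width ≤ lam)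
    (L β : ℝ) {i j : Fin n} (hji : j ≠ i) {a : Fin k} (ha : a ≠ 0) (b : Fin k)
    (s : Scores n k) :
    ∑ x, D.prob x * testTerm L β i a j b s x ^ 2 ≤ 2 * Real.exp (4 * lam) / (k : ℝ) ^ 2 := by
  have hk : (0 : ℝ) < k := by exact_mod_cast Nat.pos_of_ne_zero (NeZero.ne k)
  rw [le_div_iff₀ (by positivity), mul_comm]
  refine le_trans ?_ (D.sum_pairProb_le hlam i a j b)
  rw [← D.sum_prob_gate_pair ha hji b]
  refine mul_le_mul_of_nonneg_left (Finset.sum_le_sum fun x _ =>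
    mul_le_mul_of_nonneg_left ?_ (D.prob_pos x).le) (by positivity)
  have h1 := (sq_le_one_iff_abs_le_one _).mpr (abs_testTerm_le L β i a j b s x)
  have h2 : testTerm L β i a j b s x ^ 2 = (gate i a x * if x j = b then 1 else 0) *
      testTerm L β i a j b s x ^ 2 := by
    rw [testTerm_eq L β hji]
    unfold gate
    split_ifs <;> simp
  rw [h2]
  refine mul_le_of_le_one_right ?_ h1
  unfold gate
  split_ifs <;> simp

/-- The regret increment of problem `(i, a)`. -/
noncomputable def regretTerm (D : NonbinaryIsing n k) (L β : ℝ) (i : Fin n) (a : Fin k)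
    (s : Scores n k) (x : Fin n → Fin k) : ℝ :=
  residual L β s i a x * (D.logOdds i a x - prediction L β s i a x)

theorem sum_regretTerm_le (D : NonbinaryIsing n k) {lam β : ℝ} (hlam : D.width ≤ lam)
    (hβ0 : 0 < β) (hβ1 : β ≤ 1) (z : ℕ → Fin n → Fin k) (N : ℕ) (i : Fin n) (a : Fin k) :
    ∑ t ∈ Finset.range N, regretTerm D (2 * lam) β i a (scores (2 * lam) β z t) (z t) ≤
      2 * lam * ((Real.log n + k) / β + N * β) := by
  have : Nonempty (Fin n) := ⟨i⟩
  have h := regret_le (L := 2 * lam) hβ0 hβ1 (S := fun t => scores (2 * lam) β z t i a)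
    (x := fun t => mask i (z t)) (c := fun t => residual (2 * lam) β (scores (2 * lam) β z t) i a (z t))
    (fun _ _ => rfl) N (fun t _ j b => rfl) (fun t _ => abs_gate_mul_le _ _ _ _)
    (D.oddsCoef i a) (D.oddsBound i a) (D.abs_oddsCoef_le i a) (D.oddsBound_nonneg i a)
    ((D.sum_oddsBound_le i a).trans (by linarith))
  rw [Fintype.card_fin, Fintype.card_fin] at h
  exact h

theorem abs_regretTerm_le (D : NonbinaryIsing n k) {lam : ℝ} (h0 : 0 ≤ lam)
    (hlam : D.width ≤ lam) (β : ℝ) (i : Fin n) (a : Fin k) (s : Scores n k)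
    (x : Fin n → Fin k) : |regretTerm D (2 * lam) β i a s x| ≤ 4 * lam := by
  unfold regretTerm
  rw [abs_mul]
  have h1 : |residual (2 * lam) β s i a x| ≤ 1 := abs_gate_mul_le _ _ _ _
  have h2 := D.abs_logOdds_le i a x
  have h3 := abs_prediction_le (L := 2 * lam) (by linarith) β s i a x
  have h4 := abs_sub (D.logOdds i a x) (prediction (2 * lam) β s i a x)
  calc _ ≤ 1 * (4 * lam) := mul_le_mul h1 (by linarith) (abs_nonneg _) zero_le_one
    _ = _ := one_mul _

/-! ## Correctness of the test -/

/-- The step size of the learner. -/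
noncomputable def stepSize (k : ℕ) (lam η : ℝ) : ℝ :=
  η ^ 2 / (2 ^ 20 * Real.exp lam ^ 30 * k)

/-- The threshold of the test. -/
noncomputable def threshold (k N : ℕ) (lam η : ℝ) : ℝ :=
  N * η / (8 * Real.exp lam ^ 6 * (k : ℝ) ^ 2)

namespace Regime

variable {N : ℕ} {lam η ρ : ℝ}

/-- The failure probability allotted to every single deviation event. -/
noncomputable def delta (n k : ℕ) (ρ : ℝ) : ℝ := ρ / (3 * (n : ℝ) ^ 2 * (k : ℝ) ^ 2)

/-- The factor k comes from the crude bound log k ≤ k - 1, which a sample size of order k³ can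
afford. -/
theorem log_delta_le (R : Regime n k N lam η ρ) :
    Real.log (delta n k ρ)⁻¹ ≤ 10 * k * Real.log (n / (ρ * η)) := by
  have hk : (1 : ℝ) ≤ k := by exact_mod_cast Nat.pos_of_ne_zero (NeZero.ne k)
  have hn : (2 : ℝ) ≤ n := by exact_mod_cast R.two_le
  have hl := R.half_le_log
  have hρ := R.ρ_pos
  have hη := R.η_pos
  have h1 : Real.log (n / (ρ * η)) = Real.log n - Real.log ρ - Real.log η := by
    rw [Real.log_div (by positivity) (by positivity), Real.log_mul hρ.ne' hη.ne']; ring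
  have h2 : Real.log (delta n k ρ)⁻¹ =
      Real.log 3 + 2 * Real.log n + 2 * Real.log k - Real.log ρ := by
    unfold delta
    rw [inv_div, Real.log_div (by positivity) (by positivity), Real.log_mul (by positivity)
      (by positivity), Real.log_mul (by positivity) (by positivity), Real.log_pow, Real.log_pow]
    push_cast; ring
  have h3 := Real.log_nonpos hη.le R.η_lt.le
  have h4 := Real.log_nonpos hρ.le R.ρ_lt.le
  have h5 := Real.log_le_sub_one_of_pos (show (0 : ℝ) < k by linarith)
  have h6 := Real.log_three_lt_d9
  have h7 := R.log_le
  rw [h2]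
  set l := Real.log (n / (ρ * η))
  have h8 : l ≤ k * l := by nlinarith
  have h9 : (k : ℝ) * (1 / 2) ≤ k * l := mul_le_mul_of_nonneg_left hl (by linarith)
  nlinarith

theorem delta_pos (R : Regime n k N lam η ρ) : 0 < delta n k ρ := by
  have hk : (0 : ℝ) < k := by exact_mod_cast Nat.pos_of_ne_zero (NeZero.ne k)
  have hn : (2 : ℝ) ≤ n := by exact_mod_cast R.two_le
  have := R.ρ_pos
  unfold delta
  positivity

theorem stepSize_pos (R : Regime n k N lam η ρ) : 0 < stepSize k lam η := by
  have hk : (0 : ℝ) < k := by exact_mod_cast Nat.pos_of_ne_zero (NeZero.ne k)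
  have := R.η_pos
  unfold stepSize
  positivity

/-- Makes the step size admissible as the rate in the deviation bound for regret increments, which
are at most 4λ ≤ 4e^λ. -/
theorem stepSize_mul_le (R : Regime n k N lam η ρ) : stepSize k lam η * (4 * Real.exp lam) ≤ 1 := by
  have hk : (1 : ℝ) ≤ k := by exact_mod_cast Nat.pos_of_ne_zero (NeZero.ne k)
  have hE := Real.one_le_exp R.lam_nonneg
  have hη := R.η_pos
  have hη2 : η ^ 2 ≤ 1 := pow_le_one₀ hη.le R.η_lt.le
  have h29 : 1 ≤ Real.exp lam ^ 29 := one_le_pow₀ hE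
  unfold stepSize
  rw [div_mul_eq_mul_div, div_le_one (by positivity)]
  calc η ^ 2 * (4 * Real.exp lam) ≤ 1 * (4 * Real.exp lam) := by gcongr
    _ ≤ 2 ^ 20 * Real.exp lam * (1 * 1) := by nlinarith
    _ ≤ 2 ^ 20 * Real.exp lam * (Real.exp lam ^ 29 * k) := by gcongr
    _ = _ := by ring

theorem stepSize_le_one (R : Regime n k N lam η ρ) : stepSize k lam η ≤ 1 := by
  nlinarith [R.stepSize_mul_le, R.stepSize_pos, Real.one_le_exp R.lam_nonneg]

end Regime

end StructureLearner

/-! ### The sample size meets the error budgets -/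

namespace StructureLearner

open NonbinaryIsing SignedHedge

namespace Regime

variable {n k : ℕ} {N : ℕ} {lam η ρ : ℝ}

/-- The prefactor 4e^{4λ}k converts drift of regret into squared error. With β of order η²/k, the
terms with 1/β become k³/η² times the logarithm and those with β become Nη²; this dictates N of
order k³/η⁴. -/
theorem regret_budget_le [NeZero k] (R : Regime n k N lam η ρ) :
    4 * Real.exp lam ^ 4 * k * (2 * lam * ((Real.log n + k) / stepSize k lam η +
      N * stepSize k lam η) + (Real.log (delta n k ρ)⁻¹ / stepSize k lam η +
        N * (stepSize k lam η * (16 * Real.exp lam ^ 2)))) ≤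
      N * (η / (64 * Real.exp lam ^ 12)) ^ 2 := by
  have hk : (1 : ℝ) ≤ k := by exact_mod_cast Nat.pos_of_ne_zero (NeZero.ne k)
  have hE := Real.one_le_exp R.lam_nonneg
  have hlE : lam ≤ Real.exp lam := by linarith [Real.add_one_le_exp lam]
  have hη := R.η_pos
  have hl := R.half_le_log
  have hd := R.log_delta_le
  have hn := R.log_le
  have hN := R.le_samples
  have hβ := R.stepSize_pos
  have h0 := R.lam_nonneg
  have hlogn : 0 ≤ Real.log n := Real.log_natCast_nonneg n
  set l := Real.log (n / (ρ * η))
  set e := Real.exp lam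
  set b := stepSize k lam η with hb
  have hkl : (k : ℝ) ≤ 2 * k * l := by nlinarith
  have hl' : l ≤ k * l := by nlinarith
  have h1 : 2 * lam * (Real.log n + k) + Real.log (delta n k ρ)⁻¹ ≤ 16 * e * k * l := by
    have : 2 * lam * (Real.log n + k) ≤ 2 * e * (3 * (k * l)) := by
      refine mul_le_mul (by linarith) (by linarith) (by positivity) (by positivity)
    have : 10 * k * l ≤ 10 * e * k * l := by
      have : 0 ≤ k * l := by nlinarith
      nlinarith
    linarith
  have h2 : 2 * lam * (N * b) + N * (b * (16 * e ^ 2)) ≤ 18 * e ^ 2 * (N * b) := by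
    have h3 : lam ≤ e ^ 2 := by nlinarith
    have h4 : 0 ≤ N * b := by positivity
    nlinarith
  have h5 : 2 * lam * ((Real.log n + k) / b + N * b) + (Real.log (delta n k ρ)⁻¹ / b +
      N * (b * (16 * e ^ 2))) ≤ 16 * e * k * l / b + 18 * e ^ 2 * (N * b) := by
    have := div_le_div_of_nonneg_right h1 hβ.le
    rw [add_div, mul_div_assoc] at this
    linarith
  refine (mul_le_mul_of_nonneg_left h5 (by positivity)).trans ?_
  have hepos : 0 < e := by linarith
  have h6 : 4 * e ^ 4 * k * (16 * e * k * l / b) = 2 ^ 26 * e ^ 35 * k ^ 3 * l / η ^ 2 := by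
    rw [hb, stepSize]
    field_simp
    ring
  have h7 : 4 * e ^ 4 * k * (18 * e ^ 2 * (N * b)) = 72 * N * η ^ 2 / (2 ^ 20 * e ^ 24) := by
    rw [hb, stepSize]
    field_simp
    ring
  have h8 : 2 ^ 26 * e ^ 35 * k ^ 3 * l / η ^ 2 ≤ N * η ^ 2 / (2 ^ 14 * e ^ 24) := by
    rw [div_le_div_iff₀ (by positivity) (by positivity)]
    have h9 : e ^ 59 ≤ e ^ 60 := pow_le_pow_right₀ hE (by norm_num)
    calc _ = 2 ^ 40 * e ^ 59 * k ^ 3 * l := by ring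
      _ ≤ 2 ^ 40 * e ^ 60 * k ^ 3 * l := by gcongr
      _ ≤ N * η ^ 4 := hN
      _ = _ := by ring
  rw [mul_add, h6, h7]
  -- In this unit the budget is 256 and the two contributions are at most 64 and 72.
  have h10 : N * (η / (64 * e ^ 12)) ^ 2 = 256 * (N * η ^ 2 / (2 ^ 20 * e ^ 24)) := by
    field_simp
    ring
  have h11 : N * η ^ 2 / (2 ^ 14 * e ^ 24) = 64 * (N * η ^ 2 / (2 ^ 20 * e ^ 24)) := by
    field_simp
    ring
  have h12 : 72 * N * η ^ 2 / (2 ^ 20 * e ^ 24) = 72 * (N * η ^ 2 / (2 ^ 20 * e ^ 24)) := by ring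
  have h13 : 0 ≤ N * η ^ 2 / (2 ^ 20 * e ^ 24) := by positivity
  rw [h10, h12]
  rw [h11] at h8
  linarith

/-- The deviation parameter for the test statistics. -/
noncomputable def testRate (lam η : ℝ) : ℝ := η / (128 * Real.exp lam ^ 10)

theorem testRate_pos (R : Regime n k N lam η ρ) : 0 < testRate lam η := by
  have := R.η_pos
  unfold testRate
  positivity

theorem testRate_le_one (R : Regime n k N lam η ρ) : testRate lam η ≤ 1 := by
  have h := one_le_pow₀ (Real.one_le_exp R.lam_nonneg) (n := 10)
  unfold testRate
  rw [div_le_one (by positivity)]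
  linarith [R.η_lt]

/-- Each term takes at most half of the budget; in the variance term the powers of k cancel. -/
theorem test_budget_le [NeZero k] (R : Regime n k N lam η ρ) :
    (k : ℝ) ^ 2 * (Real.log (delta n k ρ)⁻¹ / testRate lam η +
      N * (testRate lam η * (2 * Real.exp (4 * lam) / (k : ℝ) ^ 2))) ≤
      N * η / (32 * Real.exp lam ^ 6) := by
  have hk : (1 : ℝ) ≤ k := by exact_mod_cast Nat.pos_of_ne_zero (NeZero.ne k)
  have hE := Real.one_le_exp R.lam_nonneg
  have hη := R.η_pos
  have hl := R.half_le_log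
  have hd := R.log_delta_le
  have hN := R.le_samples
  have h4 : Real.exp (4 * lam) = Real.exp lam ^ 4 := by rw [← Real.exp_nat_mul]; norm_num
  rw [h4]
  set l := Real.log (n / (ρ * η))
  set e := Real.exp lam
  have hepos : 0 < e := by linarith
  have h1 : (k : ℝ) ^ 2 * (N * (testRate lam η * (2 * e ^ 4 / (k : ℝ) ^ 2))) =
      N * η / (64 * e ^ 6) := by
    rw [show testRate lam η = η / (128 * e ^ 10) from rfl]
    field_simp
    ring
  have h2 : (k : ℝ) ^ 2 * (Real.log (delta n k ρ)⁻¹ / testRate lam η) ≤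
      N * η / (64 * e ^ 6) := by
    have h3 : (k : ℝ) ^ 2 * (Real.log (delta n k ρ)⁻¹ / testRate lam η) =
        128 * e ^ 10 * k ^ 2 * Real.log (delta n k ρ)⁻¹ / η := by
      rw [show testRate lam η = η / (128 * e ^ 10) from rfl]
      field_simp
    rw [h3, div_le_div_iff₀ hη (by positivity)]
    have hη4 : η ^ 4 ≤ η ^ 2 := pow_le_pow_of_le_one hη.le R.η_lt.le (by norm_num)
    have h5 : e ^ 16 ≤ e ^ 60 := pow_le_pow_right₀ hE (by norm_num)
    calc 128 * e ^ 10 * k ^ 2 * Real.log (delta n k ρ)⁻¹ * (64 * e ^ 6)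
        ≤ 128 * e ^ 10 * k ^ 2 * (10 * k * l) * (64 * e ^ 6) := by gcongr
      _ = 81920 * e ^ 16 * k ^ 3 * l := by ring
      _ ≤ 2 ^ 40 * e ^ 60 * k ^ 3 * l := by gcongr; norm_num
      _ ≤ N * η ^ 4 := hN
      _ ≤ N * η ^ 2 := by gcongr
      _ = _ := by ring
  rw [mul_add, h1]
  have h6 : N * η / (32 * e ^ 6) = N * η / (64 * e ^ 6) + N * η / (64 * e ^ 6) := by
    field_simp
    ring
  linarith

end Regime

/-! ### From small regret to correct detection -/

section Correctness

variable {n k : ℕ} [NeZero k] {N : ℕ} {lam η ρ : ℝ} (D : NonbinaryIsing n k)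

/-- The regret drift of problem `(i, a)` deviates from the regret. -/
def RegretDeviates (n k N : ℕ) [NeZero k] (lam η ρ : ℝ) (D : NonbinaryIsing n k) (i : Fin n)
    (a : Fin k) (z : ℕ → Fin n → Fin k) : Prop :=
  Real.log (Regime.delta n k ρ)⁻¹ / stepSize k lam η +
      N * (stepSize k lam η * (16 * Real.exp lam ^ 2)) <
    ∑ t ∈ Finset.range N,
      (-regretTerm D (2 * lam) (stepSize k lam η) i a
          (scores (2 * lam) (stepSize k lam η) z t) (z t) -
        ∑ x, D.prob x * -regretTerm D (2 * lam) (stepSize k lam η) i a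
          (scores (2 * lam) (stepSize k lam η) z t) x)

/-- The test statistic `(i, a, j, b)` deviates from its drift in the direction `c`. -/
def TestDeviates (n k N : ℕ) [NeZero k] (lam η ρ : ℝ) (D : NonbinaryIsing n k) (c : ℝ)
    (i : Fin n) (a : Fin k) (j : Fin n) (b : Fin k) (z : ℕ → Fin n → Fin k) : Prop :=
  Real.log (Regime.delta n k ρ)⁻¹ / Regime.testRate lam η +
      N * (Regime.testRate lam η * (2 * Real.exp (4 * lam) / (k : ℝ) ^ 2)) <
    ∑ t ∈ Finset.range N,
      (c * testTerm (2 * lam) (stepSize k lam η) i a j b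
          (scores (2 * lam) (stepSize k lam η) z t) (z t) -
        ∑ x, D.prob x * (c * testTerm (2 * lam) (stepSize k lam η) i a j b
          (scores (2 * lam) (stepSize k lam η) z t) x))

/-- The realised regret is bounded for every sample sequence. Outside the deviation event its drift
is bounded too, and the drift dominates the squared error. -/
theorem sum_sq_error_le (R : Regime n k N lam η ρ) (hlam : D.width ≤ lam) {i : Fin n} {a : Fin k}
    (ha : a ≠ 0) {z : ℕ → Fin n → Fin k} (hz : ¬ RegretDeviates n k N lam η ρ D i a z) :
    ∑ t ∈ Finset.range N, ∑ x, D.prob x * (prediction (2 * lam) (stepSize k lam η)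
      (scores (2 * lam) (stepSize k lam η) z t) i a x - D.logOdds i a x) ^ 2 ≤
      N * (η / (64 * Real.exp lam ^ 12)) ^ 2 := by
  unfold RegretDeviates at hz
  rw [not_lt] at hz
  have hreg := sum_regretTerm_le D hlam R.stepSize_pos R.stepSize_le_one z N i a
  have hbud := R.regret_budget_le
  set β := stepSize k lam η
  have hdrift : Real.exp (-(4 * lam)) / 4 * ∑ t ∈ Finset.range N, ∑ x, D.prob x *
      (prediction (2 * lam) β (scores (2 * lam) β z t) i a x - D.logOdds i a x) ^ 2 ≤
      k * ∑ t ∈ Finset.range N, ∑ x, D.prob x *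
        regretTerm D (2 * lam) β i a (scores (2 * lam) β z t) x := by
    rw [Finset.mul_sum, Finset.mul_sum]
    refine Finset.sum_le_sum fun t _ => ?_
    exact D.sum_prob_regret_ge ha i hlam _ (fun x c => prediction_update_self _ _ _ i a x c)
      (fun x => abs_prediction_le (by linarith [R.lam_nonneg]) _ _ i a x)
  simp only [mul_neg, Finset.sum_neg_distrib, sub_neg_eq_add, Finset.sum_add_distrib] at hz
  have hk : (0 : ℝ) < k := by exact_mod_cast Nat.pos_of_ne_zero (NeZero.ne k)
  have h4 : Real.exp (-(4 * lam)) = (Real.exp lam ^ 4)⁻¹ := by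
    rw [Real.exp_neg, ← Real.exp_nat_mul]; norm_num
  rw [h4] at hdrift
  have he := Real.exp_pos lam
  set S := ∑ t ∈ Finset.range N, ∑ x, D.prob x *
      (prediction (2 * lam) β (scores (2 * lam) β z t) i a x - D.logOdds i a x) ^ 2
  set M := ∑ t ∈ Finset.range N, ∑ x, D.prob x *
      regretTerm D (2 * lam) β i a (scores (2 * lam) β z t) x
  refine le_trans ?_ hbud
  calc S = 4 * Real.exp lam ^ 4 * ((Real.exp lam ^ 4)⁻¹ / 4 * S) := by field_simp
    _ ≤ 4 * Real.exp lam ^ 4 * (k * M) := mul_le_mul_of_nonneg_left hdrift (by positivity)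
    _ = 4 * Real.exp lam ^ 4 * k * M := by ring
    _ ≤ _ := mul_le_mul_of_nonneg_left (by linarith) (by positivity)

/-- In units of Nηe^{-6λ}, 1/32 is the deviation of the statistic from its drift and 2/32 the effect
of the prediction error on the drift. -/
theorem abs_testStat_sub_signal_le (R : Regime n k N lam η ρ) (hD : D.IsCentered)
    (hlam : D.width ≤ lam) {i j : Fin n} (hji : j ≠ i) {a : Fin k} (ha : a ≠ 0) (b : Fin k)
    {z : ℕ → Fin n → Fin k} (hz : ¬ RegretDeviates n k N lam η ρ D i a z)
    (hz1 : ¬ TestDeviates n k N lam η ρ D 1 i a j b z)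
    (hz2 : ¬ TestDeviates n k N lam η ρ D (-1) i a j b z) :
    |(k : ℝ) ^ 2 * testStat (2 * lam) (stepSize k lam η) z N i a j b - N * D.signal i a j b| ≤
      3 / 32 * (N * η / Real.exp lam ^ 6) := by
  have hk : (0 : ℝ) < k := by exact_mod_cast Nat.pos_of_ne_zero (NeZero.ne k)
  have hη := R.η_pos
  have he := Real.exp_pos lam
  have hsq := sum_sq_error_le D R hlam ha hz
  have hbud := R.test_budget_le
  unfold TestDeviates at hz1 hz2
  rw [not_lt] at hz1 hz2
  set β := stepSize k lam η
  set B := Real.log (Regime.delta n k ρ)⁻¹ / Regime.testRate lam η +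
    N * (Regime.testRate lam η * (2 * Real.exp (4 * lam) / (k : ℝ) ^ 2))
  set M := ∑ t ∈ Finset.range N, ∑ x, D.prob x *
    testTerm (2 * lam) β i a j b (scores (2 * lam) β z t) x with hM
  set T := testStat (2 * lam) β z N i a j b with hT
  have hT' : ∑ t ∈ Finset.range N, testTerm (2 * lam) β i a j b (scores (2 * lam) β z t) (z t) = T :=
    rfl
  simp only [one_mul, neg_one_mul, mul_neg, Finset.sum_neg_distrib, Finset.sum_sub_distrib,
    sub_neg_eq_add, Finset.sum_add_distrib, hT', ← hM] at hz1 hz2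
  have h1 : |(k : ℝ) ^ 2 * T - k ^ 2 * M| ≤ N * η / (32 * Real.exp lam ^ 6) := by
    rw [← mul_sub, abs_mul, abs_of_pos (by positivity)]
    refine le_trans (mul_le_mul_of_nonneg_left ?_ (by positivity)) hbud
    rw [abs_le]
    constructor <;> linarith
  -- The root mean square error granted by `sum_sq_error_le`. The inequality |d| ≤ ν + d²/ν plays
  -- the role of Cauchy–Schwarz and gives 2Nν in total.
  set ν := η / (64 * Real.exp lam ^ 12) with hν
  have hνpos : 0 < ν := by positivity
  have h6 : Real.exp (6 * lam) = Real.exp lam ^ 6 := by rw [← Real.exp_nat_mul]; norm_num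
  have h2 : |(k : ℝ) ^ 2 * M - N * D.signal i a j b| ≤ 2 * Real.exp lam ^ 6 * (2 * (N * ν)) := by
    have h3 : (k : ℝ) ^ 2 * M - N * D.signal i a j b = ∑ t ∈ Finset.range N,
        ((k : ℝ) ^ 2 * ∑ x, D.prob x *
          testTerm (2 * lam) β i a j b (scores (2 * lam) β z t) x - D.signal i a j b) := by
      rw [Finset.sum_sub_distrib, ← Finset.mul_sum, Finset.sum_const, Finset.card_range,
        nsmul_eq_mul]
    rw [h3]
    refine (Finset.abs_sum_le_sum_abs _ _).trans ?_
    have h5 : ∀ t ∈ Finset.range N, |(k : ℝ) ^ 2 * ∑ x, D.prob x *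
          testTerm (2 * lam) β i a j b (scores (2 * lam) β z t) x - D.signal i a j b| ≤
        2 * Real.exp lam ^ 6 * (ν + (∑ x, D.prob x * (prediction (2 * lam) β
          (scores (2 * lam) β z t) i a x - D.logOdds i a x) ^ 2) / ν) := by
      intro t _
      have h := D.abs_drift_sub_signal_le hD hlam ha hji b
        (prediction (2 * lam) β (scores (2 * lam) β z t) i a)
        (fun x c => prediction_update_self _ _ _ i a x c)
      rw [h6] at h
      simp only [testTerm_eq (2 * lam) β hji]
      refine h.trans (mul_le_mul_of_nonneg_left ?_ (by positivity))
      have h7 : ν + (∑ x, D.prob x * (prediction (2 * lam) β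
          (scores (2 * lam) β z t) i a x - D.logOdds i a x) ^ 2) / ν =
          ∑ x, D.prob x * (ν + (prediction (2 * lam) β
          (scores (2 * lam) β z t) i a x - D.logOdds i a x) ^ 2 / ν) := by
        simp only [mul_add, Finset.sum_add_distrib, ← Finset.sum_mul, D.sum_prob, one_mul,
          Finset.sum_div, mul_div_assoc]
      rw [h7]
      refine Finset.sum_le_sum fun x _ => mul_le_mul_of_nonneg_left ?_ (D.prob_pos x).le
      set d := prediction (2 * lam) β (scores (2 * lam) β z t) i a x - D.logOdds i a x
      rw [← sq_abs d, ← sub_le_iff_le_add', le_div_iff₀ hνpos]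
      nlinarith [sq_nonneg (|d| - ν), abs_nonneg d]
    refine (Finset.sum_le_sum h5).trans ?_
    rw [← Finset.mul_sum]
    refine mul_le_mul_of_nonneg_left ?_ (by positivity)
    rw [Finset.sum_add_distrib, Finset.sum_const, Finset.card_range, nsmul_eq_mul,
      ← Finset.sum_div, two_mul (N * ν)]
    refine add_le_add_right ?_ _
    rw [div_le_iff₀ hνpos]
    linarith
  have h8 : 2 * Real.exp lam ^ 6 * (2 * (N * ν)) = 2 / 32 * (N * η / Real.exp lam ^ 6) := by
    rw [hν]
    field_simp
    ring
  have h9 : N * η / (32 * Real.exp lam ^ 6) = 1 / 32 * (N * η / Real.exp lam ^ 6) := by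
    field_simp
  rw [h8] at h2
  rw [h9] at h1
  have := abs_sub_le ((k : ℝ) ^ 2 * T) (k ^ 2 * M) (N * D.signal i a j b)
  linarith

/-- The pairs reported by the test. -/
def Detects (n k N : ℕ) [NeZero k] (lam η : ℝ) (z : ℕ → Fin n → Fin k) (i j : Fin n) : Prop :=
  ∃ a b, threshold k N lam η < |testStat (2 * lam) (stepSize k lam η) z N i a j b|

theorem Regime.samples_pos (R : Regime n k N lam η ρ) : (0 : ℝ) < N := by
  have hk : (0 : ℝ) < k := by exact_mod_cast Nat.pos_of_ne_zero (NeZero.ne k)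
  have hl := R.half_le_log
  have hη := R.η_pos
  have h : 0 < N * η ^ 4 := lt_of_lt_of_le (by positivity) R.le_samples
  exact pos_of_mul_pos_left h (by positivity)

/-- In units of `q` and after scaling by k², the error is at most 3/32, the threshold 4/32, and the
signal 0 or, for a suitable a and b, at least 8/32. -/
theorem detects_iff_adj (R : Regime n k N lam η ρ) (hD : D.IsCentered)
    (hlam : D.width ≤ lam) (hI : D.IsIdentifiable η) {i j : Fin n} (hji : j ≠ i)
    {z : ℕ → Fin n → Fin k} (hz : ∀ a, ¬ RegretDeviates n k N lam η ρ D i a z)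
    (hz1 : ∀ a b, a ≠ 0 → ¬ TestDeviates n k N lam η ρ D 1 i a j b z)
    (hz2 : ∀ a b, a ≠ 0 → ¬ TestDeviates n k N lam η ρ D (-1) i a j b z) :
    Detects n k N lam η z i j ↔ D.dependencyGraph.Adj i j := by
  have hk : (0 : ℝ) < k := by exact_mod_cast Nat.pos_of_ne_zero (NeZero.ne k)
  have he := Real.exp_pos lam
  have hη := R.η_pos
  have hN := R.samples_pos
  set q := N * η / Real.exp lam ^ 6 with hq
  have hqpos : 0 < q := by positivity
  have hth : threshold k N lam η = q / 8 / k ^ 2 := by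
    rw [threshold, hq]
    field_simp
  have hth' : ∀ T : ℝ, threshold k N lam η < |T| ↔ q / 8 < |(k : ℝ) ^ 2 * T| := fun T => by
    rw [hth, div_lt_iff₀ (by positivity), abs_mul, abs_of_pos (by positivity : (0 : ℝ) < k ^ 2),
      mul_comm]
  constructor
  · rintro ⟨a, b, hab⟩
    by_contra hadj
    -- Problem 0 is gated off, so its statistics vanish and cannot exceed the positive threshold.
    have ha : a ≠ 0 := by
      rintro rfl
      rw [hth'] at hab
      simp only [testStat, testTerm_zero, Finset.sum_const_zero, mul_zero, abs_zero] at hab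
      linarith
    have h := abs_testStat_sub_signal_le D R hD hlam hji ha b (hz a) (hz1 a b ha) (hz2 a b ha)
    rw [D.signal_eq_zero (D.oddsCoef_eq_zero_of_not_adj hji.symm hadj a b), mul_zero, sub_zero] at h
    rw [hth'] at hab
    linarith
  · intro hadj
    obtain ⟨a, b, ha, hab⟩ := D.exists_oddsCoef_of_adj hD hη hI hadj
    refine ⟨a, b, (hth' _).mpr ?_⟩
    have h := abs_testStat_sub_signal_le D R hD hlam hji ha b (hz a) (hz1 a b ha) (hz2 a b ha)
    have hs := D.abs_signal_ge hD hlam hji hab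
    have h6 : Real.exp (-(6 * lam)) = (Real.exp lam ^ 6)⁻¹ := by
      rw [Real.exp_neg, ← Real.exp_nat_mul]; norm_num
    rw [h6] at hs
    have hs' : q / 4 ≤ |N * D.signal i a j b| := by
      rw [abs_mul, abs_of_pos hN]
      calc q / 4 = N * ((Real.exp lam ^ 6)⁻¹ / 4 * η) := by rw [hq]; field_simp
        _ ≤ _ := mul_le_mul_of_nonneg_left hs hN.le
    have h2 := abs_sub_abs_le_abs_sub (N * D.signal i a j b)
      ((k : ℝ) ^ 2 * testStat (2 * lam) (stepSize k lam η) z N i a j b)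
    rw [abs_sub_comm] at h2
    linarith

/-! ## Union bound -/

theorem measure_regretDeviates_le (R : Regime n k N lam η ρ) (hlam : D.width ≤ lam) (i : Fin n)
    (a : Fin k) :
    Measure.pi (fun _ : Fin N => D.dist.toMeasure)
      {Z | RegretDeviates n k N lam η ρ D i a (extendSeq Z)} ≤
      ENNReal.ofReal (Regime.delta n k ρ) := by
  have he : lam ≤ Real.exp lam := by linarith [Real.add_one_le_exp lam]
  have h0 := R.lam_nonneg
  have hb : ∀ s x, |(-regretTerm D (2 * lam) (stepSize k lam η) i a s x)| ≤ 4 * Real.exp lam :=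
    fun s x => by
      rw [abs_neg]
      exact (abs_regretTerm_le D h0 hlam _ i a s x).trans (by linarith)
  refine measure_scan_deviation_le D.dist (fun x => (D.prob_pos x).le) D.sum_prob D.dist_apply
    (nextScores (2 * lam) (stepSize k lam η))
    (ξ := fun s x => -regretTerm D (2 * lam) (stepSize k lam η) i a s x) R.stepSize_pos
    (fun s x => (mul_le_mul_of_nonneg_left (hb s x) R.stepSize_pos.le).trans R.stepSize_mul_le)
    (fun s => ?_) N (fun _ _ _ _ => 0) R.delta_pos
  calc _ ≤ ∑ x, D.prob x * (16 * Real.exp lam ^ 2) := by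
        refine Finset.sum_le_sum fun x _ => mul_le_mul_of_nonneg_left ?_ (D.prob_pos x).le
        rw [← sq_abs]
        calc _ ≤ (4 * Real.exp lam) ^ 2 := pow_le_pow_left₀ (abs_nonneg _) (hb s x) 2
          _ = _ := by ring
    _ = _ := by rw [← Finset.sum_mul, D.sum_prob, one_mul]

theorem measure_testDeviates_le (R : Regime n k N lam η ρ) (hlam : D.width ≤ lam) {c : ℝ}
    (hc : |c| = 1) {i j : Fin n} (hji : j ≠ i) {a : Fin k} (ha : a ≠ 0) (b : Fin k) :
    Measure.pi (fun _ : Fin N => D.dist.toMeasure)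
      {Z | TestDeviates n k N lam η ρ D c i a j b (extendSeq Z)} ≤
      ENNReal.ofReal (Regime.delta n k ρ) := by
  have hb : ∀ s x, |c * testTerm (2 * lam) (stepSize k lam η) i a j b s x| ≤ 1 := fun s x => by
    rw [abs_mul, hc, one_mul]
    exact abs_testTerm_le _ _ i a j b s x
  refine measure_scan_deviation_le D.dist (fun x => (D.prob_pos x).le) D.sum_prob D.dist_apply
    (nextScores (2 * lam) (stepSize k lam η))
    (ξ := fun s x => c * testTerm (2 * lam) (stepSize k lam η) i a j b s x) R.testRate_pos
    (fun s x => mul_le_one₀ R.testRate_le_one (abs_nonneg _) (hb s x))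
    (fun s => ?_) N (fun _ _ _ _ => 0) R.delta_pos
  have hc2 : c ^ 2 = 1 := by rw [← sq_abs, hc, one_pow]
  simp only [mul_pow, hc2, one_mul]
  exact sum_prob_testTerm_sq_le D hlam _ _ hji ha b s

/-- There are nk + 2(nk)² ≤ 3(nk)² bad events of probability at most `delta` each, which adds up to
ρ. -/
theorem le_measure_detects (R : Regime n k N lam η ρ) (hD : D.IsCentered)
    (hlam : D.width ≤ lam) (hI : D.IsIdentifiable η) :
    ENNReal.ofReal (1 - ρ) ≤ Measure.pi (fun _ : Fin N => D.dist.toMeasure)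
      {Z | ∀ i j, j ≠ i → (Detects n k N lam η (extendSeq Z) i j ↔ D.dependencyGraph.Adj i j)} := by
  set μ := Measure.pi (fun _ : Fin N => D.dist.toMeasure) with hμ
  have hk : (1 : ℝ) ≤ k := by exact_mod_cast Nat.pos_of_ne_zero (NeZero.ne k)
  have hn : (2 : ℝ) ≤ n := by exact_mod_cast R.two_le
  set B1 : Fin n × Fin k → Set (Fin N → Fin n → Fin k) := fun p =>
    {Z | RegretDeviates n k N lam η ρ D p.1 p.2 (extendSeq Z)} with hB1
  set B2 : ℝ → (Fin n × Fin k) × Fin n × Fin k → Set (Fin N → Fin n → Fin k) := fun c p =>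
    {Z | p.2.1 ≠ p.1.1 ∧ p.1.2 ≠ 0 ∧
      TestDeviates n k N lam η ρ D c p.1.1 p.1.2 p.2.1 p.2.2 (extendSeq Z)} with hB2
  set G := {Z : Fin N → Fin n → Fin k | ∀ i j, j ≠ i →
    (Detects n k N lam η (extendSeq Z) i j ↔ D.dependencyGraph.Adj i j)} with hG
  have hsub : Gᶜ ⊆ (⋃ p, B1 p) ∪ ((⋃ p, B2 1 p) ∪ ⋃ p, B2 (-1) p) := by
    intro Z hZ
    by_contra hcon
    simp only [Set.mem_union, Set.mem_iUnion, not_or, not_exists] at hcon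
    obtain ⟨h1, h2, h3⟩ := hcon
    refine hZ fun i j hji => detects_iff_adj D R hD hlam hI hji (fun a => h1 (i, a))
      (fun a b ha h => h2 ((i, a), j, b) ⟨hji, ha, h⟩)
      (fun a b ha h => h3 ((i, a), j, b) ⟨hji, ha, h⟩)
  have hm1 : μ (⋃ p, B1 p) ≤ ENNReal.ofReal (n * k * Regime.delta n k ρ) := by
    refine (measure_iUnion_fintype_le μ B1).trans ((Finset.sum_le_sum fun p _ =>
      measure_regretDeviates_le D R hlam p.1 p.2).trans (le_of_eq ?_))
    rw [Finset.sum_const, Finset.card_univ, nsmul_eq_mul, Fintype.card_prod, Fintype.card_fin,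
      Fintype.card_fin, ENNReal.ofReal_mul (by positivity), ← Nat.cast_mul, ENNReal.ofReal_natCast]
  have hm2 : ∀ c : ℝ, |c| = 1 →
      μ (⋃ p, B2 c p) ≤ ENNReal.ofReal (((n * k) * (n * k)) * Regime.delta n k ρ) := by
    intro c hc
    refine (measure_iUnion_fintype_le μ (B2 c)).trans ((Finset.sum_le_sum
      (g := fun _ => ENNReal.ofReal (Regime.delta n k ρ)) fun p _ => ?_).trans (le_of_eq ?_))
    · by_cases hp : p.2.1 ≠ p.1.1 ∧ p.1.2 ≠ 0
      · exact (measure_mono fun Z hZ => hZ.2.2).trans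
          (measure_testDeviates_le D R hlam hc hp.1 hp.2 p.2.2)
      -- The side conditions inside `B2` allow a union over all indices; the excluded ones
      -- contribute nothing.
      · have : B2 c p = ∅ := Set.eq_empty_of_forall_notMem fun Z hZ => hp ⟨hZ.1, hZ.2.1⟩
        rw [this, measure_empty]
        exact zero_le
    · rw [Finset.sum_const, Finset.card_univ, nsmul_eq_mul, Fintype.card_prod, Fintype.card_prod,
        Fintype.card_fin, Fintype.card_fin, ENNReal.ofReal_mul (by positivity),
        ← Nat.cast_mul, ← Nat.cast_mul, ENNReal.ofReal_natCast]
  have hδ := R.delta_pos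
  have hbad : μ Gᶜ ≤ ENNReal.ofReal ρ := by
    refine (measure_mono hsub).trans ((measure_union_le _ _).trans
      ((add_le_add hm1 ((measure_union_le _ _).trans
        (add_le_add (hm2 1 (by simp)) (hm2 (-1) (by simp))))).trans ?_))
    rw [← ENNReal.ofReal_add (by positivity) (by positivity),
      ← ENNReal.ofReal_add (by positivity) (by positivity)]
    refine ENNReal.ofReal_le_ofReal ?_
    have h1 : ρ = 3 * ((n * k) * (n * k)) * Regime.delta n k ρ := by
      unfold Regime.delta
      field_simp
    have h2 : (1 : ℝ) ≤ n * k := by nlinarith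
    have h3 : (n * k : ℝ) ≤ (n * k) * (n * k) := by nlinarith
    have h4 := mul_le_mul_of_nonneg_right h3 hδ.le
    linarith
  have hμ1 : IsProbabilityMeasure μ := by rw [hμ]; infer_instance
  have hG1 : MeasurableSet G := G.toFinite.measurableSet
  have h := prob_add_prob_compl (μ := μ) hG1
  rw [ENNReal.ofReal_sub _ R.ρ_pos.le, ENNReal.ofReal_one, tsub_le_iff_right, ← h]
  exact add_le_add_right hbad _

end Correctness

end StructureLearner

/-! ## Reasoning about programs -/

namespace RealRAM

namespace Program

/-- All instructions of the program satisfy a test. -/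
def all (P : Instr → Bool) : Program → Bool
  | .skip => true
  | .instr i => P i
  | .seq p q => p.all P && q.all P
  | .ifLt _ _ p q => p.all P && q.all P
  | .ifLtR _ _ p q => p.all P && q.all P
  | .loop _ p => p.all P

/-- Invariant rule with a uniform time bound per round. The number of rounds is fixed on entry,
whatever the body does to register `a`. -/
theorem loop_run_induction {x : ℕ → ℕ} {a : ℕ} {p : Program} {s : State} (I : ℕ → State → Prop)
    (T : ℕ) (h0 : I 0 s)
    (hstep : ∀ m s', m < s.nreg a → I m s' → I (m + 1) (p.run x s').1 ∧ (p.run x s').2 ≤ T) :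
    I (s.nreg a) ((loop a p).run x s).1 ∧ ((loop a p).run x s).2 ≤ 1 + s.nreg a * (T + 1) := by
  have h : ∀ m ≤ s.nreg a,
      I m ((fun c : State × ℕ => ((p.run x c.1).1, c.2 + (p.run x c.1).2 + 1))^[m] (s, 1)).1 ∧
      ((fun c : State × ℕ => ((p.run x c.1).1, c.2 + (p.run x c.1).2 + 1))^[m] (s, 1)).2 ≤
        1 + m * (T + 1) := by
    intro m
    induction m with
    | zero => intro _; exact ⟨h0, by simp⟩
    | succ m ih =>
      intro hm
      obtain ⟨h1, h2⟩ := ih (by omega)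
      obtain ⟨h3, h4⟩ := hstep m _ (by omega) h1
      rw [Function.iterate_succ_apply']
      refine ⟨h3, ?_⟩
      simp only [Nat.add_mul, Nat.one_mul] at h2 ⊢
      omega
  exact h _ le_rfl

/-- A frame rule: a preorder respected by the admitted instructions is respected by every program
made of them. The syntactic side condition is checked by evaluation. -/
theorem run_rel {R : State → State → Prop} (hr : ∀ s, R s s)
    (ht : ∀ s₁ s₂ s₃, R s₁ s₂ → R s₂ s₃ → R s₁ s₃) {P : Instr → Bool} {x : ℕ → ℕ}
    (hP : ∀ i s, P i = true → R s (i.exec x s)) (p : Program) (hp : p.all P = true) (s : State) :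
    R s (p.run x s).1 := by
  induction p generalizing s with
  | skip => exact hr s
  | instr i => exact hP i s hp
  | seq p q ihp ihq =>
    simp only [all, Bool.and_eq_true] at hp
    exact ht _ _ _ (ihp hp.1 s) (ihq hp.2 _)
  | ifLt a b p q ihp ihq =>
    simp only [all, Bool.and_eq_true] at hp
    unfold run
    split_ifs
    · exact ihp hp.1 s
    · exact ihq hp.2 s
  | ifLtR a b p q ihp ihq =>
    simp only [all, Bool.and_eq_true] at hp
    unfold run
    split_ifs
    · exact ihp hp.1 s
    · exact ihq hp.2 s
  | loop a p ih =>
    have h : ∀ m, R s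
        ((fun c : State × ℕ => ((p.run x c.1).1, c.2 + (p.run x c.1).2 + 1))^[m] (s, 1)).1 := by
      intro m
      induction m with
      | zero => exact hr s
      | succ m ihm =>
        rw [Function.iterate_succ_apply']
        exact ht _ _ _ ihm (ih hp _)
    exact h _

end Program

/-- The instruction writes no register below `m`. -/
def Instr.writesFrom (m : ℕ) : Instr → Bool
  | .const r _ | .add r _ _ | .sub r _ _ | .load r _ | .readSample r _ | .ofNat r _
  | .addR r _ _ | .subR r _ _ | .mulR r _ _ | .divR r _ _ | .expR r _ | .logR r _
  | .loadR r _ => decide (m ≤ r)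
  | .store _ _ | .storeR _ _ | .emit _ _ => true

/-- The instruction writes neither the memory of naturals nor the output. -/
def Instr.silent : Instr → Bool
  | .store _ _ | .emit _ _ => false
  | _ => true

/-- The instruction does not write the memory of reals. -/
def Instr.keepsRmem : Instr → Bool
  | .storeR _ _ => false
  | _ => true

namespace Program

/-- Inner program parts write higher registers only (from 10, 11, 18, 20, 30 on), so one lower bound
protects the variables of all enclosing loops. -/
theorem run_regs {m : ℕ} {p : Program} (hp : p.all (Instr.writesFrom m) = true) (x : ℕ → ℕ)
    (s : State) {r : ℕ} (hr : r < m) :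
    (p.run x s).1.nreg r = s.nreg r ∧ (p.run x s).1.rreg r = s.rreg r := by
  refine run_rel (R := fun s s' => s'.nreg r = s.nreg r ∧ s'.rreg r = s.rreg r)
    (fun s => ⟨rfl, rfl⟩) (fun _ _ _ h1 h2 => ⟨h2.1.trans h1.1, h2.2.trans h1.2⟩) ?_ p hp s
  intro i s hi
  cases i <;> simp only [Instr.writesFrom, decide_eq_true_eq] at hi <;>
    simp only [Instr.exec, and_self, and_true, true_and] <;>
    exact Function.update_of_ne (by omega) _ _

theorem run_silent {p : Program} (hp : p.all Instr.silent = true) (x : ℕ → ℕ) (s : State) :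
    (p.run x s).1.nmem = s.nmem ∧ (p.run x s).1.edges = s.edges := by
  refine run_rel (R := fun s s' => s'.nmem = s.nmem ∧ s'.edges = s.edges)
    (fun s => ⟨rfl, rfl⟩) (fun _ _ _ h1 h2 => ⟨h2.1.trans h1.1, h2.2.trans h1.2⟩) ?_ p hp s
  intro i s hi
  cases i <;> simp [Instr.silent, Instr.exec] at hi ⊢

theorem run_rmem {p : Program} (hp : p.all Instr.keepsRmem = true) (x : ℕ → ℕ) (s : State) :
    (p.run x s).1.rmem = s.rmem := by
  refine run_rel (R := fun s s' => s'.rmem = s.rmem)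
    (fun s => rfl) (fun _ _ _ h1 h2 => h2.trans h1) ?_ p hp s
  intro i s hi
  cases i <;> simp [Instr.keepsRmem, Instr.exec] at hi ⊢

/-- A straight-line program. -/
def block : List Instr → Program
  | [] => skip
  | i :: l => seq (instr i) (block l)

theorem block_run (x : ℕ → ℕ) (l : List Instr) (s : State) :
    (block l).run x s = (l.foldl (fun s i => i.exec x s) s, l.length + 1) := by
  induction l generalizing s with
  | nil => rfl
  | cons i l ih =>
    simp only [block, run, ih, List.foldl_cons, List.length_cons]
    rw [Nat.add_comm]

end Program

/-! ## The program -/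

namespace Learner

open Program Instr

/-- Account for one score of the current group in its weight and its mean sign. -/
def cellStep : Program := block
  -- Real register 6 holds 0, so subtracting from it negates. Natural register 4 holds 1 and is
  -- added twice, since each score is followed by its test statistic.
  [loadR 32 30, mulR 32 3 32, expR 33 32, subR 34 6 32, expR 34 34, addR 35 33 34, subR 36 33 34,
    divR 36 36 35, mulR 30 30 35, addR 31 31 36, add 30 30 4, add 30 30 4]

/-- Read the masked sample value of variable `j`. -/
def readMasked : Program :=
  -- The case j = i is the failure of both comparisons.
  seq (instr (readSample 32 21)) (ifLt 10 21 skip (ifLt 21 10 skip (instr (const 32 0))))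

/-- The weight and the sum of the mean signs of group `j`, and the address, the score and the
mean sign of the cell of the current sample. -/
def cell : Program :=
  seq (block [add 31 30 3, ofNat 30 4, ofNat 31 3]) <|
  seq (loop 1 cellStep) <|
  seq readMasked <|
  block [add 31 31 32, add 31 31 32, loadR 32 31, mulR 33 3 32, expR 34 33, subR 35 6 33,
    expR 35 35, addR 37 34 35, subR 36 34 35, divR 36 36 37]

/-- The total weight and the residual of the current problem. -/
def predictPass : Program :=
  seq (block [const 21 0, add 30 12 3, ofNat 22 3, ofNat 23 3]) <|
  seq (loop 0 (seq cell (block [mulR 38 30 36, addR 23 23 38, addR 22 22 30, add 21 21 4]))) <|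
  block [divR 24 23 22, mulR 24 24 4, subR 38 6 24, expR 38 38, addR 38 7 38, divR 38 7 38,
    subR 38 19 38, mulR 25 18 38]

/-- Update the score and the test statistic of the current cell. -/
def updateCell : Program := block
  [divR 37 30 22, mulR 37 4 37, mulR 36 37 36, mulR 37 37 31, divR 37 37 8, subR 36 24 36,
    addR 36 36 37, subR 36 6 36, expR 36 36, addR 36 7 36, divR 36 7 36, subR 36 19 36,
    mulR 36 18 36, addR 32 32 25, storeR 31 32, add 31 31 4, loadR 32 31, addR 32 32 36,
    storeR 31 32, add 21 21 4]

/-- Update the scores and the test statistics of the current problem. -/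
def updatePass : Program :=
  seq (block [const 21 0, add 30 12 3]) (loop 0 (seq cell updateCell))

/-- The gate and the label of the current problem. -/
def readLabel : Program :=
  seq (block [readSample 20 10, ofNat 18 3, ofNat 19 3]) <|
  ifLt 3 11
    (ifLt 3 20 (ifLt 20 11 skip (ifLt 11 20 skip (block [ofNat 18 4, ofNat 19 4])))
      (instr (ofNat 18 4)))
    skip

/-- Treat the current problem. -/
def problem : Program := seq readLabel (seq predictPass updatePass)

/-- Treat the problems of the current variable. -/
def variablePass : Program :=
  seq (block [const 11 0]) (loop 1 (seq problem (block [add 12 30 3, add 11 11 4])))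

/-- Process one sample. -/
def update : Program :=
  seq (block [const 10 0, const 12 0]) (loop 0 (seq variablePass (block [add 10 10 4])))

/-- Compute the parameters of the learner. -/
def setup : Program := block
  -- Powers of e^λ by squaring: real register 21 ends with exponent 6 and register 22 with 24 + 6 =
  -- 30; 1048576 is 2^20.
  [const 4 1, ofNat 7 4, ofNat 8 1, addR 4 0 0, expR 20 0, mulR 21 20 20, mulR 21 21 20,
    mulR 21 21 21, mulR 22 21 21, mulR 22 22 22, mulR 22 22 21, const 20 1048576, ofNat 23 20,
    mulR 23 23 22, mulR 23 23 8, mulR 24 1 1, divR 3 24 23, ofNat 25 2, mulR 25 25 1, const 20 8,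
    ofNat 26 20, mulR 26 26 21, mulR 26 26 8, mulR 26 26 8, divR 5 25 26]

/-- Test one cell. -/
def testCell : Program :=
  seq (block [add 31 30 4, loadR 32 31, subR 33 6 32, add 30 31 4])
    (ifLtR 5 32 (instr (emit 10 21)) (ifLtR 5 33 (instr (emit 10 21)) skip))

/-- Test all cells of one problem. -/
def testProblem : Program :=
  seq (block [const 21 0]) (loop 0 (seq (loop 1 testCell) (block [add 21 21 4])))

/-- Report the pairs with a large test statistic. -/
def finish : Program :=
  seq (block [const 10 0, const 30 0]) (loop 0 (seq (loop 1 testProblem) (block [add 10 10 4])))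

/-- The online structure learner. -/
def algorithm : OnlineAlgorithm := ⟨setup, update, finish⟩

/-! ## Semantics of the update -/

open SignedHedge

/-- The constants that the program keeps in its low registers. -/
structure Consts (n k : ℕ) (β L τ : ℝ) (s : State) : Prop where
  n0 : s.nreg 0 = n
  n1 : s.nreg 1 = k
  n3 : s.nreg 3 = 0
  n4 : s.nreg 4 = 1
  r3 : s.rreg 3 = β
  r4 : s.rreg 4 = L
  r5 : s.rreg 5 = τ
  r6 : s.rreg 6 = 0
  r7 : s.rreg 7 = 1
  r8 : s.rreg 8 = k

variable {n k : ℕ} {β L τ : ℝ} {x : ℕ → ℕ} {s : State}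

theorem Consts.run (h : Consts n k β L τ s) {p : Program}
    (hp : p.all (writesFrom 10) = true) : Consts n k β L τ (p.run x s).1 := by
  have hn : ∀ r < 10, (p.run x s).1.nreg r = s.nreg r := fun r hr => (run_regs hp x s hr).1
  have hr : ∀ r < 10, (p.run x s).1.rreg r = s.rreg r := fun r hr => (run_regs hp x s hr).2
  constructor <;> first
    | (rw [hn _ (by norm_num)]; first | exact h.n0 | exact h.n1 | exact h.n3 | exact h.n4)
    | (rw [hr _ (by norm_num)]
       first | exact h.r3 | exact h.r4 | exact h.r5 | exact h.r6 | exact h.r7 | exact h.r8)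

theorem cellStep_run (h : Consts n k β L τ s) :
    ((cellStep.run x s).1.nreg 30 = s.nreg 30 + 2 ∧ (cellStep.run x s).1.nreg 31 = s.nreg 31) ∧
    (cellStep.run x s).1.rreg 30 = s.rreg 30 * slot β (s.rmem (s.nreg 30)) ∧
    (cellStep.run x s).1.rreg 31 = s.rreg 31 + meanSign β (s.rmem (s.nreg 30)) ∧
    (cellStep.run x s).2 = 13 := by
  unfold cellStep
  rw [block_run]
  simp [Instr.exec, h.n4, h.r3, h.r6, slot, meanSign]

theorem cellLoop_run (h : Consts n k β L τ s) :
    ((((loop 1 cellStep).run x s).1.nreg 30 = s.nreg 30 + 2 * k ∧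
      ((loop 1 cellStep).run x s).1.nreg 31 = s.nreg 31) ∧
    ((loop 1 cellStep).run x s).1.rreg 30 =
      s.rreg 30 * ∏ b ∈ Finset.range k, slot β (s.rmem (s.nreg 30 + 2 * b)) ∧
    ((loop 1 cellStep).run x s).1.rreg 31 =
      s.rreg 31 + ∑ b ∈ Finset.range k, meanSign β (s.rmem (s.nreg 30 + 2 * b))) ∧
    ((loop 1 cellStep).run x s).2 ≤ 1 + k * 14 := by
  have hl := loop_run_induction (x := x) (a := 1) (p := cellStep) (s := s)
    (fun m s' => Consts n k β L τ s' ∧ s'.rmem = s.rmem ∧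
      (s'.nreg 30 = s.nreg 30 + 2 * m ∧ s'.nreg 31 = s.nreg 31) ∧
      s'.rreg 30 = s.rreg 30 * ∏ b ∈ Finset.range m, slot β (s.rmem (s.nreg 30 + 2 * b)) ∧
      s'.rreg 31 = s.rreg 31 + ∑ b ∈ Finset.range m, meanSign β (s.rmem (s.nreg 30 + 2 * b)))
    13 ⟨h, rfl, by simp, by simp, by simp⟩ ?_
  · rw [h.n1] at hl
    exact ⟨hl.1.2.2, hl.2⟩
  · rintro m s' - ⟨hc, hm, ⟨h1, h2⟩, h3, h4⟩
    obtain ⟨⟨g1, g2⟩, g3, g4, g5⟩ := cellStep_run (x := x) hc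
    refine ⟨⟨hc.run rfl, (run_rmem rfl x s').trans hm, ⟨?_, ?_⟩, ?_, ?_⟩, g5.le⟩
    · rw [g1, h1]; ring
    · rw [g2, h2]
    · rw [g3, h3, hm, h1, Finset.prod_range_succ, mul_assoc]
    · rw [g4, h4, hm, h1, Finset.sum_range_succ, add_assoc]

/-- The masked sample value of variable `j`. -/
def masked (x : ℕ → ℕ) (i j : ℕ) : ℕ := if j = i then 0 else x j

theorem readMasked_run :
    ((readMasked.run x s).1.nreg 32 = masked x (s.nreg 10) (s.nreg 21) ∧
      (readMasked.run x s).1.nreg 31 = s.nreg 31 ∧ (readMasked.run x s).1.nreg 30 = s.nreg 30) ∧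
    (readMasked.run x s).1.rreg = s.rreg ∧ (readMasked.run x s).2 ≤ 4 := by
  unfold readMasked masked
  simp only [Program.run, Instr.exec]
  rcases lt_trichotomy (s.nreg 10) (s.nreg 21) with h | h | h
  · simp [h, h.ne']
  · simp [h]
  · simp [h, h.ne, h.asymm]

/-- What `cell` computes, in terms of the memory and of the state in which it is started. -/
structure CellPost (k : ℕ) (β : ℝ) (x : ℕ → ℕ) (s s' : State) : Prop where
  next : s'.nreg 30 = s.nreg 30 + 2 * k
  addr : s'.nreg 31 = s.nreg 30 + 2 * masked x (s.nreg 10) (s.nreg 21)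
  weight : s'.rreg 30 = ∏ b ∈ Finset.range k, slot β (s.rmem (s.nreg 30 + 2 * b))
  signs : s'.rreg 31 = ∑ b ∈ Finset.range k, meanSign β (s.rmem (s.nreg 30 + 2 * b))
  score : s'.rreg 32 = s.rmem (s.nreg 30 + 2 * masked x (s.nreg 10) (s.nreg 21))
  sign : s'.rreg 36 = meanSign β (s.rmem (s.nreg 30 + 2 * masked x (s.nreg 10) (s.nreg 21)))
  rmem : s'.rmem = s.rmem

theorem cell_run (h : Consts n k β L τ s) (hk : 1 ≤ k) :
    CellPost k β x s (cell.run x s).1 ∧ (cell.run x s).2 ≤ 40 * k := by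
  set s1 := ((block [add 31 30 3, ofNat 30 4, ofNat 31 3]).run x s).1 with hs1
  have t1 : ((block [add 31 30 3, ofNat 30 4, ofNat 31 3]).run x s).2 = 4 := by rw [block_run]; rfl
  have e1 : s1.nreg 30 = s.nreg 30 ∧ s1.nreg 31 = s.nreg 30 ∧ s1.rreg 30 = 1 ∧ s1.rreg 31 = 0 ∧
      s1.rmem = s.rmem := by
    rw [hs1, block_run]
    simp [Instr.exec, h.n3, h.n4]
  have c1 : Consts n k β L τ s1 := h.run rfl
  have l1 : s1.nreg 10 = s.nreg 10 ∧ s1.nreg 21 = s.nreg 21 :=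
    ⟨(run_regs (m := 30) rfl x s (by norm_num)).1, (run_regs (m := 30) rfl x s (by norm_num)).1⟩
  obtain ⟨⟨⟨a1, a2⟩, a3, a4⟩, t2⟩ := cellLoop_run (x := x) c1
  set s2 := ((loop 1 cellStep).run x s1).1 with hs2
  have c2 : Consts n k β L τ s2 := c1.run rfl
  have m2 : s2.rmem = s.rmem := (run_rmem rfl x s1).trans e1.2.2.2.2
  have l2 : s2.nreg 10 = s.nreg 10 ∧ s2.nreg 21 = s.nreg 21 :=
    ⟨((run_regs (m := 30) rfl x s1 (by norm_num)).1).trans l1.1,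
      ((run_regs (m := 30) rfl x s1 (by norm_num)).1).trans l1.2⟩
  obtain ⟨⟨b1, b2, b3⟩, b4, t3⟩ := readMasked_run (x := x) (s := s2)
  set s3 := (readMasked.run x s2).1 with hs3
  have c3 : Consts n k β L τ s3 := c2.run rfl
  have m3 : s3.rmem = s.rmem := (run_rmem rfl x s2).trans m2
  rw [l2.1, l2.2] at b1
  have hrun : cell.run x s = ((block [add 31 31 32, add 31 31 32, loadR 32 31, mulR 33 3 32,
      expR 34 33, subR 35 6 33, expR 35 35, addR 37 34 35, subR 36 34 35,
      divR 36 36 37]).run x s3 |>.1, 4 + (((loop 1 cellStep).run x s1).2 +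
        ((readMasked.run x s2).2 + 11))) := by
    unfold cell
    simp only [Program.run, ← hs1, t1]
    simp only [block_run, List.length_cons, List.length_nil]
    rfl
  rw [hrun]
  refine ⟨?_, by simp only; omega⟩
  have hadd : s3.nreg 31 = s.nreg 30 := by rw [b2, a2, e1.2.1]
  rw [block_run]
  constructor
  · simp [Instr.exec, b3, a1, e1.1]
  · simp [Instr.exec, hadd, b1]; ring
  · simp [Instr.exec, b4, a3, e1.1, e1.2.2.1, e1.2.2.2.2]
  · simp [Instr.exec, b4, a4, e1.1, e1.2.2.2.1, e1.2.2.2.2]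
  · simp [Instr.exec, hadd, b1, m3, add_assoc, two_mul]
  · simp [Instr.exec, hadd, b1, m3, add_assoc, two_mul, c3.r3, c3.r6, meanSign, slot]
  · simp [Instr.exec, m3]

end Learner

end RealRAM

/-! ### The two passes over the cells of one problem -/

namespace RealRAM

namespace Learner

open Program Instr SignedHedge NonbinaryIsing

variable {n k : ℕ} {β L τ : ℝ} {x : ℕ → ℕ} {s : State}

theorem row_add_lt {j m k b : ℕ} (hj : j < m) (hb : b < k) : j * k + b < m * k :=
  calc j * k + b < j * k + k := by omega
    _ = (j + 1) * k := by ring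
    _ ≤ m * k := Nat.mul_le_mul_right k hj

/-- The weight of group `j` of the scores stored at address `P`. -/
noncomputable def storedWeight (k : ℕ) (β : ℝ) (f : ℕ → ℝ) (P j : ℕ) : ℝ :=
  ∏ b ∈ Finset.range k, slot β (f (P + 2 * (j * k + b)))

/-- The sum of the mean signs of group `j` of the scores stored at address `P`. -/
noncomputable def storedSigns (k : ℕ) (β : ℝ) (f : ℕ → ℝ) (P j : ℕ) : ℝ :=
  ∑ b ∈ Finset.range k, meanSign β (f (P + 2 * (j * k + b)))

/-- The total weight of the scores stored at address `P`. -/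
noncomputable def storedTotal (n k : ℕ) (β : ℝ) (f : ℕ → ℝ) (P : ℕ) : ℝ :=
  ∑ j ∈ Finset.range n, storedWeight k β f P j

/-- The mean sign of the current cell of group `j`. -/
noncomputable def storedSign (k : ℕ) (β : ℝ) (x : ℕ → ℕ) (i : ℕ) (f : ℕ → ℝ) (P j : ℕ) : ℝ :=
  meanSign β (f (P + 2 * (j * k + masked x i j)))

/-- The prediction from the scores stored at address `P`. -/
noncomputable def storedPrediction (n k : ℕ) (L β : ℝ) (x : ℕ → ℕ) (i : ℕ) (f : ℕ → ℝ)
    (P : ℕ) : ℝ :=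
  (∑ j ∈ Finset.range n, storedWeight k β f P j * storedSign k β x i f P j) /
    storedTotal n k β f P * L

/-- A separate first pass is needed because every coefficient is normalised by the total weight. -/
theorem predictPass_run (h : Consts n k β L τ s) (hk : 1 ≤ k) (hn : 1 ≤ n) :
    ((predictPass.run x s).1.rreg 22 = storedTotal n k β s.rmem (s.nreg 12) ∧
    (predictPass.run x s).1.rreg 24 =
      storedPrediction n k L β x (s.nreg 10) s.rmem (s.nreg 12) ∧
    (predictPass.run x s).1.rreg 25 = s.rreg 18 * (s.rreg 19 -
      Real.sigmoid (storedPrediction n k L β x (s.nreg 10) s.rmem (s.nreg 12)))) ∧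
    (predictPass.run x s).2 ≤ 65 * (n * k) := by
  set s1 := ((block [const 21 0, add 30 12 3, ofNat 22 3, ofNat 23 3]).run x s).1 with hs1
  have t1 : ((block [const 21 0, add 30 12 3, ofNat 22 3, ofNat 23 3]).run x s).2 = 5 := by
    rw [block_run]; rfl
  have e1 : s1.nreg 21 = 0 ∧ s1.nreg 30 = s.nreg 12 ∧ s1.rreg 22 = 0 ∧ s1.rreg 23 = 0 ∧
      s1.rmem = s.rmem := by
    rw [hs1, block_run]
    simp [Instr.exec, h.n3]
  have c1 : Consts n k β L τ s1 := h.run rfl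
  have l1 : s1.nreg 10 = s.nreg 10 ∧ s1.rreg 18 = s.rreg 18 ∧ s1.rreg 19 = s.rreg 19 :=
    ⟨(run_regs (m := 20) rfl x s (by norm_num)).1, (run_regs (m := 20) rfl x s (by norm_num)).2,
      (run_regs (m := 20) rfl x s (by norm_num)).2⟩
  set body := seq cell (block [mulR 38 30 36, addR 23 23 38, addR 22 22 30, add 21 21 4]) with hbody
  have hl := loop_run_induction (x := x) (a := 0) (p := body) (s := s1)
    (fun m s' => Consts n k β L τ s' ∧ s'.rmem = s.rmem ∧ s'.nreg 10 = s.nreg 10 ∧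
      s'.nreg 21 = m ∧ s'.nreg 30 = s.nreg 12 + 2 * (m * k) ∧
      s'.rreg 22 = ∑ j ∈ Finset.range m, storedWeight k β s.rmem (s.nreg 12) j ∧
      s'.rreg 23 = ∑ j ∈ Finset.range m, storedWeight k β s.rmem (s.nreg 12) j *
        storedSign k β x (s.nreg 10) s.rmem (s.nreg 12) j)
    (40 * k + 5) ⟨c1, e1.2.2.2.2, l1.1, e1.1, by simp [e1.2.1], by simp [e1.2.2.1],
      by simp [e1.2.2.2.1]⟩ ?_
  swap
  · rintro m s' - ⟨hc, hm, h10, h21, h30, h22, h23⟩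
    obtain ⟨hp, ht⟩ := cell_run (x := x) hc hk
    set s'' := (cell.run x s').1 with hs''
    have hc'' : Consts n k β L τ s'' := hc.run rfl
    have k10 : s''.nreg 10 = s.nreg 10 := ((run_regs (m := 30) rfl x s' (by norm_num)).1).trans h10
    have k21 : s''.nreg 21 = m := ((run_regs (m := 30) rfl x s' (by norm_num)).1).trans h21
    have k22 : s''.rreg 22 = s'.rreg 22 := (run_regs (m := 30) rfl x s' (by norm_num)).2
    have k23 : s''.rreg 23 = s'.rreg 23 := (run_regs (m := 30) rfl x s' (by norm_num)).2
    have haddr : ∀ b, s'.nreg 30 + 2 * b = s.nreg 12 + 2 * (m * k + b) := fun b => by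
      rw [h30]; ring
    have hw : s''.rreg 30 = storedWeight k β s.rmem (s.nreg 12) m := by
      rw [hp.weight]; simp only [haddr, hm, storedWeight]
    have hsg : s''.rreg 36 = storedSign k β x (s.nreg 10) s.rmem (s.nreg 12) m := by
      rw [hp.sign]; simp only [haddr, hm, storedSign, h10, h21]
    have hrun : body.run x s' = (((block [mulR 38 30 36, addR 23 23 38, addR 22 22 30,
        add 21 21 4]).run x s'').1, (cell.run x s').2 + 5) := by
      simp only [hbody, Program.run, ← hs'']
      simp only [block_run, List.length_cons, List.length_nil]
    refine ⟨⟨hc.run rfl, (run_rmem rfl x s').trans hm, ?_, ?_, ?_, ?_, ?_⟩, ?_⟩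
    · exact ((run_regs (m := 20) rfl x s' (by norm_num)).1).trans h10
    · rw [hrun, block_run]; simp [Instr.exec, k21, hc''.n4]
    · rw [hrun, block_run]; simp [Instr.exec, hp.next, h30]; ring
    · rw [hrun, block_run]; simp [Instr.exec, k22, h22, hw, Finset.sum_range_succ]
    · rw [hrun, block_run]; simp [Instr.exec, k23, h23, hw, hsg, Finset.sum_range_succ]
    · rw [hrun]; simp only; omega
  rw [c1.n0] at hl
  obtain ⟨⟨c2, m2, -, -, -, h22, h23⟩, t2⟩ := hl
  have l2 : ∀ r < 20, (((loop 0 body).run x s1).1).rreg r = s1.rreg r := fun r hr =>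
    (run_regs (m := 20) rfl x s1 hr).2
  set s2 := ((loop 0 body).run x s1).1 with hs2
  have hrun : predictPass.run x s = ((block [divR 24 23 22, mulR 24 24 4, subR 38 6 24, expR 38 38,
      addR 38 7 38, divR 38 7 38, subR 38 19 38, mulR 25 18 38]).run x s2 |>.1,
        5 + (((loop 0 body).run x s1).2 + 9)) := by
    unfold predictPass
    simp only [Program.run, ← hs1, t1]
    simp only [block_run, List.length_cons, List.length_nil]
    rfl
  have k18 : s2.rreg 18 = s.rreg 18 := (l2 18 (by norm_num)).trans l1.2.1
  have k19 : s2.rreg 19 = s.rreg 19 := (l2 19 (by norm_num)).trans l1.2.2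
  rw [hrun]
  refine ⟨?_, ?_⟩
  · rw [block_run]
    refine ⟨?_, ?_, ?_⟩
    · simp [Instr.exec, h22, storedTotal]
    · simp [Instr.exec, h22, h23, c2.r4, storedPrediction, storedTotal]
    · simp [Instr.exec, h22, h23, c2.r4, c2.r6, c2.r7, k18, k19, storedPrediction, storedTotal,
        Real.sigmoid_def]
  · simp only
    have h1 : 1 ≤ n * k := Nat.mul_pos hn hk
    have h2 : n ≤ n * k := Nat.le_mul_of_pos_right n hk
    have h3 : n * (40 * k + 5 + 1) = 40 * (n * k) + 6 * n := by ring
    omega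

/-- The leave-one-out prediction for group `j` from the scores stored at address `P`. -/
noncomputable def storedLoo (n k : ℕ) (L β : ℝ) (x : ℕ → ℕ) (i : ℕ) (f : ℕ → ℝ)
    (P j : ℕ) : ℝ :=
  storedPrediction n k L β x i f P -
    L * (storedWeight k β f P j / storedTotal n k β f P) * storedSign k β x i f P j +
      L * (storedWeight k β f P j / storedTotal n k β f P) * storedSigns k β f P j / k

theorem updateCell_run (h : Consts n k β L τ s) :
    (updateCell.run x s).1.rmem = Function.update (Function.update s.rmem (s.nreg 31)
        (s.rreg 32 + s.rreg 25)) (s.nreg 31 + 1)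
      (s.rmem (s.nreg 31 + 1) + s.rreg 18 * (s.rreg 19 - Real.sigmoid
        (s.rreg 24 - L * (s.rreg 30 / s.rreg 22) * s.rreg 36 +
          L * (s.rreg 30 / s.rreg 22) * s.rreg 31 / k))) ∧
    ((updateCell.run x s).1.nreg 21 = s.nreg 21 + 1 ∧
      (updateCell.run x s).1.nreg 30 = s.nreg 30) ∧
    ((updateCell.run x s).1.rreg 22 = s.rreg 22 ∧ (updateCell.run x s).1.rreg 24 = s.rreg 24 ∧
      (updateCell.run x s).1.rreg 25 = s.rreg 25) ∧ (updateCell.run x s).2 = 21 := by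
  unfold updateCell
  rw [block_run]
  simp [Instr.exec, h.n4, h.r4, h.r6, h.r7, h.r8, Real.sigmoid_def]

/-- The update is in place, yet everything is expressed by the old memory: a group is read before it
is written, and the total weight and prediction of the old scores stay in real registers 22 and 24.
-/
theorem updatePass_run (h : Consts n k β L τ s) (hk : 1 ≤ k) (hn : 1 ≤ n)
    (hx : ∀ j, masked x (s.nreg 10) j < k)
    (h22 : s.rreg 22 = storedTotal n k β s.rmem (s.nreg 12))
    (h24 : s.rreg 24 = storedPrediction n k L β x (s.nreg 10) s.rmem (s.nreg 12)) :
    ((updatePass.run x s).1.nreg 30 = s.nreg 12 + 2 * (n * k) ∧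
    (∀ c, c < s.nreg 12 ∨ s.nreg 12 + 2 * (n * k) ≤ c →
      (updatePass.run x s).1.rmem c = s.rmem c) ∧
    ∀ j < n, ∀ b < k,
      (updatePass.run x s).1.rmem (s.nreg 12 + 2 * (j * k + b)) =
        s.rmem (s.nreg 12 + 2 * (j * k + b)) +
          (if masked x (s.nreg 10) j = b then s.rreg 25 else 0) ∧
      (updatePass.run x s).1.rmem (s.nreg 12 + 2 * (j * k + b) + 1) =
        s.rmem (s.nreg 12 + 2 * (j * k + b) + 1) +
          (if masked x (s.nreg 10) j = b then s.rreg 18 * (s.rreg 19 - Real.sigmoid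
            (storedLoo n k L β x (s.nreg 10) s.rmem (s.nreg 12) j)) else 0)) ∧
    (updatePass.run x s).2 ≤ 70 * (n * k) := by
  set P := s.nreg 12 with hP
  set i := s.nreg 10 with hi
  set f := s.rmem with hf
  set s1 := ((block [const 21 0, add 30 12 3]).run x s).1 with hs1
  have t1 : ((block [const 21 0, add 30 12 3]).run x s).2 = 3 := by
    rw [block_run]; rfl
  have e1 : s1.nreg 21 = 0 ∧ s1.nreg 30 = P ∧ s1.rmem = f ∧ s1.rreg = s.rreg := by
    rw [hs1, block_run]
    simp [Instr.exec, h.n3, hP, hf]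
  have c1 : Consts n k β L τ s1 := h.run rfl
  have l1 : s1.nreg 10 = i := (run_regs (m := 20) rfl x s (by norm_num)).1
  set body := seq cell updateCell with hbody
  have hl := loop_run_induction (x := x) (a := 0) (p := body) (s := s1)
    (fun m s' => Consts n k β L τ s' ∧ s'.nreg 10 = i ∧
      (s'.rreg 18 = s.rreg 18 ∧ s'.rreg 19 = s.rreg 19 ∧ s'.rreg 22 = s.rreg 22 ∧
        s'.rreg 24 = s.rreg 24 ∧ s'.rreg 25 = s.rreg 25) ∧
      s'.nreg 21 = m ∧ s'.nreg 30 = P + 2 * (m * k) ∧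
      (∀ c, c < P ∨ P + 2 * (m * k) ≤ c → s'.rmem c = f c) ∧
      ∀ j < m, ∀ b < k,
        s'.rmem (P + 2 * (j * k + b)) = f (P + 2 * (j * k + b)) +
          (if masked x i j = b then s.rreg 25 else 0) ∧
        s'.rmem (P + 2 * (j * k + b) + 1) = f (P + 2 * (j * k + b) + 1) +
          (if masked x i j = b then s.rreg 18 * (s.rreg 19 - Real.sigmoid
            (storedLoo n k L β x i f P j)) else 0))
    (40 * k + 21) ⟨c1, l1, by simp [e1.2.2.2], e1.1, by simp [e1.2.1], by simp [e1.2.2.1],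
      by simp⟩ ?_
  swap
  · rintro m s' - ⟨hc, h10, ⟨g18, g19, g22, g24, g25⟩, h21, h30, hout, hin⟩
    obtain ⟨hp, ht⟩ := cell_run (x := x) hc hk
    set s'' := (cell.run x s').1 with hs''
    have hc'' : Consts n k β L τ s'' := hc.run rfl
    have kn : ∀ r < 30, s''.nreg r = s'.nreg r := fun r hr => (run_regs (m := 30) rfl x s' hr).1
    have kr : ∀ r < 30, s''.rreg r = s'.rreg r := fun r hr => (run_regs (m := 30) rfl x s' hr).2
    have haddr : ∀ b, s'.nreg 30 + 2 * b = P + 2 * (m * k + b) := fun b => by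
      rw [h30]; ring
    -- Group `m` and all later ones have not been written yet.
    have hold : ∀ b, s'.rmem (P + 2 * (m * k + b)) = f (P + 2 * (m * k + b)) := fun b =>
      hout _ (Or.inr (by omega))
    have hold' : ∀ b, s'.rmem (P + 2 * (m * k + b) + 1) = f (P + 2 * (m * k + b) + 1) := fun b =>
      hout _ (Or.inr (by omega))
    have hw : s''.rreg 30 = storedWeight k β f P m := by
      rw [hp.weight]; simp only [haddr, hold, storedWeight]
    have hsgs : s''.rreg 31 = storedSigns k β f P m := by
      rw [hp.signs]; simp only [haddr, hold, storedSigns]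
    have hsg : s''.rreg 36 = storedSign k β x i f P m := by
      rw [hp.sign]; simp only [haddr, hold, storedSign, h10, h21]
    have hsc : s''.rreg 32 = f (P + 2 * (m * k + masked x i m)) := by
      rw [hp.score]; simp only [haddr, hold, h10, h21]
    have had : s''.nreg 31 = P + 2 * (m * k + masked x i m) := by
      rw [hp.addr, haddr, h10, h21]
    obtain ⟨u1, ⟨u2, u3⟩, ⟨u22, u24, u25⟩, ut⟩ := updateCell_run (x := x) hc''
    have hrun : body.run x s' = ((updateCell.run x s'').1, (cell.run x s').2 + 21) := by
      simp only [hbody, Program.run, ← hs'', ut]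
    rw [hp.rmem, had, hsc, hw, hsg, hsgs, kr 18 (by norm_num), kr 19 (by norm_num),
      kr 22 (by norm_num), kr 24 (by norm_num), kr 25 (by norm_num), g18, g19, g22, g24, g25, h22,
      h24, hold'] at u1
    change _ = Function.update (Function.update s'.rmem _ _) _ (_ + s.rreg 18 * (s.rreg 19 -
      Real.sigmoid (storedLoo n k L β x i f P m))) at u1
    have hxm := hx m
    have hsucc : (m + 1) * k = m * k + k := by ring
    refine ⟨⟨hc.run rfl, ((run_regs (m := 20) rfl x s' (by norm_num)).1).trans h10,
      ⟨((run_regs (m := 20) rfl x s' (by norm_num)).2).trans g18,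
        ((run_regs (m := 20) rfl x s' (by norm_num)).2).trans g19, ?_, ?_, ?_⟩,
        ?_, ?_, ?_, ?_⟩, ?_⟩
    · rw [hrun]; exact (u22.trans (kr 22 (by norm_num))).trans g22
    · rw [hrun]; exact (u24.trans (kr 24 (by norm_num))).trans g24
    · rw [hrun]; exact (u25.trans (kr 25 (by norm_num))).trans g25
    · rw [hrun]; exact u2.trans (by rw [kn 21 (by norm_num), h21])
    · rw [hrun]; exact u3.trans (by rw [hp.next, h30]; ring)
    · intro c hcc
      rw [hrun, u1, Function.update_of_ne (by omega), Function.update_of_ne (by omega)]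
      exact hout c (by omega)
    · intro j hj b hb
      rw [hrun, u1]
      rcases Nat.lt_succ_iff_lt_or_eq.mp hj with hj' | rfl
      · have hlt := row_add_lt hj' hb
        rw [Function.update_of_ne (by omega), Function.update_of_ne (by omega),
          Function.update_of_ne (by omega), Function.update_of_ne (by omega)]
        exact hin j hj' b hb
      · by_cases hbb : masked x i j = b
        · subst hbb
          rw [if_pos rfl, if_pos rfl, Function.update_self, Function.update_of_ne (by omega),
            Function.update_self]
          exact ⟨rfl, rfl⟩
        · rw [if_neg hbb, if_neg hbb, add_zero, add_zero, Function.update_of_ne (by omega),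
            Function.update_of_ne (by omega), Function.update_of_ne (by omega),
            Function.update_of_ne (by omega)]
          exact ⟨hold b, hold' b⟩
    · rw [hrun]; simp only; omega
  rw [c1.n0] at hl
  obtain ⟨⟨-, -, -, -, h30, hout, hin⟩, t2⟩ := hl
  have hrun : updatePass.run x s = (((loop 0 body).run x s1).1, 3 + ((loop 0 body).run x s1).2) := by
    unfold updatePass
    simp only [Program.run, ← hs1, t1]
    rfl
  rw [hrun]
  refine ⟨⟨h30, hout, hin⟩, ?_⟩
  simp only
  have h1 : 1 ≤ n * k := Nat.mul_pos hn hk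
  have h2 : n ≤ n * k := Nat.le_mul_of_pos_right n hk
  have h3 : n * (40 * k + 21 + 1) = 40 * (n * k) + 22 * n := by ring
  omega

end Learner

end RealRAM

/-! ### Memory contents as scores and statistics -/

namespace RealRAM

namespace Learner

open Program Instr SignedHedge NonbinaryIsing StructureLearner

variable {n k : ℕ} {β L τ : ℝ} {s : State}

theorem encode_apply (z : Fin n → Fin k) (j : Fin n) : encode z j = z j := by
  simp [encode]

section Bridge

theorem masked_encode [NeZero k] (z : Fin n → Fin k) (i j : Fin n) :
    masked (encode z) i j = (mask i z j : ℕ) := by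
  unfold masked mask
  by_cases h : j = i
  · subst h; simp
  · rw [if_neg (fun h' => h (Fin.ext h')), Function.update_of_ne h, encode_apply]

theorem masked_encode_lt [NeZero k] (z : Fin n → Fin k) (i j : ℕ) : masked (encode z) i j < k := by
  unfold masked encode
  split_ifs
  · exact Nat.pos_of_ne_zero (NeZero.ne k)
  · exact (z _).isLt
  · exact Nat.pos_of_ne_zero (NeZero.ne k)

variable (z : Fin n → Fin k) (i : Fin n) (f : ℕ → ℝ) (P : ℕ) (S : Fin n → Fin k → ℝ)

theorem storedWeight_eq (hS : ∀ (j : Fin n) (b : Fin k), f (P + 2 * (j * k + b)) = S j b)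
    (j : Fin n) : storedWeight k β f P j = groupWeight β S j := by
  unfold storedWeight groupWeight
  rw [Finset.prod_range]
  simp only [hS]

theorem storedSigns_eq (hS : ∀ (j : Fin n) (b : Fin k), f (P + 2 * (j * k + b)) = S j b)
    (j : Fin n) : storedSigns k β f P j = ∑ b, meanSign β (S j b) := by
  unfold storedSigns
  rw [Finset.sum_range]
  simp only [hS]

theorem storedTotal_eq (hS : ∀ (j : Fin n) (b : Fin k), f (P + 2 * (j * k + b)) = S j b) :
    storedTotal n k β f P = ∑ l, groupWeight β S l := by
  unfold storedTotal
  rw [Finset.sum_range]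
  exact Finset.sum_congr rfl fun j _ => storedWeight_eq f P S hS j

theorem storedSign_eq [NeZero k]
    (hS : ∀ (j : Fin n) (b : Fin k), f (P + 2 * (j * k + b)) = S j b)
    (j : Fin n) :
    storedSign k β (encode z) i f P j = meanSign β (S j (mask i z j)) := by
  unfold storedSign
  rw [masked_encode, hS]

theorem storedPrediction_eq [NeZero k]
    (hS : ∀ (j : Fin n) (b : Fin k), f (P + 2 * (j * k + b)) = S j b) :
    storedPrediction n k L β (encode z) i f P = predict L β S (mask i z) := by
  unfold storedPrediction predict coef
  rw [Finset.sum_range, storedTotal_eq f P S hS, Finset.sum_div, Finset.sum_mul]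
  refine Finset.sum_congr rfl fun j _ => ?_
  rw [storedWeight_eq f P S hS, storedSign_eq z i f P S hS]
  ring

theorem storedLoo_eq [NeZero k]
    (hS : ∀ (j : Fin n) (b : Fin k), f (P + 2 * (j * k + b)) = S j b)
    (j : Fin n) :
    storedLoo n k L β (encode z) i f P j = predict L β S (mask i z) -
      coef L β S j (mask i z j) + (∑ b, coef L β S j b) / k := by
  unfold storedLoo
  rw [storedPrediction_eq z i f P S hS, storedTotal_eq f P S hS, storedWeight_eq f P S hS,
    storedSign_eq z i f P S hS, storedSigns_eq f P S hS]
  unfold coef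
  rw [Finset.mul_sum]

end Bridge

/-- Only the gated product is claimed: for a = 0 the label register stays 0 even when the label is
1, which the zero gate hides. -/
theorem readLabel_run [NeZero k] (h : Consts n k β L τ s) (z : Fin n → Fin k) (i : Fin n)
    (a : Fin k) (hi : s.nreg 10 = i) (ha : s.nreg 11 = a) :
    (∀ p, (readLabel.run (encode z) s).1.rreg 18 * ((readLabel.run (encode z) s).1.rreg 19 - p) =
      gate i a z * (label i a z - p)) ∧ (readLabel.run (encode z) s).2 ≤ 15 := by
  have e0 : ∀ c : Fin k, c = 0 ↔ (c : ℕ) = 0 := fun c => by rw [Fin.ext_iff]; simp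
  have e1 : z i = a ↔ (z i : ℕ) = a := Fin.ext_iff
  unfold readLabel gate label
  simp only [Program.run, block_run, List.foldl_cons, List.foldl_nil, Instr.exec, ne_eq, e0, e1]
  rcases Nat.eq_zero_or_pos (a : ℕ) with ha0 | ha0
  · simp [h.n3, ha, ha0]
  · rcases Nat.eq_zero_or_pos (z i : ℕ) with hz0 | hz0
    · simp [h.n3, h.n4, ha, hi, ha0, ha0.ne', ha0.ne, hz0, encode_apply]
    · rcases lt_trichotomy (z i : ℕ) a with hlt | heq | hlt
      · simp [h.n3, ha, hi, ha0, ha0.ne', hz0, hz0.ne', hlt, hlt.ne, encode_apply]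
      · simp [h.n3, h.n4, ha, hi, ha0, ha0.ne', heq, encode_apply]
      · simp [h.n3, ha, hi, ha0, ha0.ne', hz0, hz0.ne', hlt, hlt.ne', hlt.asymm,
          encode_apply]

/-- The address of the score `(i, a, j, b)`; the test statistic is stored in the next cell. -/
def cellAddr (n k i a j b : ℕ) : ℕ := 2 * ((i * k + a) * (n * k)) + 2 * (j * k + b)

/-- The scores stored in a memory. -/
def memScores (n k : ℕ) (f : ℕ → ℝ) : Scores n k := fun i a j b => f (cellAddr n k i a j b)

/-- The test statistics stored in a memory. -/
def memStats (n k : ℕ) (f : ℕ → ℝ) : Scores n k := fun i a j b => f (cellAddr n k i a j b + 1)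

/-- The memory `g` results from `f` by treating the first `r` problems for the sample `z`. -/
structure PartlyUpdated [NeZero k] (L β : ℝ) (z : Fin n → Fin k) (f : ℕ → ℝ) (r : ℕ)
    (g : ℕ → ℝ) : Prop where
  rest : ∀ c, 2 * (r * (n * k)) ≤ c → g c = f c
  scores : ∀ (i : Fin n) (a : Fin k), (i : ℕ) * k + a < r → ∀ (j : Fin n) (b : Fin k),
    g (cellAddr n k i a j b) = nextScores L β (memScores n k f) z i a j b
  stats : ∀ (i : Fin n) (a : Fin k), (i : ℕ) * k + a < r → ∀ (j : Fin n) (b : Fin k),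
    g (cellAddr n k i a j b + 1) = memStats n k f i a j b +
      testTerm L β i a j b (memScores n k f) z

theorem block_index_inj {i i' : Fin n} {a a' : Fin k} (h : (i' : ℕ) * k + a' = i * k + a) :
    i' = i ∧ a' = a := by
  have hk : 0 < k := lt_of_le_of_lt (Nat.zero_le _) a.isLt
  have h1 : ((i' : ℕ) * k + a') / k = (i * k + a) / k := by rw [h]
  have h2 : ((i' : ℕ) * k + a') % k = (i * k + a) % k := by rw [h]
  rw [Nat.mul_comm, Nat.mul_comm (i : ℕ), Nat.mul_add_div hk, Nat.mul_add_div hk,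
    Nat.div_eq_of_lt a.isLt, Nat.div_eq_of_lt a'.isLt] at h1
  rw [Nat.mul_comm, Nat.mul_comm (i : ℕ), Nat.mul_add_mod, Nat.mul_add_mod,
    Nat.mod_eq_of_lt a.isLt, Nat.mod_eq_of_lt a'.isLt] at h2
  exact ⟨Fin.ext (by omega), Fin.ext h2⟩

/-- Problems occupy consecutive blocks of 2nk cells. Earlier blocks are final, this one still holds
the old memory, and natural register 30 ends at the start of the next. -/
theorem problem_run [NeZero k] (h : Consts n k β L τ s) (z : Fin n → Fin k) (i : Fin n)
    (a : Fin k) (f : ℕ → ℝ) (hi : s.nreg 10 = i) (ha : s.nreg 11 = a)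
    (hP : s.nreg 12 = 2 * (((i : ℕ) * k + a) * (n * k)))
    (hu : PartlyUpdated L β z f (i * k + a) s.rmem) :
    (PartlyUpdated L β z f (i * k + a + 1) (problem.run (encode z) s).1.rmem ∧
      (problem.run (encode z) s).1.nreg 30 = 2 * (((i : ℕ) * k + a + 1) * (n * k))) ∧
    (problem.run (encode z) s).2 ≤ 150 * (n * k) := by
  have hk : 1 ≤ k := Nat.pos_of_ne_zero (NeZero.ne k)
  have hn : 1 ≤ n := lt_of_le_of_lt (Nat.zero_le _) i.isLt
  obtain ⟨hlab, t1⟩ := readLabel_run h z i a hi ha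
  set s1 := (readLabel.run (encode z) s).1 with hs1
  have c1 : Consts n k β L τ s1 := h.run rfl
  have k1 : ∀ r < 18, s1.nreg r = s.nreg r := fun r hr => (run_regs (m := 18) rfl _ s hr).1
  have m1 : s1.rmem = s.rmem := run_rmem rfl _ s
  obtain ⟨⟨h22, h24, h25⟩, t2⟩ := predictPass_run (x := encode z) c1 hk hn
  set s2 := (predictPass.run (encode z) s1).1 with hs2
  have c2 : Consts n k β L τ s2 := c1.run rfl
  have k2 : ∀ r < 20, s2.nreg r = s1.nreg r := fun r hr => (run_regs (m := 20) rfl _ s1 hr).1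
  have kr2 : ∀ r < 20, s2.rreg r = s1.rreg r := fun r hr => (run_regs (m := 20) rfl _ s1 hr).2
  have m2 : s2.rmem = s1.rmem := run_rmem rfl _ s1
  have i1 : s1.nreg 10 = i := (k1 10 (by norm_num)).trans hi
  have i2 : s2.nreg 10 = i := (k2 10 (by norm_num)).trans i1
  set P := 2 * (((i : ℕ) * k + a) * (n * k)) with hPdef
  have p1 : s1.nreg 12 = P := (k1 12 (by norm_num)).trans hP
  have p2 : s2.nreg 12 = P := (k2 12 (by norm_num)).trans p1
  rw [p1, m1] at h22
  rw [i1, p1, m1] at h24 h25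
  obtain ⟨⟨u1, u2, u3⟩, t3⟩ := updatePass_run (x := encode z) c2 hk hn
    (fun j => by rw [i2]; exact masked_encode_lt z i j)
    (by rw [h22, m2, m1, p2]) (by rw [h24, m2, m1, p2, i2])
  rw [i2, p2, m2, m1] at u3
  rw [p2] at u1 u2
  rw [m2, m1] at u2
  set s3 := (updatePass.run (encode z) s2).1 with hs3
  have hrun : problem.run (encode z) s = (s3, (readLabel.run (encode z) s).2 +
      ((predictPass.run (encode z) s1).2 + (updatePass.run (encode z) s2).2)) := by
    unfold problem
    simp only [Program.run, ← hs1, ← hs2, ← hs3]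
  have hnk : 1 ≤ n * k := Nat.mul_pos hn hk
  have hsucc : ((i : ℕ) * k + a + 1) * (n * k) = (i * k + a) * (n * k) + n * k := by ring
  rw [hrun]
  refine ⟨⟨?_, by rw [u1, hsucc]; omega⟩, by simp only; omega⟩
  have hS : ∀ (j : Fin n) (b : Fin k), s.rmem (P + 2 * ((j : ℕ) * k + b)) =
      memScores n k f i a j b := fun j b => hu.rest _ (by omega)
  have hT : ∀ (j : Fin n) (b : Fin k), s.rmem (P + 2 * ((j : ℕ) * k + b) + 1) =
      memStats n k f i a j b := fun j b => hu.rest _ (by omega)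
  have hpred : storedPrediction n k L β (encode z) i s.rmem P =
      prediction L β (memScores n k f) i a z := storedPrediction_eq z i s.rmem P _ hS
  have h25' : s2.rreg 25 = residual L β (memScores n k f) i a z := by
    rw [h25, hlab, hpred]; rfl
  -- The blocks of earlier problems lie entirely below `P` and are left alone.
  have hother : ∀ (i' : Fin n) (a' : Fin k), (i' : ℕ) * k + a' < i * k + a → ∀ (j : Fin n)
      (b : Fin k), cellAddr n k i' a' j b + 1 < P := by
    intro i' a' hlt j b
    have e1 := row_add_lt hlt (row_add_lt j.isLt b.isLt)
    unfold cellAddr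
    omega
  constructor
  · intro c hc
    rw [u2 c (by omega)]
    exact hu.rest c (by omega)
  · intro i' a' hlt j b
    rcases Nat.lt_succ_iff_lt_or_eq.mp hlt with hlt' | heq
    · have := hother i' a' hlt' j b
      rw [u2 _ (by omega)]
      exact hu.scores i' a' hlt' j b
    · obtain ⟨rfl, rfl⟩ := block_index_inj heq
      refine (u3 j j.isLt b b.isLt).1.trans ?_
      rw [hS, h25', masked_encode]
      unfold nextScores
      simp only [Fin.ext_iff]
  · intro i' a' hlt j b
    rcases Nat.lt_succ_iff_lt_or_eq.mp hlt with hlt' | heq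
    · have := hother i' a' hlt' j b
      rw [u2 _ (by omega)]
      exact hu.stats i' a' hlt' j b
    · obtain ⟨rfl, rfl⟩ := block_index_inj heq
      refine (u3 j j.isLt b b.isLt).2.trans ?_
      rw [hT, kr2 18 (by norm_num), kr2 19 (by norm_num), hlab, masked_encode,
        storedLoo_eq z i' s.rmem P _ hS]
      unfold testTerm looPrediction prediction
      simp only [Fin.ext_iff, mul_ite, mul_one, mul_zero]

theorem variablePass_run [NeZero k] (h : Consts n k β L τ s) (z : Fin n → Fin k) (i : Fin n)
    (f : ℕ → ℝ) (hi : s.nreg 10 = i) (hP : s.nreg 12 = 2 * (((i : ℕ) * k) * (n * k)))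
    (hu : PartlyUpdated L β z f (i * k) s.rmem) :
    (PartlyUpdated L β z f ((i + 1) * k) (variablePass.run (encode z) s).1.rmem ∧
      (variablePass.run (encode z) s).1.nreg 12 = 2 * ((((i : ℕ) + 1) * k) * (n * k))) ∧
    (variablePass.run (encode z) s).2 ≤ 160 * (n * k * k) := by
  set x := encode z
  have hk : 1 ≤ k := Nat.pos_of_ne_zero (NeZero.ne k)
  have hn : 1 ≤ n := lt_of_le_of_lt (Nat.zero_le _) i.isLt
  set s1 := ((block [const 11 0]).run x s).1 with hs1
  have e1 : s1.nreg 11 = 0 ∧ s1.nreg 10 = i ∧ s1.nreg 12 = 2 * (((i : ℕ) * k) * (n * k)) ∧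
      s1.rmem = s.rmem := by
    rw [hs1, block_run]
    simp [Instr.exec, hi, hP]
  have c1 : Consts n k β L τ s1 := h.run rfl
  set body := seq problem (block [add 12 30 3, add 11 11 4]) with hbody
  have hl := loop_run_induction (x := x) (a := 1) (p := body) (s := s1)
    (fun m s' => Consts n k β L τ s' ∧ s'.nreg 10 = i ∧ s'.nreg 11 = m ∧
      s'.nreg 12 = 2 * (((i : ℕ) * k + m) * (n * k)) ∧ PartlyUpdated L β z f (i * k + m) s'.rmem)
    (150 * (n * k) + 3) ⟨c1, e1.2.1, e1.1, e1.2.2.1, by rw [e1.2.2.2]; exact hu⟩ ?_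
  swap
  · rintro m s' hm ⟨hc, h10, h11, h12, hu'⟩
    rw [c1.n1] at hm
    obtain ⟨⟨g1, g2⟩, g3⟩ := problem_run hc z i ⟨m, hm⟩ f h10 h11 h12 hu'
    have kn : ∀ r < 18, (problem.run x s').1.nreg r = s'.nreg r := fun r hr =>
      (run_regs (m := 18) rfl x s' hr).1
    set s'' := (problem.run x s').1 with hs''
    have hc'' : Consts n k β L τ s'' := hc.run rfl
    have hrun : body.run x s' = (((block [add 12 30 3, add 11 11 4]).run x s'').1,
        (problem.run x s').2 + 3) := by
      simp only [hbody, Program.run, ← hs'']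
      simp only [block_run, List.length_cons, List.length_nil]
    rw [hrun]
    refine ⟨⟨hc''.run rfl, ?_, ?_, ?_, ?_⟩, by simp only; exact Nat.add_le_add_right g3 3⟩
    · rw [block_run]; simp [Instr.exec, kn, h10]
    · rw [block_run]; simp [Instr.exec, kn, h11, hc.n4]
    · rw [block_run]; simp [Instr.exec, g2, hc''.n3, add_assoc]
    · rw [block_run]; exact g1
  rw [c1.n1] at hl
  obtain ⟨⟨-, -, -, h12, hu'⟩, t2⟩ := hl
  have hrun : variablePass.run x s = (((loop 1 body).run x s1).1,
      2 + ((loop 1 body).run x s1).2) := by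
    unfold variablePass
    simp only [Program.run, ← hs1]
    rfl
  have hs : ((i : ℕ) + 1) * k = i * k + k := by ring
  rw [hrun, hs]
  refine ⟨⟨hu', h12⟩, ?_⟩
  simp only
  have h1 : 1 ≤ n * k * k := Nat.mul_pos (Nat.mul_pos hn hk) hk
  have h2 : k ≤ n * k * k := Nat.le_mul_of_pos_left k (Nat.mul_pos hn hk)
  have h3 : k * (150 * (n * k) + 3 + 1) = 150 * (n * k * k) + 4 * k := by ring
  omega

theorem update_run [NeZero n] [NeZero k] (h : Consts n k β L τ s) (z : Fin n → Fin k) :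
    PartlyUpdated L β z s.rmem (n * k) (update.run (encode z) s).1.rmem ∧
    (update.run (encode z) s).2 ≤ 170 * (n * k * (n * k)) := by
  set x := encode z
  set f := s.rmem with hf
  have hk : 1 ≤ k := Nat.pos_of_ne_zero (NeZero.ne k)
  have hn : 1 ≤ n := Nat.pos_of_ne_zero (NeZero.ne n)
  set s1 := ((block [const 10 0, const 12 0]).run x s).1 with hs1
  have e1 : s1.nreg 10 = 0 ∧ s1.nreg 12 = 0 ∧ s1.rmem = f := by
    rw [hs1, block_run]
    simp [Instr.exec, hf]
  have c1 : Consts n k β L τ s1 := h.run rfl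
  set body := seq variablePass (block [add 10 10 4]) with hbody
  have hl := loop_run_induction (x := x) (a := 0) (p := body) (s := s1)
    (fun m s' => Consts n k β L τ s' ∧ s'.nreg 10 = m ∧
      s'.nreg 12 = 2 * ((m * k) * (n * k)) ∧ PartlyUpdated L β z f (m * k) s'.rmem)
    (160 * (n * k * k) + 2) ⟨c1, e1.1, by simp [e1.2.1], ?_⟩ ?_
  rotate_left
  · rw [e1.2.2, Nat.zero_mul]
    exact ⟨fun _ _ => rfl, fun _ _ h => absurd h (Nat.not_lt_zero _),
      fun _ _ h => absurd h (Nat.not_lt_zero _)⟩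
  · rintro m s' hm ⟨hc, h10, h12, hu'⟩
    rw [c1.n0] at hm
    obtain ⟨⟨g1, g2⟩, g3⟩ := variablePass_run hc z ⟨m, hm⟩ f h10 h12 hu'
    have k10 : (variablePass.run x s').1.nreg 10 = s'.nreg 10 :=
      (run_regs (m := 11) rfl x s' (by norm_num)).1
    set s'' := (variablePass.run x s').1 with hs''
    have hc'' : Consts n k β L τ s'' := hc.run rfl
    have hrun : body.run x s' = (((block [add 10 10 4]).run x s'').1,
        (variablePass.run x s').2 + 2) := by
      simp only [hbody, Program.run, ← hs'']
      simp only [block_run, List.length_cons, List.length_nil]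
    rw [hrun]
    refine ⟨⟨hc''.run rfl, ?_, ?_, ?_⟩, by simp only; exact Nat.add_le_add_right g3 2⟩
    · rw [block_run]; simp [Instr.exec, k10, h10, hc''.n4]
    · rw [block_run]; simp [Instr.exec, g2]
    · rw [block_run]; exact g1
  rw [c1.n0] at hl
  obtain ⟨⟨-, -, h12, hu'⟩, t2⟩ := hl
  have hrun : update.run x s = (((loop 0 body).run x s1).1,
      3 + ((loop 0 body).run x s1).2) := by
    unfold update
    simp only [Program.run, ← hs1]
    rfl
  rw [hrun]
  refine ⟨hu', ?_⟩
  simp only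
  have h1 : 1 ≤ n * k * (n * k) := Nat.mul_pos (Nat.mul_pos hn hk) (Nat.mul_pos hn hk)
  have h2 : n ≤ n * k * (n * k) := by
    calc n ≤ n * k := Nat.le_mul_of_pos_right n hk
      _ ≤ _ := Nat.le_mul_of_pos_right _ (Nat.mul_pos hn hk)
  have h3 : n * (160 * (n * k * k) + 2 + 1) = 160 * (n * k * (n * k)) + 3 * n := by ring
  omega

/-! ## Semantics of the final test -/

/-- The absolute value is tested by comparing `τ` with the statistic and then with its negative. -/
theorem testCell_run {x : ℕ → ℕ} (h : Consts n k β L τ s) :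
    (∀ q, q ∈ (testCell.run x s).1.edges ↔ q ∈ s.edges ∨
      (q = (s.nreg 10, s.nreg 21) ∧ τ < |s.rmem (s.nreg 30 + 1)|)) ∧
    (testCell.run x s).1.nreg 30 = s.nreg 30 + 2 ∧ (testCell.run x s).2 ≤ 8 := by
  set v := s.rmem (s.nreg 30 + 1) with hv
  unfold testCell
  simp only [Program.run, block_run, List.foldl_cons, List.foldl_nil, Instr.exec]
  by_cases h1 : τ < v
  · have h2 : τ < |v| := h1.trans_le (le_abs_self v)
    simp [h.n4, h.r5, ← hv, h1, h2, or_comm]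
  · by_cases h3 : τ < -v
    · have h2 : τ < |v| := h3.trans_le (neg_le_abs v)
      simp [h.n4, h.r5, h.r6, ← hv, h1, h2, h3, or_comm]
    · have h2 : ¬ τ < |v| := by rw [lt_abs]; tauto
      simp [h.n4, h.r5, h.r6, ← hv, h1, h2, h3]

theorem testRow_run {x : ℕ → ℕ} (h : Consts n k β L τ s) :
    ((∀ q, q ∈ ((loop 1 testCell).run x s).1.edges ↔ q ∈ s.edges ∨
      (q = (s.nreg 10, s.nreg 21) ∧ ∃ b < k, τ < |s.rmem (s.nreg 30 + 2 * b + 1)|)) ∧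
    ((loop 1 testCell).run x s).1.nreg 30 = s.nreg 30 + 2 * k) ∧
    ((loop 1 testCell).run x s).2 ≤ 1 + k * 9 := by
  have hl := loop_run_induction (x := x) (a := 1) (p := testCell) (s := s)
    (fun m s' => Consts n k β L τ s' ∧ s'.rmem = s.rmem ∧ s'.nreg 10 = s.nreg 10 ∧
      s'.nreg 21 = s.nreg 21 ∧ (∀ q, q ∈ s'.edges ↔ q ∈ s.edges ∨
      (q = (s.nreg 10, s.nreg 21) ∧ ∃ b < m, τ < |s.rmem (s.nreg 30 + 2 * b + 1)|)) ∧
      s'.nreg 30 = s.nreg 30 + 2 * m) 8 ⟨h, rfl, rfl, rfl, by simp, rfl⟩ ?_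
  · rw [h.n1] at hl
    exact ⟨hl.1.2.2.2.2, hl.2⟩
  · rintro m s' - ⟨hc, hm, h10, h21, he, h30⟩
    obtain ⟨g1, g2, g3⟩ := testCell_run (x := x) hc
    refine ⟨⟨hc.run rfl, (run_rmem rfl x s').trans hm,
      ((run_regs (m := 30) rfl x s' (by norm_num)).1).trans h10,
      ((run_regs (m := 30) rfl x s' (by norm_num)).1).trans h21, fun q => ?_, by omega⟩, g3⟩
    rw [g1, he, h10, h21, hm, h30]
    simp only [Nat.lt_succ_iff_lt_or_eq, or_and_right, exists_or, exists_eq_left]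
    rw [and_or_left, or_assoc]

theorem testProblem_run {x : ℕ → ℕ} (h : Consts n k β L τ s) (hk : 1 ≤ k) (hn : 1 ≤ n) :
    ((∀ q, q ∈ (testProblem.run x s).1.edges ↔ q ∈ s.edges ∨
      ∃ j < n, q = (s.nreg 10, j) ∧ ∃ b < k, τ < |s.rmem (s.nreg 30 + 2 * (j * k + b) + 1)|) ∧
    (testProblem.run x s).1.nreg 30 = s.nreg 30 + 2 * (n * k)) ∧
    (testProblem.run x s).2 ≤ 20 * (n * k) := by
  set s1 := ((block [const 21 0]).run x s).1 with hs1
  have e1 : s1.nreg 21 = 0 ∧ s1.nreg 10 = s.nreg 10 ∧ s1.nreg 30 = s.nreg 30 ∧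
      s1.rmem = s.rmem ∧ s1.edges = s.edges := by
    rw [hs1, block_run]
    simp [Instr.exec]
  have c1 : Consts n k β L τ s1 := h.run rfl
  set body := seq (loop 1 testCell) (block [add 21 21 4]) with hbody
  have hl := loop_run_induction (x := x) (a := 0) (p := body) (s := s1)
    (fun m s' => Consts n k β L τ s' ∧ s'.rmem = s.rmem ∧ s'.nreg 10 = s.nreg 10 ∧
      s'.nreg 21 = m ∧ (∀ q, q ∈ s'.edges ↔ q ∈ s.edges ∨
        ∃ j < m, q = (s.nreg 10, j) ∧ ∃ b < k, τ < |s.rmem (s.nreg 30 + 2 * (j * k + b) + 1)|) ∧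
      s'.nreg 30 = s.nreg 30 + 2 * (m * k)) (1 + k * 9 + 2)
    ⟨c1, e1.2.2.2.1, e1.2.1, e1.1, by simp [e1.2.2.2.2], by simp [e1.2.2.1]⟩ ?_
  swap
  · rintro m s' - ⟨hc, hm, h10, h21, he, h30⟩
    obtain ⟨⟨g1, g2⟩, g3⟩ := testRow_run (x := x) hc
    have kn : ∀ r < 30, ((loop 1 testCell).run x s').1.nreg r = s'.nreg r := fun r hr =>
      (run_regs (m := 30) rfl x s' hr).1
    have km : ((loop 1 testCell).run x s').1.rmem = s'.rmem := run_rmem rfl x s'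
    have hrun : body.run x s' = (((block [add 21 21 4]).run x ((loop 1 testCell).run x s').1).1,
        ((loop 1 testCell).run x s').2 + 2) := by
      rw [hbody]
      rfl
    set s'' := ((loop 1 testCell).run x s').1 with hs''
    have hc'' : Consts n k β L τ s'' := hc.run rfl
    rw [hrun]
    refine ⟨⟨hc''.run rfl, ?_, ?_, ?_, ?_, ?_⟩, by simp only; omega⟩
    · rw [block_run]; exact km.trans hm
    · rw [block_run]; simp [Instr.exec, kn, h10]
    · rw [block_run]; simp [Instr.exec, kn, h21, hc.n4]
    · intro q
      rw [block_run]
      simp only [List.foldl_cons, List.foldl_nil, Instr.exec]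
      rw [g1, he, h10, h21, hm]
      have haddr : ∀ b, s'.nreg 30 + 2 * b + 1 = s.nreg 30 + 2 * (m * k + b) + 1 := fun b => by
        rw [h30]; ring
      simp only [haddr, Nat.lt_succ_iff_lt_or_eq, or_and_right, exists_or, exists_eq_left]
      exact or_assoc
    · rw [block_run]; simp [Instr.exec, g2, h30]; ring
  rw [c1.n0] at hl
  obtain ⟨⟨-, -, -, -, he, h30⟩, t2⟩ := hl
  have hrun : testProblem.run x s = (((loop 0 body).run x s1).1,
      2 + ((loop 0 body).run x s1).2) := rfl
  rw [hrun]
  refine ⟨⟨he, h30⟩, ?_⟩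
  simp only
  have h1 : 1 ≤ n * k := Nat.mul_pos hn hk
  have h2 : n ≤ n * k := Nat.le_mul_of_pos_right n hk
  have h3 : n * (1 + k * 9 + 2 + 1) = 9 * (n * k) + 4 * n := by ring
  omega

theorem testVariable_run {x : ℕ → ℕ} (h : Consts n k β L τ s) (hk : 1 ≤ k) (hn : 1 ≤ n) :
    ((∀ q, q ∈ ((loop 1 testProblem).run x s).1.edges ↔ q ∈ s.edges ∨
      ∃ a < k, ∃ j < n, q = (s.nreg 10, j) ∧
        ∃ b < k, τ < |s.rmem (s.nreg 30 + 2 * (a * (n * k)) + 2 * (j * k + b) + 1)|) ∧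
    ((loop 1 testProblem).run x s).1.nreg 30 = s.nreg 30 + 2 * (k * (n * k))) ∧
    ((loop 1 testProblem).run x s).2 ≤ 1 + k * (20 * (n * k) + 1) := by
  have hl := loop_run_induction (x := x) (a := 1) (p := testProblem) (s := s)
    (fun m s' => Consts n k β L τ s' ∧ s'.rmem = s.rmem ∧ s'.nreg 10 = s.nreg 10 ∧
      (∀ q, q ∈ s'.edges ↔ q ∈ s.edges ∨
      ∃ a < m, ∃ j < n, q = (s.nreg 10, j) ∧
        ∃ b < k, τ < |s.rmem (s.nreg 30 + 2 * (a * (n * k)) + 2 * (j * k + b) + 1)|) ∧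
      s'.nreg 30 = s.nreg 30 + 2 * (m * (n * k))) (20 * (n * k))
      ⟨h, rfl, rfl, by simp, by simp⟩ ?_
  · rw [h.n1] at hl
    exact ⟨hl.1.2.2.2, hl.2⟩
  · rintro m s' - ⟨hc, hm, h10, he, h30⟩
    obtain ⟨⟨g1, g2⟩, g3⟩ := testProblem_run (x := x) hc hk hn
    refine ⟨⟨hc.run rfl, (run_rmem rfl x s').trans hm,
      ((run_regs (m := 20) rfl x s' (by norm_num)).1).trans h10, fun q => ?_, ?_⟩, g3⟩
    · rw [g1, he, h10, hm, h30]
      simp only [Nat.lt_succ_iff_lt_or_eq, or_and_right, exists_or, exists_eq_left]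
      exact or_assoc
    · rw [g2, h30]; ring

theorem finish_run {x : ℕ → ℕ} (h : Consts n k β L τ s) (hk : 1 ≤ k) (hn : 1 ≤ n) :
    (∀ q, q ∈ (finish.run x s).1.edges ↔ q ∈ s.edges ∨
      ∃ i < n, ∃ a < k, ∃ j < n, q = (i, j) ∧
        ∃ b < k, τ < |s.rmem (cellAddr n k i a j b + 1)|) ∧
    (finish.run x s).2 ≤ 40 * (n * k * (n * k)) := by
  set s1 := ((block [const 10 0, const 30 0]).run x s).1 with hs1
  have e1 : s1.nreg 10 = 0 ∧ s1.nreg 30 = 0 ∧ s1.rmem = s.rmem ∧ s1.edges = s.edges := by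
    rw [hs1, block_run]
    simp [Instr.exec]
  have c1 : Consts n k β L τ s1 := h.run rfl
  set body := seq (loop 1 testProblem) (block [add 10 10 4]) with hbody
  have hl := loop_run_induction (x := x) (a := 0) (p := body) (s := s1)
    (fun m s' => Consts n k β L τ s' ∧ s'.rmem = s.rmem ∧ s'.nreg 10 = m ∧
      (∀ q, q ∈ s'.edges ↔ q ∈ s.edges ∨
        ∃ i < m, ∃ a < k, ∃ j < n, q = (i, j) ∧
          ∃ b < k, τ < |s.rmem (cellAddr n k i a j b + 1)|) ∧
      s'.nreg 30 = 2 * (m * k * (n * k))) (1 + k * (20 * (n * k) + 1) + 2)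
    ⟨c1, e1.2.2.1, e1.1, by simp [e1.2.2.2], by simp [e1.2.1]⟩ ?_
  swap
  · rintro m s' - ⟨hc, hm, h10, he, h30⟩
    obtain ⟨⟨g1, g2⟩, g3⟩ := testVariable_run (x := x) hc hk hn
    have k10 : ((loop 1 testProblem).run x s').1.nreg 10 = s'.nreg 10 :=
      (run_regs (m := 20) rfl x s' (by norm_num)).1
    have km : ((loop 1 testProblem).run x s').1.rmem = s'.rmem := run_rmem rfl x s'
    have hrun : body.run x s' = (((block [add 10 10 4]).run x
        ((loop 1 testProblem).run x s').1).1, ((loop 1 testProblem).run x s').2 + 2) := by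
      rw [hbody]
      rfl
    set s'' := ((loop 1 testProblem).run x s').1 with hs''
    have hc'' : Consts n k β L τ s'' := hc.run rfl
    rw [hrun]
    refine ⟨⟨hc''.run rfl, ?_, ?_, ?_, ?_⟩, by simp only; omega⟩
    · rw [block_run]; exact km.trans hm
    · rw [block_run]; simp [Instr.exec, k10, h10, hc''.n4]
    · intro q
      rw [block_run]
      simp only [List.foldl_cons, List.foldl_nil, Instr.exec]
      rw [g1, he, h10, hm]
      have haddr : ∀ a j b, s'.nreg 30 + 2 * (a * (n * k)) + 2 * (j * k + b) + 1 =
          cellAddr n k m a j b + 1 := fun a j b => by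
        rw [h30]; unfold cellAddr; ring
      simp only [haddr, Nat.lt_succ_iff_lt_or_eq, or_and_right, exists_or, exists_eq_left]
      exact or_assoc
    · rw [block_run]; simp [Instr.exec, g2, h30]; ring
  rw [c1.n0] at hl
  obtain ⟨⟨-, -, -, he, -⟩, t2⟩ := hl
  have hrun : finish.run x s = (((loop 0 body).run x s1).1,
      3 + ((loop 0 body).run x s1).2) := rfl
  rw [hrun]
  refine ⟨he, ?_⟩
  simp only
  have hnk : 1 ≤ n * k := Nat.mul_pos hn hk
  have h1 : 1 ≤ n * k * (n * k) := Nat.mul_pos hnk hnk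
  have h2 : n ≤ n * k * (n * k) :=
    (Nat.le_mul_of_pos_right n hk).trans (Nat.le_mul_of_pos_right _ hnk)
  have h4 : n * k ≤ n * k * (n * k) := Nat.le_mul_of_pos_right _ hnk
  have h3 : n * (1 + k * (20 * (n * k) + 1) + 2 + 1) =
      20 * (n * k * (n * k)) + n * k + 4 * n := by ring
  omega

end Learner

end RealRAM

/-! ### The whole run: invariant, time, space and output -/

namespace RealRAM

namespace Learner

open Program Instr NonbinaryIsing StructureLearner

variable {n k N : ℕ} {lam η ρ : ℝ}

theorem setup_run (x : ℕ → ℕ) :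
    Consts n k (stepSize k lam η) (2 * lam) (threshold k N lam η)
      (setup.run x (Input.state ⟨n, k, N, lam, η, ρ⟩)).1 ∧
    (setup.run x (Input.state ⟨n, k, N, lam, η, ρ⟩)).2 = 26 := by
  unfold setup
  rw [block_run]
  refine ⟨?_, rfl⟩
  constructor
  · simp [Instr.exec, Input.state]
  · simp [Instr.exec, Input.state]
  · simp [Instr.exec, Input.state]
  · simp [Instr.exec]
  · simp only [Instr.exec, Input.state, List.foldl_cons, List.foldl_nil, Function.update_apply]
    norm_num [stepSize]
    ring
  · simp [Instr.exec, Input.state, two_mul]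
  · simp only [Instr.exec, Input.state, List.foldl_cons, List.foldl_nil, Function.update_apply]
    norm_num [threshold]
    ring
  · simp [Instr.exec, Input.state]
  · simp [Instr.exec]
  · simp [Instr.exec, Input.state]

theorem sample_eq [NeZero k] (Z : Fin N → Fin n → Fin k) {t : ℕ} (ht : t < N) :
    OnlineAlgorithm.sample ⟨n, k, N, lam, η, ρ⟩ Z t = encode (extendSeq Z t) := by
  unfold OnlineAlgorithm.sample extendSeq
  rw [dif_pos ht, dif_pos ht]

/-- The state before sample `t`. -/
structure StateInv (n k N : ℕ) [NeZero k] (lam η : ℝ) (z : ℕ → Fin n → Fin k) (t : ℕ)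
    (s : State) : Prop where
  consts : Consts n k (stepSize k lam η) (2 * lam) (threshold k N lam η) s
  nmem : s.nmem = fun _ => 0
  edges : s.edges = ∅
  rest : ∀ c, 2 * (n * k * (n * k)) ≤ c → s.rmem c = 0
  scores : memScores n k s.rmem = scores (2 * lam) (stepSize k lam η) z t
  stats : memStats n k s.rmem = testStat (2 * lam) (stepSize k lam η) z t

theorem block_index_lt (i : Fin n) (a : Fin k) : (i : ℕ) * k + a < n * k :=
  row_add_lt i.isLt a.isLt

variable [NeZero n] [NeZero k] (Z : Fin N → Fin n → Fin k)

/-- Score updates and test increments both refer to the scores before the sample, so one run of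
`update` is one step of `scan` and one summand of `testStat`. -/
theorem stateAfter_inv {t : ℕ} (ht : t ≤ N) :
    StateInv n k N lam η (extendSeq Z) t
      (algorithm.stateAfter ⟨n, k, N, lam, η, ρ⟩ Z t) := by
  induction t with
  | zero =>
    have hm : (setup.run noSample (Input.state ⟨n, k, N, lam, η, ρ⟩)).1.rmem = fun _ => 0 :=
      run_rmem rfl _ _
    have hs := run_silent (p := setup) rfl noSample (Input.state ⟨n, k, N, lam, η, ρ⟩)
    refine ⟨(setup_run noSample).1, hs.1, hs.2, fun c _ => congrFun hm c, ?_, ?_⟩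
    · funext i a j b
      exact congrFun hm _
    · funext i a j b
      simp only [testStat, Finset.range_zero, Finset.sum_empty]
      exact congrFun hm _
  | succ t ih =>
    have h := ih (by omega)
    have hrun : algorithm.stateAfter ⟨n, k, N, lam, η, ρ⟩ Z (t + 1) =
        (update.run (encode (extendSeq Z t))
          (algorithm.stateAfter ⟨n, k, N, lam, η, ρ⟩ Z t)).1 := by
      rw [← sample_eq (lam := lam) (η := η) (ρ := ρ) Z (by omega : t < N)]
      rfl
    rw [hrun]
    set s := algorithm.stateAfter ⟨n, k, N, lam, η, ρ⟩ Z t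
    have hu := (update_run h.consts (extendSeq Z t)).1
    have hs := run_silent (p := update) rfl (encode (extendSeq Z t)) s
    refine ⟨h.consts.run rfl, hs.1.trans h.nmem, hs.2.trans h.edges,
      fun c hc => (hu.rest c hc).trans (h.rest c hc), ?_, ?_⟩
    · funext i a j b
      refine (hu.scores i a (block_index_lt i a) j b).trans ?_
      rw [h.scores]
      rfl
    · funext i a j b
      refine (hu.stats i a (block_index_lt i a) j b).trans ?_
      rw [h.scores, h.stats]
      simp only [testStat, Finset.sum_range_succ]

theorem updateTime_le {t : ℕ} (ht : t < N) :
    algorithm.updateTime ⟨n, k, N, lam, η, ρ⟩ Z t ≤ 170 * (n * k * (n * k)) := by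
  have h := stateAfter_inv (lam := lam) (η := η) (ρ := ρ) Z ht.le
  unfold OnlineAlgorithm.updateTime
  rw [sample_eq Z ht]
  exact (update_run h.consts (extendSeq Z t)).2

/-- As N ≥ 1, setup and final test can be charged to the samples: 26 + 170 + 40 ≤ 240. -/
theorem totalTime_le (hN : 1 ≤ N) :
    algorithm.totalTime ⟨n, k, N, lam, η, ρ⟩ Z ≤ 240 * (n * k * (n * k)) * N := by
  have hk : 1 ≤ k := Nat.pos_of_ne_zero (NeZero.ne k)
  have hn : 1 ≤ n := Nat.pos_of_ne_zero (NeZero.ne n)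
  have h := stateAfter_inv (lam := lam) (η := η) (ρ := ρ) Z le_rfl
  have h1 : (algorithm.setup.run noSample (Input.state ⟨n, k, N, lam, η, ρ⟩)).2 = 26 :=
    (setup_run noSample).2
  have h2 : ∑ t ∈ Finset.range N, algorithm.updateTime ⟨n, k, N, lam, η, ρ⟩ Z t ≤
      N * (170 * (n * k * (n * k))) := by
    refine (Finset.sum_le_card_nsmul _ _ _ fun t ht =>
      updateTime_le Z (Finset.mem_range.mp ht)).trans (le_of_eq ?_)
    simp
  have h3 : (algorithm.finish.run noSample
      (algorithm.stateAfter ⟨n, k, N, lam, η, ρ⟩ Z N)).2 ≤ 40 * (n * k * (n * k)) :=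
    (finish_run h.consts hk hn).2
  have h4 : 1 ≤ n * k * (n * k) := Nat.mul_pos (Nat.mul_pos hn hk) (Nat.mul_pos hn hk)
  unfold OnlineAlgorithm.totalTime
  have h5 : n * k * (n * k) ≤ n * k * (n * k) * N := Nat.le_mul_of_pos_right _ hN
  have h6 : N * (170 * (n * k * (n * k))) = 170 * (n * k * (n * k) * N) := by ring
  have h7 : 240 * (n * k * (n * k)) * N = 240 * (n * k * (n * k) * N) := by ring
  rw [h7]
  rw [h6] at h2
  have h8 : ∑ t ∈ Finset.range (Input.N ⟨n, k, N, lam, η, ρ⟩),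
      algorithm.updateTime ⟨n, k, N, lam, η, ρ⟩ Z t ≤ 170 * (n * k * (n * k) * N) := h2
  rw [h1]
  have h9 := add_le_add (add_le_add (le_refl 26) h8) h3
  exact h9.trans (by omega)

theorem usesSpace :
    algorithm.UsesSpace ⟨n, k, N, lam, η, ρ⟩ Z (2 * (n * k * (n * k))) := by
  intro t ht c hc
  have h := stateAfter_inv (lam := lam) (η := η) (ρ := ρ) Z ht
  exact ⟨congrFun h.nmem c, h.rest c hc⟩

/-- `SimpleGraph.fromRel` symmetrises and drops loops, so emitted pairs (i, i) do no harm. -/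
theorem graph_adj_iff (i j : Fin n) :
    (algorithm.graph ⟨n, k, N, lam, η, ρ⟩ Z).Adj i j ↔
      i ≠ j ∧ (Detects n k N lam η (extendSeq Z) i j ∨ Detects n k N lam η (extendSeq Z) j i) := by
  have hk : 1 ≤ k := Nat.pos_of_ne_zero (NeZero.ne k)
  have hn : 1 ≤ n := Nat.pos_of_ne_zero (NeZero.ne n)
  have h := stateAfter_inv (lam := lam) (η := η) (ρ := ρ) Z le_rfl
  have hd : ∀ i j : Fin n, ((i : ℕ), (j : ℕ)) ∈ (algorithm.finish.run noSample
      (algorithm.stateAfter ⟨n, k, N, lam, η, ρ⟩ Z N)).1.edges ↔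
      Detects n k N lam η (extendSeq Z) i j := by
    intro i j
    refine ((finish_run h.consts hk hn).1 _).trans ?_
    rw [h.edges]
    have hst : ∀ (a b : Fin k), (algorithm.stateAfter ⟨n, k, N, lam, η, ρ⟩ Z N).rmem
        (cellAddr n k i a j b + 1) =
        testStat (2 * lam) (stepSize k lam η) (extendSeq Z) N i a j b := fun a b =>
      congrFun (congrFun (congrFun (congrFun h.stats i) a) j) b
    constructor
    · rintro (h0 | ⟨i', -, a, ha, j', -, hq, b, hb, hlt⟩)
      · exact absurd h0 (Set.notMem_empty _)
      · obtain ⟨rfl, rfl⟩ := Prod.mk.inj hq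
        refine ⟨⟨a, ha⟩, ⟨b, hb⟩, ?_⟩
        rw [← hst]
        exact hlt
    · rintro ⟨a, b, hlt⟩
      rw [← hst] at hlt
      exact Or.inr ⟨i, i.isLt, a, a.isLt, j, j.isLt, rfl, b, b.isLt, hlt⟩
  unfold OnlineAlgorithm.graph
  rw [SimpleGraph.fromRel_adj]
  exact and_congr Iff.rfl (or_congr (hd i j) (hd j i))

end Learner

end RealRAM

open RealRAM.Learner StructureLearner in
theorem mainTheorem7 :
    ∃ (A : RealRAM.OnlineAlgorithm) (C : ℝ) (m : ℕ → ℕ → ℕ), 0 < C ∧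
      ∀ (n k N : ℕ) [NeZero n] [NeZero k] (lam η ρ : ℝ),
        0 < η → η < 1 → 0 < ρ → ρ < 1 →
        C * Real.exp (C * lam) / η ^ 4 * (k : ℝ) ^ 3 * Real.log (n / (ρ * η)) ≤ N →
        (∀ Z : Fin N → Fin n → Fin k,
          (∀ t < N, (A.updateTime ⟨n, k, N, lam, η, ρ⟩ Z t : ℝ) ≤ C * (k : ℝ) ^ 2 * (n : ℝ) ^ 2) ∧
          (A.totalTime ⟨n, k, N, lam, η, ρ⟩ Z : ℝ) ≤ C * (k : ℝ) ^ 2 * (n : ℝ) ^ 2 * N ∧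
          A.UsesSpace ⟨n, k, N, lam, η, ρ⟩ Z (m n k)) ∧
        ∀ D : NonbinaryIsing n k, D.width ≤ lam → D.IsCentered → D.IsIdentifiable η →
          ENNReal.ofReal (1 - ρ) ≤
            Measure.pi (fun _ : Fin N => D.dist.toMeasure)
              {Z | A.graph ⟨n, k, N, lam, η, ρ⟩ Z = D.dependencyGraph} := by
  -- 2^40 is the constant of `Regime`; it also exceeds the exponent 60 of e^λ there and the time
  -- constants 170 and 240.
  refine ⟨algorithm, 2 ^ 40, fun n k => 2 * (n * k * (n * k)), by norm_num, ?_⟩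
  intro n k N _ _ lam η ρ hη0 hη1 hρ0 hρ1 hN
  have hk : (1 : ℝ) ≤ k := by exact_mod_cast Nat.pos_of_ne_zero (NeZero.ne k)
  have hn : (1 : ℝ) ≤ n := by exact_mod_cast Nat.pos_of_ne_zero (NeZero.ne n)
  have hlog : 0 < Real.log (n / (ρ * η)) := by
    refine Real.log_pos ?_
    rw [lt_div_iff₀ (mul_pos hρ0 hη0)]
    nlinarith
  have hN1 : 1 ≤ N := by
    have h : (0 : ℝ) < N := lt_of_lt_of_le (by positivity) hN
    exact_mod_cast h
  refine ⟨fun Z => ⟨fun t ht => ?_, ?_, usesSpace Z⟩, fun D hlam hD hI => ?_⟩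
  · have h : (algorithm.updateTime ⟨n, k, N, lam, η, ρ⟩ Z t : ℝ) ≤
        ((170 * (n * k * (n * k)) : ℕ) : ℝ) := by exact_mod_cast updateTime_le Z ht
    refine h.trans ?_
    push_cast
    have : (0 : ℝ) ≤ (k : ℝ) ^ 2 * (n : ℝ) ^ 2 := by positivity
    nlinarith
  · have h : (algorithm.totalTime ⟨n, k, N, lam, η, ρ⟩ Z : ℝ) ≤
        ((240 * (n * k * (n * k)) * N : ℕ) : ℝ) := by exact_mod_cast totalTime_le Z hN1
    refine h.trans ?_
    push_cast
    have : (0 : ℝ) ≤ (k : ℝ) ^ 2 * (n : ℝ) ^ 2 * N := by positivity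
    nlinarith
  -- For n = 1 both graphs are empty; `Regime` requires n ≥ 2.
  · rcases Nat.lt_or_ge n 2 with hn2 | hn2
    · have hn' : n = 1 := by
        have := Nat.pos_of_ne_zero (NeZero.ne n)
        omega
      subst hn'
      have huniv : {Z | algorithm.graph ⟨1, k, N, lam, η, ρ⟩ Z = D.dependencyGraph} =
          Set.univ := Set.eq_univ_of_forall fun Z => by
        show algorithm.graph ⟨1, k, N, lam, η, ρ⟩ Z = D.dependencyGraph
        ext i j
        have hij : i = j := Subsingleton.elim i j
        subst hij
        exact iff_of_false (SimpleGraph.irrefl _) (SimpleGraph.irrefl _)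
      rw [huniv, measure_univ]
      exact ENNReal.ofReal_le_one.mpr (by linarith)
    -- The sign of λ comes from the existence of a model of width at most λ.
    · have hlam0 : 0 ≤ lam := D.width_nonneg.trans hlam
      have hexp : Real.exp lam ^ 60 ≤ Real.exp (2 ^ 40 * lam) := by
        rw [← Real.exp_nat_mul]
        refine Real.exp_le_exp.mpr ?_
        push_cast
        nlinarith
      have R : Regime n k N lam η ρ := by
        refine ⟨hn2, hlam0, hη0, hη1, hρ0, hρ1, ?_⟩
        rw [div_mul_eq_mul_div, div_mul_eq_mul_div, div_le_iff₀ (by positivity)] at hN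
        refine le_trans ?_ hN
        gcongr
      refine (le_measure_detects D R hD hlam hI).trans (measure_mono fun Z hZ => ?_)
      show algorithm.graph ⟨n, k, N, lam, η, ρ⟩ Z = D.dependencyGraph
      ext i j
      rw [graph_adj_iff]
      constructor
      · rintro ⟨hij, h | h⟩
        · exact (hZ i j hij.symm).mp h
        · exact ((hZ j i hij).mp h).symm
      · intro h
        exact ⟨h.ne, Or.inl ((hZ i j h.ne.symm).mpr h)⟩
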